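/- Let $\zeta$ be the Riemann zeta function, let $0<r<1/4$ be fixed and put $\sigma(r)=\tfrac34-r$. Then there exist positive constants $b_1,b_2,b_3$ and $C$, depending only on $r$, such that for all real $T\ge 3$ and all real $V$ with $$b_2<V\le b_3\,\frac{(\log T)^{1-\sigma(r)}}{\log\log T}$$ we have $$\frac1T\,\mathrm{meas}\Big\{t\in[T,2T]:\ \max_{|z|\le r}\big|\zeta'(\tfrac34+it+z)\big|>e^V\Big\}\le C\exp\Big(-b_1V^{\frac1{1-\sigma(r)}}(\log V)^{\frac{\sigma(r)}{1-\sigma(r)}}\Big),$$ where $\mathrm{meas}$ denotes Lebesgue measure on $\mathbb R$. -/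

import Mathlib

open Complex MeasureTheory

noncomputable section

/-- The abscissa `σ(r) = 3/4 - r` of the leftmost point of the disc `|s - 3/4| ≤ r`. -/
def sigmaOf (r : ℝ) : ℝ := 3 / 4 - r

/-- The normalised Lebesgue measure `ℙ_T(S) = meas(S) / T` of the part of `S` in `[T, 2T]`. -/
def probT (T : ℝ) (S : Set ℝ) : ℝ :=
  (1 / T) * volume.real (Set.Icc T (2 * T) ∩ S)

/-- `max_{|z| ≤ r} |ζ'(3/4 + it + z)|`. -/
def maxZetaDeriv (r t : ℝ) : ℝ :=
  sSup ((fun z : ℂ => ‖deriv riemannZeta (3 / 4 + I * (t : ℂ) + z)‖) '' Metric.closedBall 0 r)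

/-- For `0 ≤ r < 1/4` the supremum in `maxZetaDeriv` is an attained maximum. -/
theorem isGreatest_maxZetaDeriv {r : ℝ} (hr0 : 0 ≤ r) (hr : r < 1 / 4) (t : ℝ) :
    IsGreatest ((fun z : ℂ => ‖deriv riemannZeta (3 / 4 + I * (t : ℂ) + z)‖) ''
      Metric.closedBall 0 r) (maxZetaDeriv r t) := by
  have hd : DifferentiableOn ℂ riemannZeta {1}ᶜ := fun s hs =>
    (differentiableAt_riemannZeta hs).differentiableWithinAt
  have hd' : ContinuousOn (deriv riemannZeta) {1}ᶜ :=
    (hd.deriv isOpen_compl_singleton).continuousOn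
  have hc : ContinuousOn (fun z : ℂ => ‖deriv riemannZeta (3 / 4 + I * (t : ℂ) + z)‖)
      (Metric.closedBall 0 r) := by
    refine (hd'.comp (by fun_prop) ?_).norm
    intro z hz h1
    have h2 := congrArg Complex.re (Set.mem_singleton_iff.mp h1)
    have h3 : (3 / 4 : ℂ).re = 3 / 4 := by norm_num
    have h4 := (Complex.re_le_norm z).trans (mem_closedBall_zero_iff.mp hz)
    simp [h3] at h2
    linarith
  exact ((isCompact_closedBall (0 : ℂ) r).image_of_continuousOn hc).isGreatest_sSup
    ((Metric.nonempty_closedBall.mpr hr0).image _)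

end

/-! Put `σ = sigmaOf r`, so `1/2 < σ < 3/4`. The disc of radius `r` about `3/4 + it` lies in the
disc of radius `3 - σ` about `3 + it`, and any radius below `5/2` about that centre stays in the
half-plane `Re s > 1/2`. Cauchy's estimate (`maxZetaDeriv_le`) reduces the derivative to `ζ` on a
disc larger by `ε = 1 / log k`, at the cost of a factor `log k`. The integer `k` is of order
`V^(1/(1-σ)) (log V)^(σ/(1-σ))`, so the required bound is a constant times `e^(-k)`.

Outside a small set of `t`, `log |ζ|` is at most a constant plus a prime sum `|∑_{p<N} p^(-z)|` of
length only `N = (log T)^A` (`exists_norm_zeta_le_exp_primeSum`). The product `f = ζ · ∏_{p<N} (1 -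
p^(-z))` is within a negative power of `log T` of `1` on the unit disc about `3 + it`, and is at
most `T^O(1)` on a larger disc. If `ζ` has no zero there, a logarithm of `f` exists, and
Borel–Carathéodory with the three circles theorem makes its real part `O(1)` on the intermediate
disc (`norm_le_exp_of_ne_zero`).

Three exceptional sets remain. Zeros of `ζ` in the disc occur on a set of measure `O(T^(1-c))`: the
mean square of `ζM - 1`, with `M` a short Möbius mollifier, saves a power of `T`, whereas `ζM - 1 =
-1` at a zero (`exists_measure_zeta_zero_le`). The prime sum reaches `log T` on the larger disc only
on a set of measure `O(T e^(-k))` (`exists_measure_log_le_primeSum_le`). It reaches a small multiple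
of `V` on the smaller disc equally rarely (`exists_measure_primeSum_large_le`): primes up to `k log
k` are bounded trivially, the others through the `2k`-th moment, whose diagonal terms contribute `k!
(∑ p^(-2 Re z))^k`. These moments require `N^(2k) ≤ T`, that is `k log log T ≪ log T`, which is what
the upper limit for `V` provides.

All passages from mean values on vertical lines to maxima over discs go through
`measure_large_values_le`. -/

/-! ### Zero-free holomorphic functions: logarithms, three circles and growth. -/

/-- A primitive `h` of `f'/f` exists on a disc, and `e^(-h) f` then has zero derivative; the value
at the centre fixes the constant. -/
theorem exists_log_of_ne_zero {f : ℂ → ℂ} {c : ℂ} {R : ℝ} (hR : 0 < R)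
    (hf : DifferentiableOn ℂ f (Metric.ball c R)) (h0 : ∀ z ∈ Metric.ball c R, f z ≠ 0) :
    ∃ h : ℂ → ℂ, h c = Complex.log (f c) ∧
      ∀ z ∈ Metric.ball c R, HasDerivAt h (deriv f z / f z) z ∧ Complex.exp (h z) = f z := by
  have hd : DifferentiableOn ℂ (fun z => deriv f z / f z) (Metric.ball c R) :=
    (hf.deriv Metric.isOpen_ball).div hf h0
  obtain ⟨h, hc, hh⟩ := hd.isExactOn_ball.with_val_at c (Complex.log (f c))
  refine ⟨h, hc, fun z hz => ⟨hh z hz, ?_⟩⟩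
  have hcm : c ∈ Metric.ball c R := Metric.mem_ball_self hR
  have hfd : ∀ w ∈ Metric.ball c R, HasDerivAt f (deriv f w) w := fun w hw =>
    (hf.differentiableAt (Metric.isOpen_ball.mem_nhds hw)).hasDerivAt
  have hg : ∀ w ∈ Metric.ball c R,
      HasDerivAt (fun z => Complex.exp (-h z) * f z) 0 w := by
    intro w hw
    have := ((hh w hw).fun_neg.cexp).mul (hfd w hw)
    convert! this using 1
    field_simp [h0 w hw]
    ring
  have hconst := (convex_ball c R).is_const_of_fderivWithin_eq_zero (𝕜 := ℂ)
    (f := fun z => Complex.exp (-h z) * f z)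
    (fun w hw => (hg w hw).differentiableAt.differentiableWithinAt) (by
      intro w hw
      rw [fderivWithin_of_isOpen Metric.isOpen_ball hw]
      ext
      simpa using (hg w hw).deriv) hz hcm
  simp only [hc, Complex.exp_neg, Complex.exp_log (h0 c hcm)] at hconst
  rw [inv_mul_cancel₀ (h0 c hcm)] at hconst
  have := Complex.exp_ne_zero (h z)
  field_simp at hconst
  exact hconst.symm

/-- Where `f` stays within `1/2` of `1` the principal logarithm is holomorphic. It has the same
derivative as `h` and the same value at the centre, so it equals `h`, and `|log (1 + u)| ≤ (3/2)
|u|` applies. -/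
theorem norm_log_branch_le {f h : ℂ → ℂ} {c : ℂ} {η : ℝ} (hη : η ≤ 1 / 2) {r : ℝ} (hr : 0 ≤ r)
    (hf : ∀ z ∈ Metric.closedBall c r, DifferentiableAt ℂ f z)
    (hh : ∀ z ∈ Metric.closedBall c r, HasDerivAt h (deriv f z / f z) z)
    (hc : h c = Complex.log (f c))
    (hf1 : ∀ z ∈ Metric.closedBall c r, ‖f z - 1‖ ≤ η) :
    ∀ z ∈ Metric.closedBall c r, ‖h z‖ ≤ 2 * η := by
  intro z hz
  have hslit : ∀ w ∈ Metric.closedBall c r, f w ∈ Complex.slitPlane := by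
    intro w hw
    left
    have h1 := (abs_re_le_norm (f w - 1)).trans (hf1 w hw)
    rw [sub_re, one_re] at h1
    linarith [(abs_le.mp h1).1]
  have hder : ∀ w ∈ Metric.closedBall c r,
      HasDerivAt (fun z => h z - Complex.log (f z)) 0 w := by
    intro w hw
    have := (hh w hw).fun_sub ((hf w hw).hasDerivAt.clog (hslit w hw))
    simpa using this
  have hcm : c ∈ Metric.closedBall c r := Metric.mem_closedBall_self hr
  have hb := (convex_closedBall c r).norm_image_sub_le_of_norm_hasDerivWithin_le
    (C := 0) (fun w hw => (hder w hw).hasDerivWithinAt) (by simp) hcm hz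
  have heq : h z = Complex.log (f z) := by
    have h2 : (h z - Complex.log (f z)) - (h c - Complex.log (f c)) = 0 := by
      simpa using hb
    rw [hc, sub_self, sub_zero] at h2
    exact sub_eq_zero.mp h2
  have h3 := Complex.norm_log_one_add_half_le_self (z := f z - 1) ((hf1 z hz).trans hη)
  rw [heq]
  have h4 := hf1 z hz
  have h5 : 1 + (f z - 1) = f z := by ring
  rw [h5] at h3
  have := norm_nonneg (f z - 1)
  linarith

/-- Hadamard's three circles theorem, for circles of radii `1` and `R`. -/
theorem three_circles {h : ℂ → ℂ} {c : ℂ} {R a b : ℝ} (hR : 1 < R)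
    (hd : ∀ z ∈ Metric.closedBall c R, DifferentiableAt ℂ h z)
    (ha : ∀ z ∈ Metric.closedBall c 1, ‖h z‖ ≤ a)
    (hb : ∀ z ∈ Metric.closedBall c R, ‖h z‖ ≤ b) {z : ℂ} (hz1 : 1 ≤ ‖z - c‖)
    (hzR : ‖z - c‖ ≤ R) :
    ‖h z‖ ≤ a ^ (1 - Real.log ‖z - c‖ / Real.log R) * b ^ (Real.log ‖z - c‖ / Real.log R) := by
  have hlR : 0 < Real.log R := Real.log_pos hR
  -- The exponential maps the strip `0 ≤ Re u ≤ log R` onto the annulus, which turns three circles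
  -- into three lines.
  set F : ℂ → ℂ := fun u => h (c + Complex.exp u) with hF
  have hmem : ∀ u : ℂ, u.re ≤ Real.log R → c + Complex.exp u ∈ Metric.closedBall c R := by
    intro u hu
    rw [mem_closedBall_iff_norm, add_sub_cancel_left, Complex.norm_exp]
    calc Real.exp u.re ≤ Real.exp (Real.log R) := Real.exp_le_exp.mpr hu
      _ = R := Real.exp_log (by linarith)
  have hne : z - c ≠ 0 := by
    intro h0
    rw [h0, norm_zero] at hz1
    linarith
  have hFd : ∀ u : ℂ, u.re ≤ Real.log R → DifferentiableAt ℂ F u := by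
    intro u hu
    have h1 : DifferentiableAt ℂ (fun u => c + Complex.exp u) u := by fun_prop
    exact DifferentiableAt.comp u (hd _ (hmem u hu)) h1
  have hre : (Complex.log (z - c)).re = Real.log ‖z - c‖ := Complex.log_re _
  have hl0 : 0 ≤ Real.log ‖z - c‖ := Real.log_nonneg hz1
  have hlz : Real.log ‖z - c‖ ≤ Real.log R := Real.log_le_log (by linarith) hzR
  have key := Complex.HadamardThreeLines.norm_le_interp_of_mem_verticalClosedStrip'
    (f := F) (z := Complex.log (z - c)) (a := a) (b := b) (l := 0) (u := Real.log R) hlR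
    (by
      simp only [Complex.HadamardThreeLines.verticalClosedStrip, Set.mem_preimage, Set.mem_Icc, hre]
      exact ⟨hl0, hlz⟩)
    (by
      apply DifferentiableOn.diffContOnCl
      intro u hu
      refine (hFd u ?_).differentiableWithinAt
      have h2 := Complex.continuous_re.closure_preimage_subset _ hu
      rw [closure_Ioo hlR.ne] at h2
      exact h2.2)
    ⟨b, by
      rintro _ ⟨u, hu, rfl⟩
      exact hb _ (hmem u hu.2)⟩
    (by
      intro u hu
      apply ha
      have hu' : u.re = 0 := hu
      rw [mem_closedBall_iff_norm, add_sub_cancel_left, Complex.norm_exp, hu', Real.exp_zero])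
    (by
      intro u hu
      have hu' : u.re = Real.log R := hu
      exact hb _ (hmem u hu'.le))
  have hFz : F (Complex.log (z - c)) = h z := by
    simp only [hF, Complex.exp_log hne]
    congr 1
    ring
  rw [hFz, hre] at key
  simpa using key

/-- Let `h = log f`. On the unit disc `|h| ≤ 2η`; from `Re h ≤ B`, Borel–Carathéodory gives `|h| ≤
K₀ B` on an intermediate radius `ρ₂`; three circles interpolates at `ρ₁`. The constants `K` and `θ`
depend on the radii alone, so `η` can later be chosen small enough to offset `B`. -/
theorem norm_le_exp_of_ne_zero {ρ₁ ρ₃ : ℝ} (h1 : 1 < ρ₁) (h13 : ρ₁ < ρ₃) :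
    ∃ K θ : ℝ, 0 < K ∧ 0 < θ ∧ θ < 1 ∧ ∀ (f : ℂ → ℂ) (c : ℂ) (B η : ℝ), 1 ≤ B → 0 < η → η ≤ 1 / 2 →
      DifferentiableOn ℂ f (Metric.ball c ρ₃) → (∀ z ∈ Metric.ball c ρ₃, f z ≠ 0) →
      (∀ z ∈ Metric.ball c ρ₃, ‖f z‖ ≤ Real.exp B) →
      (∀ z ∈ Metric.closedBall c 1, ‖f z - 1‖ ≤ η) →
      ∀ z ∈ Metric.closedBall c ρ₁, ‖f z‖ ≤ Real.exp (K * B ^ (1 - θ) * η ^ θ) := by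
  set ρ₂ := (ρ₁ + ρ₃) / 2 with hρ₂
  have h12 : ρ₁ < ρ₂ := by rw [hρ₂]; linarith
  have h23 : ρ₂ < ρ₃ := by rw [hρ₂]; linarith
  -- The sum of the two Borel–Carathéodory coefficients, the value at the centre being at most `1 ≤
  -- B`.
  set K₀ := (2 * ρ₂ + (ρ₃ + ρ₂)) / (ρ₃ - ρ₂) with hK₀
  have hK₀1 : 1 ≤ K₀ := by
    rw [hK₀, le_div_iff₀ (by linarith)]
    linarith
  set φ := Real.log ρ₁ / Real.log ρ₂ with hφ
  have hl1 : 0 < Real.log ρ₁ := Real.log_pos h1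
  have hl2 : Real.log ρ₁ < Real.log ρ₂ := Real.log_lt_log (by linarith) h12
  have hφ0 : 0 < φ := div_pos hl1 (by linarith)
  have hφ1 : φ < 1 := (div_lt_one (by linarith)).mpr hl2
  refine ⟨2 * K₀, 1 - φ, by linarith, by linarith, by linarith, ?_⟩
  intro f c B η hB hη0 hη hf hne hfB hf1 z hz
  obtain ⟨h, hc, hh⟩ := exists_log_of_ne_zero (by linarith) hf hne
  have hsub : ∀ r, r < ρ₃ → Metric.closedBall c r ⊆ Metric.ball c ρ₃ := fun r hr =>
    Metric.closedBall_subset_ball hr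
  have hsmall : ∀ z ∈ Metric.closedBall c 1, ‖h z‖ ≤ 2 * η :=
    norm_log_branch_le hη zero_le_one
      (fun w hw => hf.differentiableAt (Metric.isOpen_ball.mem_nhds (hsub 1 (by linarith) hw)))
      (fun w hw => (hh w (hsub 1 (by linarith) hw)).1) hc hf1
  have hreB : ∀ w ∈ Metric.ball c ρ₃, (h w).re ≤ B := by
    intro w hw
    have h3 := hfB w hw
    rw [← (hh w hw).2, Complex.norm_exp] at h3
    exact Real.exp_le_exp.mp h3
  have hbig : ∀ w ∈ Metric.closedBall c ρ₂, ‖h w‖ ≤ K₀ * B := by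
    intro w hw
    have hw' : ‖w - c‖ ≤ ρ₂ := mem_closedBall_iff_norm.mp hw
    have hm : ∀ u ∈ Metric.ball (0 : ℂ) ρ₃, c + u ∈ Metric.ball c ρ₃ := by
      intro u hu
      simpa [mem_ball_iff_norm] using hu
    have key := Complex.borelCaratheodory (M := B) (f := fun u => h (c + u)) (R := ρ₃) (z := w - c)
      (by linarith) (fun u hu => by
        have h4 : DifferentiableAt ℂ (fun u => c + u) u := by fun_prop
        exact (DifferentiableAt.comp u (hh _ (hm u hu)).1.differentiableAt h4).differentiableWithinAt)
      (fun u hu => hreB _ (hm u hu)) (by linarith)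
      (by rw [mem_ball_zero_iff]; linarith)
    have hc1 : ‖h (c + 0)‖ ≤ 1 := by
      rw [add_zero]
      have := hsmall c (Metric.mem_closedBall_self zero_le_one)
      linarith
    have hz0 : c + (w - c) = w := by ring
    simp only [hz0] at key
    have hn := norm_nonneg (w - c)
    have hd0 : 0 < ρ₃ - ρ₂ := by linarith
    calc ‖h w‖ ≤ _ := key
      _ ≤ 2 * B * ρ₂ / (ρ₃ - ρ₂) + B * (ρ₃ + ρ₂) / (ρ₃ - ρ₂) := by
        gcongr
        · nlinarith
        · nlinarith
        · linarith
        · exact hc1.trans hB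
      _ = K₀ * B := by rw [hK₀]; field_simp
  have hz' : ‖z - c‖ ≤ ρ₁ := mem_closedBall_iff_norm.mp hz
  have hηB : 2 * η ≤ K₀ * B := by nlinarith
  have hfin : ‖h z‖ ≤ (2 * η) ^ (1 - φ) * (K₀ * B) ^ φ := by
    rcases le_or_gt ‖z - c‖ 1 with h5 | h5
    · calc ‖h z‖ ≤ 2 * η := hsmall z (mem_closedBall_iff_norm.mpr h5)
        _ = (2 * η) ^ (1 - φ) * (2 * η) ^ φ := by
          rw [← Real.rpow_add (by linarith)]; simp
        _ ≤ _ := by gcongr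
    · have h6 := three_circles (R := ρ₂) (by linarith)
        (fun w hw => (hh w (hsub _ h23 hw)).1.differentiableAt) hsmall hbig h5.le (by linarith)
      set ψ := Real.log ‖z - c‖ / Real.log ρ₂ with hψ
      -- The base `K₀ B / (2η)` is at least `1`, so the exponent at `|z - c|` may be raised to the
      -- one at `ρ₁`.
      have hψφ : ψ ≤ φ := by
        rw [hψ, hφ]
        gcongr
        · linarith
      have hb : 0 < 2 * η := by linarith
      calc ‖h z‖ ≤ _ := h6
        _ = (2 * η) * (K₀ * B / (2 * η)) ^ ψ := by
          rw [Real.rpow_sub hb, Real.div_rpow (by nlinarith) hb.le, Real.rpow_one]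
          ring
        _ ≤ (2 * η) * (K₀ * B / (2 * η)) ^ φ := by
          gcongr
          rw [le_div_iff₀ hb]; linarith
        _ = _ := by
          rw [Real.rpow_sub hb, Real.div_rpow (by nlinarith) hb.le, Real.rpow_one]
          ring
  rw [← (hh z (hsub _ (by linarith) hz)).2, Complex.norm_exp]
  refine Real.exp_le_exp.mpr (((re_le_norm _).trans hfin).trans ?_)
  rw [Real.mul_rpow (by norm_num) hη0.le, Real.mul_rpow (by linarith) (by linarith)]
  have e1 : (2 : ℝ) ^ (1 - φ) ≤ 2 := by
    calc (2 : ℝ) ^ (1 - φ) ≤ 2 ^ (1 : ℝ) := by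
          apply Real.rpow_le_rpow_of_exponent_le <;> linarith
      _ = 2 := Real.rpow_one 2
  have e2 : K₀ ^ φ ≤ K₀ := by
    calc K₀ ^ φ ≤ K₀ ^ (1 : ℝ) := by
          apply Real.rpow_le_rpow_of_exponent_le <;> linarith
      _ = K₀ := Real.rpow_one _
  rw [sub_sub_cancel]
  calc 2 ^ (1 - φ) * η ^ (1 - φ) * (K₀ ^ φ * B ^ φ)
      ≤ 2 * η ^ (1 - φ) * (K₀ * B ^ φ) := by gcongr
    _ = 2 * K₀ * B ^ φ * η ^ (1 - φ) := by ring

/-! ### From mean squares on vertical lines to large values on moving discs. -/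

/-- A holomorphic function inside a disc is bounded by its mean over the boundary circle. -/
theorem norm_le_integral_circleMap {G : ℂ → ℂ} {c z : ℂ} {ρ ρ' : ℝ} (hρ : 0 ≤ ρ) (hρ' : ρ < ρ')
    (hG : ∀ w ∈ Metric.closedBall c ρ', DifferentiableAt ℂ G w) (hz : z ∈ Metric.closedBall c ρ) :
    ‖G z‖ ≤ ρ' / (ρ' - ρ) * ((2 * Real.pi)⁻¹ *
      ∫ θ in 0..2 * Real.pi, ‖G (circleMap c ρ' θ)‖) := by
  have hz' : z ∈ Metric.ball c ρ' := Metric.closedBall_subset_ball hρ' hz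
  have h1 := Complex.two_pi_I_inv_smul_circleIntegral_sub_inv_smul_of_differentiable_on_off_countable
    (s := ∅) Set.countable_empty hz'
    (fun w hw => (hG w hw).continuousAt.continuousWithinAt)
    (fun w hw => hG w (Metric.ball_subset_closedBall hw.1))
  rw [← h1, norm_smul]
  have h2 : ‖(2 * Real.pi * I : ℂ)⁻¹‖ = (2 * Real.pi)⁻¹ := by
    simp [abs_of_pos Real.pi_pos]
  rw [h2]
  have hpi := Real.pi_pos
  have hcont : Continuous fun θ => ‖G (circleMap c ρ' θ)‖ := by
    refine (continuous_iff_continuousAt.mpr fun θ => ?_).norm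
    exact ContinuousAt.comp (f := circleMap c ρ') (hG _ (circleMap_mem_closedBall c (by linarith) θ)).continuousAt
      (continuous_circleMap c ρ').continuousAt
  have h3 : ‖∮ w in C(c, ρ'), (w - z)⁻¹ • G w‖ ≤
      ∫ θ in 0..2 * Real.pi, ρ' / (ρ' - ρ) * ‖G (circleMap c ρ' θ)‖ := by
    rw [circleIntegral]
    refine intervalIntegral.norm_integral_le_of_norm_le (by positivity) ?_
      ((hcont.const_mul _).intervalIntegrable _ _)
    refine Filter.Eventually.of_forall fun θ _ => ?_
    rw [norm_smul, norm_smul, deriv_circleMap, norm_mul, norm_I, mul_one, norm_circleMap_zero,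
      abs_of_pos (by linarith), norm_inv, ← mul_assoc, div_eq_mul_inv]
    have h4 : ‖circleMap c ρ' θ - c‖ = ρ' := by
      simp [abs_of_pos (show 0 < ρ' by linarith)]
    have h5 := norm_sub_norm_le (circleMap c ρ' θ - c) (z - c)
    rw [sub_sub_sub_cancel_right, h4] at h5
    have h6 := mem_closedBall_iff_norm.mp hz
    have h7 : 0 < ρ' := by linarith
    gcongr
    · linarith
  rw [intervalIntegral.integral_const_mul] at h3
  calc _ ≤ (2 * Real.pi)⁻¹ * (ρ' / (ρ' - ρ) * ∫ θ in 0..2 * Real.pi, ‖G (circleMap c ρ' θ)‖) := by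
        gcongr
    _ = _ := by ring

/-- Large values, on discs moving along a vertical line, of a function whose mean squares along
vertical lines are bounded. -/
theorem measure_large_values_le {F : ℂ → ℂ} {c : ℂ} {ρ ρ' T₁ T₂ B lam : ℝ} (hρ : 0 ≤ ρ)
    (hρ' : ρ < ρ') (hT : T₁ ≤ T₂) (hlam : 0 < lam)
    (hF : ∀ t ∈ Set.Icc T₁ T₂, ∀ w ∈ Metric.closedBall (c + t * I) ρ', DifferentiableAt ℂ F w)
    (hB : ∀ θ : ℝ, ∫ t in T₁..T₂, ‖F (circleMap (c + t * I) ρ' θ)‖ ^ 2 ≤ B) :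
    volume.real {t ∈ Set.Icc T₁ T₂ | ∃ z ∈ Metric.closedBall (c + t * I) ρ, lam ≤ ‖F z‖ ^ 2} ≤
      ρ' / (ρ' - ρ) * B / lam := by
  have hpi := Real.pi_pos
  set Φ : ℝ → ℝ → ℝ := fun t θ => ‖F (circleMap (c + t * I) ρ' θ)‖ ^ 2 with hΦ
  have hΦc : ContinuousOn (Function.uncurry Φ) (Set.Icc T₁ T₂ ×ˢ Set.univ) := by
    rintro ⟨t, θ⟩ ⟨ht, -⟩
    have h1 : Continuous fun q : ℝ × ℝ => circleMap (c + q.1 * I) ρ' q.2 := by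
      unfold circleMap
      fun_prop
    have h2 : ContinuousAt F (circleMap (c + t * I) ρ' θ) :=
      (hF t ht _ (circleMap_mem_closedBall _ (by linarith) θ)).continuousAt
    have h3 : ContinuousAt (fun q : ℝ × ℝ => F (circleMap (c + q.1 * I) ρ' q.2)) (t, θ) :=
      ContinuousAt.comp (f := fun q : ℝ × ℝ => circleMap (c + q.1 * I) ρ' q.2) h2 h1.continuousAt
    exact ((h3.norm).pow 2).continuousWithinAt
  set μ := volume.restrict (Set.Icc T₁ T₂) with hμ
  set ν := volume.restrict (Set.Ioc 0 (2 * Real.pi)) with hν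
  have hint : Integrable (Function.uncurry Φ) (μ.prod ν) := by
    rw [hμ, hν, Measure.prod_restrict]
    have h4 : IntegrableOn (Function.uncurry Φ)
        (Set.Icc T₁ T₂ ×ˢ Set.Icc 0 (2 * Real.pi)) (volume.prod volume) := by
      refine ContinuousOn.integrableOn_compact (isCompact_Icc.prod isCompact_Icc) ?_
      exact hΦc.mono (Set.prod_mono le_rfl (Set.subset_univ _))
    exact h4.mono_set (Set.prod_mono le_rfl Set.Ioc_subset_Icc_self)
  set g : ℝ → ℝ := fun t => ρ' / (ρ' - ρ) * ((2 * Real.pi)⁻¹ * ∫ θ, Φ t θ ∂ν) with hg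
  have hgint : Integrable g μ := (hint.integral_prod_left.const_mul _).const_mul _
  have hd : 0 < ρ' - ρ := by linarith
  have hg0 : ∀ t, 0 ≤ g t := by
    intro t
    have : 0 ≤ ∫ θ, Φ t θ ∂ν := integral_nonneg fun θ => by positivity
    have : 0 ≤ ρ' := by linarith
    positivity
  -- Markov's inequality for the circle mean `g`; its integral over `t` is bounded by Fubini and the
  -- mean square at each fixed angle.
  have hmark := mul_meas_ge_le_integral_of_nonneg (μ := μ) (Filter.Eventually.of_forall hg0) hgint lam
  have hgle : ∫ t, g t ∂μ ≤ ρ' / (ρ' - ρ) * B := by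
    rw [hg, integral_const_mul, integral_const_mul]
    have hρ0 : 0 ≤ ρ' / (ρ' - ρ) := div_nonneg (by linarith) hd.le
    refine mul_le_mul_of_nonneg_left ?_ hρ0
    rw [integral_integral_swap hint]
    have h5 : ∫ θ, (∫ t, Φ t θ ∂μ) ∂ν ≤ ∫ θ, B ∂ν := by
      refine integral_mono_of_nonneg (Filter.Eventually.of_forall fun θ => ?_) (integrable_const _)
        (Filter.Eventually.of_forall fun θ => ?_)
      · exact integral_nonneg fun t => by positivity
      · have := hB θ
        rw [intervalIntegral.integral_of_le hT, ← integral_Icc_eq_integral_Ioc] at this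
        exact this
    have h6 : ∫ θ, B ∂ν = 2 * Real.pi * B := by
      rw [integral_const, hν]
      simp [Measure.real, hpi.le]
    rw [h6] at h5
    calc (2 * Real.pi)⁻¹ * ∫ θ, (∫ t, Φ t θ ∂μ) ∂ν ≤ (2 * Real.pi)⁻¹ * (2 * Real.pi * B) := by
          gcongr
      _ = B := by field_simp
  have hsub : {t ∈ Set.Icc T₁ T₂ | ∃ z ∈ Metric.closedBall (c + t * I) ρ, lam ≤ ‖F z‖ ^ 2} ⊆
      {t | lam ≤ g t} ∩ Set.Icc T₁ T₂ := by
    rintro t ⟨ht, z, hz, hl⟩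
    refine ⟨?_, ht⟩
    -- `F²` is holomorphic too, so `|F|²` inside is controlled by the circle mean of `|F|²`, and a
    -- mean square suffices.
    have h7 := norm_le_integral_circleMap (G := fun w => F w ^ 2) hρ hρ'
      (fun w hw => (hF t ht w hw).pow 2) hz
    simp only [norm_pow] at h7
    rw [intervalIntegral.integral_of_le (by positivity)] at h7
    exact hl.trans h7
  rw [le_div_iff₀ hlam]
  calc _ ≤ μ.real {t | lam ≤ g t} * lam := by
        refine mul_le_mul_of_nonneg_right ?_ hlam.le
        rw [hμ, measureReal_restrict_apply' measurableSet_Icc]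
        exact measureReal_mono hsub (by
          refine ne_top_of_le_ne_top ?_ (measure_mono Set.inter_subset_right)
          simp)
    _ = lam * μ.real {t | lam ≤ g t} := mul_comm _ _
    _ ≤ _ := hmark.trans hgle

/-! ### Mean squares of Dirichlet polynomials. -/

theorem integral_cexp_mul_I_le (x : ℝ) (hx : x ≠ 0) (T₁ T₂ : ℝ) :
    ‖∫ t in T₁..T₂, Complex.exp (x * I * t)‖ ≤ 2 / |x| := by
  have hne : (x * I : ℂ) ≠ 0 := by simp [hx]
  rw [integral_exp_mul_complex hne, norm_div]
  have h1 : ∀ t : ℝ, ‖Complex.exp (x * I * t)‖ = 1 := by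
    intro t
    rw [Complex.norm_exp]
    simp
  have h2 : ‖(x * I : ℂ)‖ = |x| := by simp
  rw [h2]
  gcongr
  refine (norm_sub_le _ _).trans ?_
  rw [h1, h1]
  norm_num

theorem natCast_cpow_neg_mul_I {n : ℕ} (hn : n ≠ 0) (t : ℝ) :
    (n : ℂ) ^ (-(t * I)) = Complex.exp (-(Real.log n : ℝ) * I * t) := by
  rw [Complex.cpow_def_of_ne_zero (by exact_mod_cast hn), ← Complex.natCast_log]
  congr 1
  push_cast
  ring

/-- The square is expanded: equal indices give the length of the interval, and each other pair gives
`∫ (m/n)^(it) dt`, which is at most `2 / |log (n/m)|` whatever the interval. -/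
theorem integral_norm_sq_dirichlet_le (s : Finset ℕ) (hs : ∀ n ∈ s, n ≠ 0) (a : ℕ → ℂ) (T₁ T₂ : ℝ) :
    ∫ t in T₁..T₂, ‖∑ n ∈ s, a n * (n : ℂ) ^ (-(t * I))‖ ^ 2 ≤
      (T₂ - T₁) * ∑ n ∈ s, ‖a n‖ ^ 2 +
      ∑ m ∈ s, ∑ n ∈ s.erase m, ‖a m‖ * ‖a n‖ * (2 / |Real.log n - Real.log m|) := by
  have hexp : ∀ t : ℝ, ‖∑ n ∈ s, a n * (n : ℂ) ^ (-(t * I))‖ ^ 2 =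
      (∑ m ∈ s, ∑ n ∈ s, a m * (starRingEnd ℂ) (a n) *
        Complex.exp (((Real.log n - Real.log m : ℝ) : ℂ) * I * t)).re := by
    intro t
    have h0 : ∀ z : ℂ, ‖z‖ ^ 2 = (z * (starRingEnd ℂ) z).re := by
      intro z
      rw [Complex.mul_conj, Complex.normSq_eq_norm_sq, Complex.ofReal_re]
    rw [h0, map_sum, Finset.sum_mul_sum]
    congr 1
    refine Finset.sum_congr rfl fun m hm => Finset.sum_congr rfl fun n hn => ?_
    rw [natCast_cpow_neg_mul_I (hs m hm), natCast_cpow_neg_mul_I (hs n hn), map_mul,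
      ← Complex.exp_conj]
    simp only [map_mul, map_neg, Complex.conj_ofReal, Complex.conj_I]
    rw [mul_mul_mul_comm, ← Complex.exp_add]
    congr 2
    push_cast
    ring
  have hci : ∀ m n, IntervalIntegrable (fun t : ℝ => a m * (starRingEnd ℂ) (a n) *
        Complex.exp (((Real.log n - Real.log m : ℝ) : ℂ) * I * t)) volume T₁ T₂ := by
    intro m n
    apply Continuous.intervalIntegrable
    fun_prop
  simp_rw [hexp]
  have h1 : ∫ t in T₁..T₂, (∑ m ∈ s, ∑ n ∈ s, a m * (starRingEnd ℂ) (a n) *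
        Complex.exp (((Real.log n - Real.log m : ℝ) : ℂ) * I * t)).re =
      (∑ m ∈ s, ∑ n ∈ s, a m * (starRingEnd ℂ) (a n) *
        ∫ t in T₁..T₂, Complex.exp (((Real.log n - Real.log m : ℝ) : ℂ) * I * t)).re := by
    have h2 := Complex.reCLM.intervalIntegral_comp_comm (μ := volume) (a := T₁) (b := T₂)
      (f := fun t : ℝ => ∑ m ∈ s, ∑ n ∈ s, a m * (starRingEnd ℂ) (a n) *
        Complex.exp (((Real.log n - Real.log m : ℝ) : ℂ) * I * t))
      (by apply Continuous.intervalIntegrable; fun_prop)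
    simp only [Complex.reCLM_apply] at h2
    rw [h2, intervalIntegral.integral_finsetSum]
    · congr 1
      refine Finset.sum_congr rfl fun m hm => ?_
      rw [intervalIntegral.integral_finsetSum (fun n _ => hci m n)]
      refine Finset.sum_congr rfl fun n hn => ?_
      rw [intervalIntegral.integral_const_mul]
    · intro m _
      apply Continuous.intervalIntegrable
      fun_prop
  rw [h1, Complex.re_sum, Finset.mul_sum, ← Finset.sum_add_distrib]
  refine Finset.sum_le_sum fun m hm => ?_
  rw [← Finset.add_sum_erase s _ hm, Complex.add_re, Complex.re_sum]
  refine add_le_add ?_ (Finset.sum_le_sum fun n hn => ?_)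
  · rw [sub_self]
    simp only [Complex.ofReal_zero, zero_mul, Complex.exp_zero]
    rw [Complex.mul_conj, Complex.normSq_eq_norm_sq]
    simp [mul_comm, -Complex.ofReal_pow]
  · have hnm : n ≠ m := (Finset.mem_erase.mp hn).1
    have hns : n ∈ s := (Finset.mem_erase.mp hn).2
    refine (Complex.re_le_norm _).trans ?_
    rw [norm_mul, norm_mul, RCLike.norm_conj]
    gcongr
    apply integral_cexp_mul_I_le
    intro h
    apply hnm
    have := Real.log_injOn_pos (Set.mem_Ioi.mpr (by exact_mod_cast Nat.pos_of_ne_zero (hs n hns)))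
      (Set.mem_Ioi.mpr (by exact_mod_cast Nat.pos_of_ne_zero (hs m hm))) (sub_eq_zero.mp h)
    exact_mod_cast this

/-! ### Euler–Maclaurin summation and the approximation of `ζ` by its partial sums. -/

theorem hasDerivAt_ofReal_cpow_neg {x : ℝ} (hx : 0 < x) (a : ℂ) :
    HasDerivAt (fun y : ℝ => (y : ℂ) ^ (-a)) (-a * (x : ℂ) ^ (-(a + 1))) x := by
  have h1 : (x : ℂ) ∈ slitPlane := Or.inl (by simpa using hx)
  have h2 := ((hasDerivAt_id (x : ℂ)).cpow_const (c := -a) h1).comp_ofReal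
  convert! h2 using 1
  rw [show -(a + 1) = -a - 1 by ring]
  simp

theorem continuousOn_ofReal_cpow {N M : ℝ} (hN : 1 ≤ N) (hNM : N ≤ M) (a : ℂ) :
    ContinuousOn (fun y : ℝ => (y : ℂ) ^ a) (Set.uIcc N M) := by
  intro y hy
  rw [Set.uIcc_of_le hNM] at hy
  have h := (hasDerivAt_ofReal_cpow_neg (x := y) (by linarith [hy.1]) (-a)).continuousAt
  rw [neg_neg] at h
  exact h.continuousWithinAt

theorem norm_ofReal_cpow_neg {x : ℝ} (hx : 0 < x) (a : ℂ) : ‖(x : ℂ) ^ (-a)‖ = x ^ (-a.re) := by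
  rw [Complex.norm_cpow_eq_rpow_re_of_pos hx, neg_re]

/-- The antiderivative, of mean zero, of a periodic function of mean zero. -/
theorem exists_periodic_antideriv {ρ : ℝ → ℝ} (hc : Continuous ρ) (hper : Function.Periodic ρ 1)
    (hmean : ∫ x in (0 : ℝ)..1, ρ x = 0) {B : ℝ} (hB : ∀ x, |ρ x| ≤ B) :
    ∃ σ : ℝ → ℝ, Continuous σ ∧ Function.Periodic σ 1 ∧ ∫ x in (0 : ℝ)..1, σ x = 0 ∧
      (∀ x, |σ x| ≤ B) ∧ ∀ x, HasDerivAt σ (ρ x) x := by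
  have hint : ∀ a b, IntervalIntegrable ρ volume a b := fun a b => hc.intervalIntegrable a b
  set P : ℝ → ℝ := fun x => ∫ u in (0 : ℝ)..x, ρ u with hP
  have hPd : ∀ x, HasDerivAt P (ρ x) x := fun x => hc.integral_hasStrictDerivAt 0 x |>.hasDerivAt
  have hPc : Continuous P := continuous_iff_continuousAt.mpr fun x => (hPd x).continuousAt
  set m := ∫ x in (0 : ℝ)..1, P x with hm
  have hperP : Function.Periodic (fun x => P x - m) 1 := by
    intro x
    have h1 : P (x + 1) = P x + ∫ u in x..x + 1, ρ u :=
      (intervalIntegral.integral_add_adjacent_intervals (hint _ _) (hint _ _)).symm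
    have h2 : ∫ u in x..x + 1, ρ u = 0 := by
      have := hper.intervalIntegral_add_eq x 0
      rw [this, zero_add, hmean]
    simp only [h1, h2, add_zero]
  have hB0 : 0 ≤ B := (abs_nonneg _).trans (hB 0)
  refine ⟨fun x => P x - m, hPc.sub continuous_const, hperP, ?_, ?_, fun x => (hPd x).sub_const m⟩
  · rw [intervalIntegral.integral_sub (hPc.intervalIntegrable _ _) (by simp)]
    simp [hm]
  · intro x
    obtain ⟨y, hy, hxy⟩ := hperP.exists_mem_Ico₀ one_pos x
    change |P x - m| ≤ B
    rw [hxy]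
    -- The centred antiderivative is the average of `P y - P u` over a period, and each difference
    -- is at most `B`; repeated integration therefore never worsens the bound.
    have h3 : P y - m = ∫ u in (0 : ℝ)..1, (P y - P u) := by
      rw [intervalIntegral.integral_sub (by simp) (hPc.intervalIntegrable _ _)]
      simp [hm]
    rw [h3, ← Real.norm_eq_abs]
    have h4 := intervalIntegral.norm_integral_le_of_norm_le_const (a := (0 : ℝ)) (b := 1) (C := B)
      (f := fun u => P y - P u) (by
        intro u hu
        rw [Set.uIoc_of_le zero_le_one] at hu
        have h5 : P y - P u = ∫ w in u..y, ρ w := by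
          rw [hP]
          exact intervalIntegral.integral_interval_sub_left (hint _ _) (hint _ _)
        rw [h5]
        have h6 := intervalIntegral.norm_integral_le_of_norm_le_const (a := u) (b := y) (C := B)
          (f := ρ) (fun w _ => hB w)
        refine h6.trans ?_
        have h7 : |y - u| ≤ 1 := by
          rw [abs_le]
          constructor <;> linarith [hy.1, hy.2, hu.1, hu.2]
        nlinarith)
    simpa using h4

theorem norm_integral_ofReal_cpow_le {a : ℂ} {N M : ℝ} (hN : 1 ≤ N) (hNM : N ≤ M) (ha : 2 ≤ a.re)
    {ρ : ℝ → ℝ} {B : ℝ} (hB : ∀ x, |ρ x| ≤ B) :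
    ‖∫ x in N..M, (ρ x : ℂ) * (x : ℂ) ^ (-a)‖ ≤ B * N ^ (-a.re) * N := by
  have hB0 : 0 ≤ B := (abs_nonneg _).trans (hB 0)
  have h0 : (0 : ℝ) ∉ Set.uIcc N M := by
    rw [Set.uIcc_of_le hNM]
    intro h
    linarith [h.1]
  have h1 : ‖∫ x in N..M, (ρ x : ℂ) * (x : ℂ) ^ (-a)‖ ≤ ∫ x in N..M, B * x ^ (-a.re) := by
    refine intervalIntegral.norm_integral_le_of_norm_le hNM ?_ ?_
    · refine Filter.Eventually.of_forall fun x hx => ?_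
      rw [norm_mul, norm_ofReal_cpow_neg (by linarith [hx.1]), Complex.norm_real]
      have : 0 ≤ x ^ (-a.re) := Real.rpow_nonneg (by linarith [hx.1]) _
      exact mul_le_mul_of_nonneg_right (hB x) this
    · exact (intervalIntegral.intervalIntegrable_rpow (Or.inr h0)).const_mul B
  refine h1.trans ?_
  rw [intervalIntegral.integral_const_mul, integral_rpow (Or.inr ⟨by linarith, h0⟩), mul_assoc]
  refine mul_le_mul_of_nonneg_left ?_ hB0
  have h2 : N ^ (-a.re) * N = N ^ (-a.re + 1) := by
    rw [Real.rpow_add (by linarith), Real.rpow_one]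
  rw [h2, show (M ^ (-a.re + 1) - N ^ (-a.re + 1)) / (-a.re + 1) =
    (N ^ (-a.re + 1) - M ^ (-a.re + 1)) / (a.re - 1) by
      rw [← neg_div_neg_eq]; congr 1 <;> ring]
  have h3 : 0 ≤ M ^ (-a.re + 1) := Real.rpow_nonneg (by linarith) _
  have h4 : 0 ≤ N ^ (-a.re + 1) := Real.rpow_nonneg (by linarith) _
  rw [div_le_iff₀ (by linarith)]
  nlinarith

/-- Induction by integration by parts. One step replaces `ρ` by its mean-zero antiderivative, with
the same bound, and `x^(-a)` by `a x^(-(a+1))`, a gain of `|a| / N`. The two boundary terms of each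
step account for the `2k`, and the integral left after `k` steps is estimated trivially. -/
theorem norm_integral_periodic_mul_cpow_le (k : ℕ) : ∀ (ρ : ℝ → ℝ), Continuous ρ →
    Function.Periodic ρ 1 → ∫ x in (0 : ℝ)..1, ρ x = 0 → ∀ B : ℝ, (∀ x, |ρ x| ≤ B) →
    ∀ (a : ℂ) (N M : ℝ), 2 ≤ a.re → 1 ≤ N → N ≤ M → ‖a‖ + k ≤ N →
    ‖∫ x in N..M, (ρ x : ℂ) * (x : ℂ) ^ (-a)‖ ≤
      B * N ^ (-a.re) * (2 * k + N * ((‖a‖ + k) / N) ^ k) := by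
  induction k with
  | zero =>
    intro ρ _ _ _ B hB a N M ha hN hNM _
    simpa using norm_integral_ofReal_cpow_le hN hNM ha hB
  | succ k ih =>
    intro ρ hc hper hmean B hB a N M ha hN hNM hk
    obtain ⟨σ, hσc, hσper, hσmean, hσB, hσd⟩ := exists_periodic_antideriv hc hper hmean hB
    have hB0 : 0 ≤ B := (abs_nonneg _).trans (hB 0)
    have hn1 : ‖a + 1‖ ≤ ‖a‖ + 1 := by simpa using norm_add_le a 1
    have hIH := ih σ hσc hσper hσmean B hσB (a + 1) N M (by simp; linarith) hN hNM (by
      push_cast at hk; linarith)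
    have hN0 : 0 < N := by linarith
    have hparts : ∫ x in N..M, (ρ x : ℂ) * (x : ℂ) ^ (-a) =
        (σ M : ℂ) * (M : ℂ) ^ (-a) - (σ N : ℂ) * (N : ℂ) ^ (-a) +
          a * ∫ x in N..M, (σ x : ℂ) * (x : ℂ) ^ (-(a + 1)) := by
      have h1 := intervalIntegral.integral_deriv_mul_eq_sub (a := N) (b := M)
        (u := fun x => (σ x : ℂ)) (v := fun x : ℝ => (x : ℂ) ^ (-a))
        (u' := fun x => (ρ x : ℂ)) (v' := fun x : ℝ => -a * (x : ℂ) ^ (-(a + 1)))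
        (fun x _ => (hσd x).ofReal_comp)
        (fun x hx => hasDerivAt_ofReal_cpow_neg (by
          rw [Set.uIcc_of_le hNM] at hx; linarith [hx.1]) a)
        ((Complex.continuous_ofReal.comp hc).intervalIntegrable _ _)
        ((continuousOn_const.mul (continuousOn_ofReal_cpow hN hNM _)).intervalIntegrable)
      rw [intervalIntegral.integral_add] at h1
      · rw [← h1, ← intervalIntegral.integral_const_mul, add_assoc, ← intervalIntegral.integral_add]
        · rw [eq_comm, add_eq_left]
          apply intervalIntegral.integral_zero_ae
          refine Filter.Eventually.of_forall fun x _ => ?_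
          ring
        · exact ((Complex.continuous_ofReal.comp hσc).continuousOn.mul
            (continuousOn_const.mul (continuousOn_ofReal_cpow hN hNM _))).intervalIntegrable
        · exact (continuousOn_const.mul ((Complex.continuous_ofReal.comp hσc).continuousOn.mul
            (continuousOn_ofReal_cpow hN hNM _))).intervalIntegrable
      · exact ((Complex.continuous_ofReal.comp hc).continuousOn.mul
            (continuousOn_ofReal_cpow hN hNM _)).intervalIntegrable
      · exact ((Complex.continuous_ofReal.comp hσc).continuousOn.mul
            (continuousOn_const.mul (continuousOn_ofReal_cpow hN hNM _))).intervalIntegrable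
    rw [hparts]
    have hNa : 0 ≤ N ^ (-a.re) := Real.rpow_nonneg hN0.le _
    have e1 : ‖(σ M : ℂ) * (M : ℂ) ^ (-a)‖ ≤ B * N ^ (-a.re) := by
      rw [norm_mul, norm_ofReal_cpow_neg (by linarith), Complex.norm_real]
      have h2 : M ^ (-a.re) ≤ N ^ (-a.re) :=
        Real.rpow_le_rpow_of_nonpos hN0 hNM (by linarith)
      have := hσB M
      exact mul_le_mul this h2 (Real.rpow_nonneg (by linarith) _) hB0
    have e2 : ‖(σ N : ℂ) * (N : ℂ) ^ (-a)‖ ≤ B * N ^ (-a.re) := by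
      rw [norm_mul, norm_ofReal_cpow_neg (by linarith), Complex.norm_real]
      exact mul_le_mul_of_nonneg_right (hσB N) hNa
    have hNa1 : N ^ (-(a + 1).re) = N ^ (-a.re) / N := by
      rw [add_re, one_re, neg_add, Real.rpow_add hN0, Real.rpow_neg_one, div_eq_mul_inv]
    have e3 : ‖a * ∫ x in N..M, (σ x : ℂ) * (x : ℂ) ^ (-(a + 1))‖ ≤
        B * N ^ (-a.re) * (2 * k + N * ((‖a‖ + (k + 1)) / N) ^ (k + 1)) := by
      rw [norm_mul]
      have ha0 := norm_nonneg a
      have h3 : ‖a‖ / N ≤ (‖a‖ + (k + 1)) / N := by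
        gcongr; linarith [(Nat.cast_nonneg k : (0 : ℝ) ≤ k)]
      have h4 : ‖a‖ / N ≤ 1 := by
        rw [div_le_one hN0]
        push_cast at hk
        linarith [(Nat.cast_nonneg k : (0 : ℝ) ≤ k)]
      have hd0 : 0 ≤ ‖a‖ / N := by positivity
      set y := (‖a‖ + (k + 1)) / N with hy
      have hy0 : 0 ≤ y := by positivity
      have hyk : 0 ≤ y ^ k := by positivity
      have h5 : ((‖a + 1‖ + k) / N) ^ k ≤ y ^ k := by
        rw [hy]; gcongr ?_ ^ k; gcongr ?_ / N; linarith
      calc ‖a‖ * ‖∫ x in N..M, (σ x : ℂ) * (x : ℂ) ^ (-(a + 1))‖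
          ≤ ‖a‖ * (B * N ^ (-(a + 1).re) * (2 * k + N * ((‖a + 1‖ + k) / N) ^ k)) := by gcongr
        _ ≤ ‖a‖ * (B * N ^ (-(a + 1).re) * (2 * k + N * y ^ k)) := by
          have : 0 ≤ N ^ (-(a + 1).re) := Real.rpow_nonneg hN0.le _
          gcongr
        _ = B * N ^ (-a.re) * (‖a‖ / N * (2 * k) + N * (‖a‖ / N * y ^ k)) := by
          rw [hNa1]; field_simp
        _ ≤ B * N ^ (-a.re) * (1 * (2 * k) + N * (y * y ^ k)) := by
          gcongr
        _ = _ := by rw [pow_succ]; ring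
    calc _ ≤ B * N ^ (-a.re) + B * N ^ (-a.re) +
          B * N ^ (-a.re) * (2 * k + N * ((‖a‖ + (k + 1)) / N) ^ (k + 1)) := by
          refine (norm_add_le _ _).trans (add_le_add ((norm_sub_le _ _).trans (add_le_add e1 e2)) e3)
      _ = _ := by push_cast; ring

/-- The Euler--Maclaurin approximation to `ζ(s)` with the sum cut off at `N`. -/
noncomputable def zetaTrapezoid (N : ℕ) (s : ℂ) : ℂ :=
  ∑ n ∈ Finset.Ico 1 N, (n : ℂ) ^ (-s) + (N : ℂ) ^ (-s) / 2 + (N : ℂ) ^ (1 - s) / (s - 1)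

/-- The kernel of the trapezoid rule. -/
noncomputable def trapezoidKernel (x : ℝ) : ℝ := Int.fract x * (1 - Int.fract x) / 2

theorem trapezoidKernel_eq {n : ℕ} {x : ℝ} (hx : x ∈ Set.Icc (n : ℝ) (n + 1)) :
    trapezoidKernel x = (x - n) * (n + 1 - x) / 2 := by
  rcases eq_or_lt_of_le hx.2 with h | h
  · rw [trapezoidKernel, h]
    have : Int.fract ((n : ℝ) + 1) = 0 := by
      rw [Int.fract_add_one, Int.fract_natCast]
    rw [this]
    ring
  · have : Int.fract x = x - n := by
      rw [Int.fract_eq_iff]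
      exact ⟨by linarith [hx.1], by linarith, n, by simp⟩
    rw [trapezoidKernel, this]
    ring

theorem continuous_trapezoidKernel : Continuous trapezoidKernel := by
  have h : ContinuousOn (fun x : ℝ => x * (1 - x) / 2) (Set.Icc 0 1) := by fun_prop
  exact h.comp_fract'' (by norm_num)

theorem periodic_trapezoidKernel : Function.Periodic trapezoidKernel 1 := by
  intro x
  simp [trapezoidKernel]

theorem trapezoidKernel_nonneg (x : ℝ) : 0 ≤ trapezoidKernel x := by
  have h1 := Int.fract_nonneg x
  have h2 := Int.fract_lt_one x
  unfold trapezoidKernel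
  nlinarith

theorem trapezoidKernel_le (x : ℝ) : trapezoidKernel x ≤ 1 / 8 := by
  unfold trapezoidKernel
  nlinarith [sq_nonneg (Int.fract x - 1 / 2)]

theorem integral_trapezoidKernel : ∫ x in (0 : ℝ)..1, trapezoidKernel x = 1 / 12 := by
  have h : ∫ x in (0 : ℝ)..1, trapezoidKernel x = ∫ x in (0 : ℝ)..1, (x / 2 - x ^ 2 / 2) := by
    refine intervalIntegral.integral_congr fun x hx => ?_
    rw [Set.uIcc_of_le zero_le_one] at hx
    rw [trapezoidKernel_eq (n := 0) (by simpa using hx)]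
    push_cast
    ring
  rw [h, intervalIntegral.integral_sub (by apply Continuous.intervalIntegrable; fun_prop)
    (by apply Continuous.intervalIntegrable; fun_prop)]
  simp only [intervalIntegral.integral_div, integral_id, integral_pow]
  norm_num

/-- The trapezoid rule on one unit interval, with its error written as an integral against the Peano
kernel `(x - n)(n + 1 - x)/2`. -/
theorem zetaTrapezoid_succ_sub {n : ℕ} (hn : 1 ≤ n) {s : ℂ} (hs : s ≠ 1) :
    zetaTrapezoid (n + 1) s - zetaTrapezoid n s =
      s * (s + 1) * ∫ x in (n : ℝ)..(n + 1), (trapezoidKernel x : ℂ) * (x : ℂ) ^ (-(s + 2)) := by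
  have hn1 : (1 : ℝ) ≤ n := by exact_mod_cast hn
  have hs1 : 1 - s ≠ 0 := sub_ne_zero.mpr hs.symm
  -- The antiderivative produced by two integrations by parts, each differentiating the quadratic
  -- kernel once.
  set F : ℝ → ℂ := fun x => (((x - n) * (n + 1 - x) / 2 : ℝ) : ℂ) * (-s * (x : ℂ) ^ (-(s + 1))) -
    ((n + 1 / 2 - x : ℝ) : ℂ) * (x : ℂ) ^ (-s) - (x : ℂ) ^ (-(s - 1)) / (1 - s) with hF
  have hFd : ∀ x ∈ Set.uIcc (n : ℝ) (n + 1), HasDerivAt F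
      (s * (s + 1) * ((((x - n) * (n + 1 - x) / 2 : ℝ) : ℂ) * (x : ℂ) ^ (-(s + 2)))) x := by
    intro x hx
    rw [Set.uIcc_of_le (by linarith)] at hx
    have hx0 : 0 < x := by linarith [hx.1]
    have d1 : HasDerivAt (fun x : ℝ => (x - n) * (n + 1 - x) / 2) (n + 1 / 2 - x) x := by
      have := ((((hasDerivAt_id x).sub_const (n : ℝ)).mul
        ((hasDerivAt_id x).const_sub ((n : ℝ) + 1))).div_const 2)
      convert! this using 1
      simp
      ring
    have d2 : HasDerivAt (fun x : ℝ => (n + 1 / 2 - x : ℝ)) (-1) x :=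
      (hasDerivAt_id x).const_sub _
    have e1 := hasDerivAt_ofReal_cpow_neg hx0 (s + 1)
    have e2 := hasDerivAt_ofReal_cpow_neg hx0 s
    have e3 := hasDerivAt_ofReal_cpow_neg hx0 (s - 1)
    have := ((d1.ofReal_comp.mul (e1.const_mul (-s))).sub (d2.ofReal_comp.mul e2)).sub
      (e3.div_const (1 - s))
    convert! this using 1
    rw [sub_add_cancel, show s + 1 + 1 = s + 2 by ring]
    field_simp
    push_cast
    ring
  have hcont : ContinuousOn (fun x : ℝ => s * (s + 1) *
      ((((x - n) * (n + 1 - x) / 2 : ℝ) : ℂ) * (x : ℂ) ^ (-(s + 2)))) (Set.uIcc (n : ℝ) (n + 1)) := by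
    refine continuousOn_const.mul (ContinuousOn.mul ?_ (continuousOn_ofReal_cpow hn1 (by linarith) _))
    fun_prop
  have key := intervalIntegral.integral_eq_sub_of_hasDerivAt hFd hcont.intervalIntegrable
  rw [intervalIntegral.integral_const_mul] at key
  have hk : ∫ x in (n : ℝ)..(n + 1), (trapezoidKernel x : ℂ) * (x : ℂ) ^ (-(s + 2)) =
      ∫ x in (n : ℝ)..(n + 1), (((x - n) * (n + 1 - x) / 2 : ℝ) : ℂ) * (x : ℂ) ^ (-(s + 2)) := by
    refine intervalIntegral.integral_congr fun x hx => ?_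
    rw [Set.uIcc_of_le (by linarith)] at hx
    rw [trapezoidKernel_eq hx]
  rw [hk, key, zetaTrapezoid, zetaTrapezoid, Finset.sum_Ico_succ_top hn, hF]
  have hs2 : s - 1 ≠ 0 := sub_ne_zero.mpr hs
  have e4 : (1 - s)⁻¹ = -(s - 1)⁻¹ := by rw [← neg_sub, neg_inv]
  simp only [neg_sub, div_eq_mul_inv, e4]
  push_cast
  ring

theorem zetaTrapezoid_sub {N M : ℕ} (hN : 1 ≤ N) (hNM : N ≤ M) {s : ℂ} (hs : s ≠ 1) :
    zetaTrapezoid M s - zetaTrapezoid N s =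
      s * (s + 1) * ∫ x in (N : ℝ)..M, (trapezoidKernel x : ℂ) * (x : ℂ) ^ (-(s + 2)) := by
  induction M, hNM using Nat.le_induction with
  | base => simp
  | succ M hNM ih =>
    have hN1 : (1 : ℝ) ≤ N := by exact_mod_cast hN
    have hNM' : (N : ℝ) ≤ M := by exact_mod_cast hNM
    have hi : ∀ a b : ℝ, 1 ≤ a → a ≤ b → IntervalIntegrable
        (fun x : ℝ => (trapezoidKernel x : ℂ) * (x : ℂ) ^ (-(s + 2))) volume a b := by
      intro a b ha hab
      exact ((Complex.continuous_ofReal.comp continuous_trapezoidKernel).continuousOn.mul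
        (continuousOn_ofReal_cpow ha hab _)).intervalIntegrable
    rw [← sub_add_sub_cancel _ (zetaTrapezoid M s), ih, zetaTrapezoid_succ_sub (hN.trans hNM) hs,
      ← mul_add, add_comm (∫ x in (M : ℝ)..(M + 1), _)]
    push_cast
    rw [intervalIntegral.integral_add_adjacent_intervals (hi _ _ hN1 hNM')
      (hi _ _ (hN1.trans hNM') (by linarith))]

theorem norm_zetaTrapezoid_succ_sub_le {n : ℕ} (hn : 1 ≤ n) {s : ℂ} (hs : s ≠ 1) (h0 : 0 < s.re) :
    ‖zetaTrapezoid (n + 1) s - zetaTrapezoid n s‖ ≤ ‖s‖ * ‖s + 1‖ * (1 / (n : ℝ) ^ 2) := by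
  have hn1 : (1 : ℝ) ≤ n := by exact_mod_cast hn
  rw [zetaTrapezoid_succ_sub hn hs, norm_mul, norm_mul]
  gcongr
  have h1 := intervalIntegral.norm_integral_le_of_norm_le_const (a := (n : ℝ)) (b := n + 1)
    (C := 1 / (n : ℝ) ^ 2) (f := fun x : ℝ => (trapezoidKernel x : ℂ) * (x : ℂ) ^ (-(s + 2))) (by
      intro x hx
      rw [Set.uIoc_of_le (by linarith)] at hx
      have hx0 : 0 < x := by linarith [hx.1]
      rw [norm_mul, norm_ofReal_cpow_neg hx0, Complex.norm_real, Real.norm_eq_abs,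
        abs_of_nonneg (trapezoidKernel_nonneg x)]
      have e1 : x ^ (-(s + 2).re) ≤ x ^ (-2 : ℝ) := by
        apply Real.rpow_le_rpow_of_exponent_le (by linarith [hx.1])
        simp
        linarith
      have e2 : x ^ (-2 : ℝ) ≤ 1 / (n : ℝ) ^ 2 := by
        rw [Real.rpow_neg hx0.le, ← one_div]
        rw [Real.rpow_ofNat]
        gcongr
        exact hx.1.le
      have e3 : 0 ≤ x ^ (-(s + 2).re) := Real.rpow_nonneg hx0.le _
      have e4 := trapezoidKernel_le x
      nlinarith)
  simpa using h1

theorem tendsto_zetaTrapezoid_of_one_lt {s : ℂ} (hs : 1 < s.re) :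
    Filter.Tendsto (fun N : ℕ => zetaTrapezoid (N + 1) s) Filter.atTop (nhds (riemannZeta s)) := by
  have h1 : Filter.Tendsto (fun N : ℕ => ∑ n ∈ Finset.Ico 1 (N + 1), (n : ℂ) ^ (-s)) Filter.atTop
      (nhds (riemannZeta s)) := by
    have hsum := (Complex.summable_one_div_nat_cpow.mpr hs)
    have h2 := hsum.hasSum.tendsto_sum_nat
    rw [← zeta_eq_tsum_one_div_nat_cpow hs] at h2
    refine (h2.comp (Filter.tendsto_add_atTop_nat 1)).congr fun N => ?_
    have hs0 : s ≠ 0 := by rintro rfl; simp at hs; linarith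
    simp only [Function.comp]
    rw [Finset.range_eq_Ico, Finset.sum_eq_sum_Ico_succ_bot (Nat.succ_pos N)]
    simp [Complex.cpow_neg, hs0]
  have h3 : ∀ a : ℂ, a.re < 0 → Filter.Tendsto (fun N : ℕ => ((N + 1 : ℕ) : ℂ) ^ a) Filter.atTop
      (nhds 0) := by
    intro a ha
    rw [tendsto_zero_iff_norm_tendsto_zero]
    have h4 : Filter.Tendsto (fun N : ℕ => ((N + 1 : ℕ) : ℝ) ^ (-(-a.re))) Filter.atTop (nhds 0) :=
      (tendsto_rpow_neg_atTop (by linarith)).comp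
        (tendsto_natCast_atTop_atTop.comp (Filter.tendsto_add_atTop_nat 1))
    refine h4.congr fun N => ?_
    rw [neg_neg, Complex.norm_natCast_cpow_of_pos (Nat.succ_pos N)]
  have h5 := (h1.add ((h3 (-s) (by simp; linarith)).div_const 2)).add
    ((h3 (1 - s) (by simp; linarith)).div_const (s - 1))
  simpa [zetaTrapezoid] using h5

theorem differentiableAt_zetaTrapezoid {N : ℕ} (hN : 1 ≤ N) {s : ℂ} (hs : s ≠ 1) :
    DifferentiableAt ℂ (zetaTrapezoid N) s := by
  have h : ∀ n : ℕ, 1 ≤ n → ∀ f : ℂ → ℂ, DifferentiableAt ℂ f s →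
      DifferentiableAt ℂ (fun s => (n : ℂ) ^ f s) s := by
    intro n hn f hf
    exact hf.const_cpow (Or.inl (by exact_mod_cast Nat.pos_iff_ne_zero.mp hn))
  unfold zetaTrapezoid
  refine ((DifferentiableAt.fun_sum fun n hn => ?_).add ((h N hN _ (by fun_prop)).div_const 2)).add
    ((h N hN _ (by fun_prop)).div (by fun_prop) (sub_ne_zero.mpr hs))
  exact h n (Finset.mem_Ico.mp hn).1 _ (by fun_prop)

/-- The increments are `O(n^(-2))` uniformly on bounded parts of the quadrant `Re, Im > 0`, so the
limit is holomorphic there. It equals `ζ` where `Re > 1`, hence throughout by the identity theorem.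
The quadrant is convex and avoids the pole. -/
theorem tendsto_zetaTrapezoid {s : ℂ} (hs : 0 < s.re) (hi : 0 < s.im) :
    Filter.Tendsto (fun N : ℕ => zetaTrapezoid (N + 1) s) Filter.atTop (nhds (riemannZeta s)) := by
  -- Large enough for `s + 2`, a point with real part above `1`, to lie in the region along with
  -- `s`.
  set R := ‖s‖ + 3 with hR
  set U : Set ℂ := {z | 0 < z.re} ∩ {z | 0 < z.im} ∩ Metric.ball 0 R with hU
  have hUo : IsOpen U := ((isOpen_lt continuous_const continuous_re).inter
    (isOpen_lt continuous_const continuous_im)).inter Metric.isOpen_ball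
  have hUc : Convex ℝ U := ((convex_halfSpace_re_gt 0).inter (convex_halfSpace_im_gt 0)).inter
    (convex_ball 0 R)
  have hU1 : ∀ z ∈ U, z ≠ 1 := by
    rintro z hz rfl
    have := hz.1.2
    simp at this
  set D : ℕ → ℂ → ℂ := fun n z => zetaTrapezoid (n + 2) z - zetaTrapezoid (n + 1) z with hD
  set u : ℕ → ℝ := fun n => R * (R + 1) * (1 / ((n + 1 : ℕ) : ℝ) ^ 2) with hu
  have husum : Summable u :=
    ((summable_nat_add_iff 1).mpr (Real.summable_one_div_nat_pow.mpr (by norm_num))).mul_left _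
  have hDu : ∀ n, ∀ z ∈ U, ‖D n z‖ ≤ u n := by
    intro n z hz
    refine (norm_zetaTrapezoid_succ_sub_le (Nat.succ_pos n) (hU1 z hz) hz.1.1).trans ?_
    have h1 : ‖z‖ ≤ R := (mem_ball_zero_iff.mp hz.2).le
    have h2 : ‖z + 1‖ ≤ R + 1 := (norm_add_le _ _).trans (by simpa using h1)
    change ‖z‖ * ‖z + 1‖ * (1 / ((n + 1 : ℕ) : ℝ) ^ 2) ≤ R * (R + 1) * (1 / ((n + 1 : ℕ) : ℝ) ^ 2)
    gcongr
  have hDd : ∀ n, DifferentiableOn ℂ (D n) U := fun n z hz =>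
    ((differentiableAt_zetaTrapezoid (by lia) (hU1 z hz)).sub
      (differentiableAt_zetaTrapezoid (by lia) (hU1 z hz))).differentiableWithinAt
  have hlim : ∀ z ∈ U, Filter.Tendsto (fun N : ℕ => zetaTrapezoid (N + 1) z) Filter.atTop
      (nhds (zetaTrapezoid 1 z + ∑' n, D n z)) := by
    intro z hz
    have hsm : Summable fun n => D n z := Summable.of_norm_bounded husum fun n => hDu n z hz
    refine (hsm.hasSum.tendsto_sum_nat.const_add (zetaTrapezoid 1 z)).congr fun N => ?_
    rw [hD, Finset.sum_range_sub (fun n => zetaTrapezoid (n + 1) z)]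
    simp
  have hsU : s ∈ U := ⟨⟨hs, hi⟩, by rw [mem_ball_zero_iff, hR]; linarith⟩
  have hGd : DifferentiableOn ℂ (fun z => zetaTrapezoid 1 z + ∑' n, D n z) U :=
    DifferentiableOn.add
      (fun z hz => (differentiableAt_zetaTrapezoid le_rfl (hU1 z hz)).differentiableWithinAt)
      (differentiableOn_tsum_of_summable_norm husum hDd hUo hDu)
  have hZd : DifferentiableOn ℂ riemannZeta U := fun z hz =>
    (differentiableAt_riemannZeta (hU1 z hz)).differentiableWithinAt
  have hs2 : s + 2 ∈ U := by
    refine ⟨⟨by simp; linarith, by simpa using hi⟩, ?_⟩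
    rw [mem_ball_zero_iff, hR]
    refine (norm_add_le _ _).trans_lt ?_
    norm_num
  have heq := (hGd.analyticOnNhd hUo).eqOn_of_preconnected_of_eventuallyEq
    (hZd.analyticOnNhd hUo) hUc.isPreconnected hs2 (by
      have h1 : ∀ᶠ z in nhds (s + 2), z ∈ U ∩ {z | 1 < z.re} := by
        refine (hUo.inter (isOpen_lt continuous_const continuous_re)).mem_nhds ⟨hs2, ?_⟩
        simp
        linarith
      filter_upwards [h1] with z hz
      exact tendsto_nhds_unique (hlim z hz.1) (tendsto_zetaTrapezoid_of_one_lt hz.2))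
  rw [← heq hsU]
  exact hlim s hsU

/-- The kernel is its mean `1/12` plus a periodic function of mean zero. The constant part
integrates exactly; the other gains from `k` integrations by parts, and `s(s+1)` costs only `N²`,
which `x^(-(s+2))` repays. -/
theorem norm_integral_trapezoidKernel_le {k : ℕ} {s : ℂ} {N M : ℝ} (hs : 0 < s.re) (hN : 1 ≤ N)
    (hNM : N ≤ M) (hk : ‖s + 2‖ + k ≤ N) (hk' : N * ((‖s + 2‖ + k) / N) ^ k ≤ 1) :
    ‖s * (s + 1) * ∫ x in N..M, (trapezoidKernel x : ℂ) * (x : ℂ) ^ (-(s + 2))‖ ≤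
      (2 * k + 2) * N ^ (-s.re) := by
  have hN0 : 0 < N := by linarith
  have h2re : (s + 2).re = s.re + 2 := by simp
  have h1re : (s + 1).re = s.re + 1 := by simp
  have hI1 := norm_integral_periodic_mul_cpow_le k (fun x => trapezoidKernel x - 1 / 12)
    (continuous_trapezoidKernel.sub continuous_const) (fun x => by
      simp only [periodic_trapezoidKernel x])
    (by
      rw [intervalIntegral.integral_sub (continuous_trapezoidKernel.intervalIntegrable _ _) (by simp),
        integral_trapezoidKernel]
      norm_num) 1 (fun x => by
      rw [abs_le]
      constructor <;> linarith [trapezoidKernel_nonneg x, trapezoidKernel_le x]) (s + 2) N M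
    (by rw [h2re]; linarith) hN hNM hk
  have hs10 : s + 1 ≠ 0 := by
    intro h
    have := congrArg Complex.re h
    rw [h1re] at this
    simp at this
    linarith
  have h0 : (0 : ℝ) ∉ Set.uIcc N M := by
    rw [Set.uIcc_of_le hNM]
    intro h
    linarith [h.1]
  have hI2 : ∫ x in N..M, (x : ℂ) ^ (-(s + 2)) =
      ((N : ℂ) ^ (-(s + 1)) - (M : ℂ) ^ (-(s + 1))) / (s + 1) := by
    rw [integral_cpow (Or.inr ⟨by
      intro h
      apply hs10
      linear_combination -h, h0⟩)]
    rw [show -(s + 2) + 1 = -(s + 1) by ring, div_neg, ← neg_div, neg_sub]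
  have hsplit : ∫ x in N..M, (trapezoidKernel x : ℂ) * (x : ℂ) ^ (-(s + 2)) =
      (∫ x in N..M, ((trapezoidKernel x - 1 / 12 : ℝ) : ℂ) * (x : ℂ) ^ (-(s + 2))) +
      1 / 12 * ∫ x in N..M, (x : ℂ) ^ (-(s + 2)) := by
    rw [← intervalIntegral.integral_const_mul, ← intervalIntegral.integral_add]
    · refine intervalIntegral.integral_congr fun x _ => ?_
      push_cast
      ring
    · exact ((Complex.continuous_ofReal.comp
        (continuous_trapezoidKernel.sub continuous_const)).continuousOn.mul
        (continuousOn_ofReal_cpow hN hNM _)).intervalIntegrable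
    · exact (continuousOn_const.mul (continuousOn_ofReal_cpow hN hNM _)).intervalIntegrable
  have hss : ‖s‖ ≤ N := by
    have h3 : ‖s‖ ≤ ‖s + 2‖ := by
      rw [← abs_norm s, ← abs_norm (s + 2), ← sq_le_sq, ← Complex.normSq_eq_norm_sq,
        ← Complex.normSq_eq_norm_sq, Complex.normSq_apply, Complex.normSq_apply]
      simp
      nlinarith
    linarith [(Nat.cast_nonneg k : (0 : ℝ) ≤ k)]
  have hss1 : ‖s + 1‖ ≤ N := by
    have h3 : ‖s + 1‖ ≤ ‖s + 2‖ := by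
      rw [← abs_norm (s + 1), ← abs_norm (s + 2), ← sq_le_sq, ← Complex.normSq_eq_norm_sq,
        ← Complex.normSq_eq_norm_sq, Complex.normSq_apply, Complex.normSq_apply]
      simp
      nlinarith
    linarith [(Nat.cast_nonneg k : (0 : ℝ) ≤ k)]
  have hp : 0 ≤ N ^ (-s.re) := Real.rpow_nonneg hN0.le _
  have hp2 : N ^ (-(s + 2).re) = N ^ (-s.re) / N ^ 2 := by
    rw [h2re, neg_add, Real.rpow_add hN0, Real.rpow_neg hN0.le 2, div_eq_mul_inv]
    norm_num
  have hp1 : N ^ (-(s + 1).re) = N ^ (-s.re) / N := by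
    rw [h1re, neg_add, Real.rpow_add hN0, Real.rpow_neg_one, div_eq_mul_inv]
  have hA : ‖s * (s + 1)‖ * ‖∫ x in N..M, ((trapezoidKernel x - 1 / 12 : ℝ) : ℂ) *
      (x : ℂ) ^ (-(s + 2))‖ ≤ (2 * k + 1) * N ^ (-s.re) := by
    rw [norm_mul]
    calc _ ≤ N * N * (1 * N ^ (-(s + 2).re) * (2 * k + 1)) := by
          have : 0 ≤ N ^ (-(s + 2).re) := Real.rpow_nonneg hN0.le _
          gcongr
          refine hI1.trans ?_
          gcongr
      _ = _ := by rw [hp2]; field_simp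
  have hBd : ‖s * (s + 1) * (1 / 12 * ∫ x in N..M, (x : ℂ) ^ (-(s + 2)))‖ ≤ 1 * N ^ (-s.re) := by
    rw [hI2, show s * (s + 1) * (1 / 12 * (((N : ℂ) ^ (-(s + 1)) - (M : ℂ) ^ (-(s + 1))) / (s + 1))) =
      1 / 12 * s * ((N : ℂ) ^ (-(s + 1)) - (M : ℂ) ^ (-(s + 1))) by field_simp]
    rw [norm_mul, norm_mul]
    have hM : ‖(M : ℂ) ^ (-(s + 1))‖ ≤ N ^ (-s.re) / N := by
      rw [norm_ofReal_cpow_neg (by linarith), ← hp1]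
      exact Real.rpow_le_rpow_of_nonpos hN0 hNM (by rw [h1re]; linarith)
    have hN' : ‖(N : ℂ) ^ (-(s + 1))‖ ≤ N ^ (-s.re) / N := by
      rw [norm_ofReal_cpow_neg hN0, ← hp1]
    have h12 : ‖(1 / 12 : ℂ)‖ = 1 / 12 := by norm_num
    calc _ ≤ 1 / 12 * N * (N ^ (-s.re) / N + N ^ (-s.re) / N) := by
          rw [h12]
          gcongr
          exact (norm_sub_le _ _).trans (add_le_add hN' hM)
      _ = 1 / 6 * N ^ (-s.re) := by field_simp; ring
      _ ≤ 1 * N ^ (-s.re) := by gcongr; norm_num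
  rw [hsplit, mul_add]
  refine (norm_add_le _ _).trans ?_
  rw [norm_mul]
  linarith

theorem norm_zeta_sub_sum_le {k N : ℕ} {s : ℂ} (hs : 0 < s.re) (hi : 0 < s.im) (hN : 1 ≤ N)
    (hk : ‖s + 2‖ + k ≤ N) (hk' : N * ((‖s + 2‖ + k) / N) ^ k ≤ 1) :
    ‖riemannZeta s - ∑ n ∈ Finset.Icc 1 N, (n : ℂ) ^ (-s)‖ ≤
      (2 * k + 3) * (N : ℝ) ^ (-s.re) + (N : ℝ) ^ (1 - s.re) / ‖s - 1‖ := by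
  have hs1 : s ≠ 1 := by rintro rfl; simp at hi
  have hN1 : (1 : ℝ) ≤ N := by exact_mod_cast hN
  have hN0 : 0 < N := hN
  have h1 : ‖riemannZeta s - zetaTrapezoid N s‖ ≤ (2 * k + 2) * (N : ℝ) ^ (-s.re) := by
    refine le_of_tendsto ((tendsto_zetaTrapezoid hs hi).sub_const (zetaTrapezoid N s)).norm ?_
    filter_upwards [Filter.eventually_ge_atTop N] with M hM
    rw [zetaTrapezoid_sub hN (by lia) hs1]
    exact norm_integral_trapezoidKernel_le hs hN1 (by push_cast; exact_mod_cast (by lia)) hk hk'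
  have h2 : riemannZeta s - ∑ n ∈ Finset.Icc 1 N, (n : ℂ) ^ (-s) =
      (riemannZeta s - zetaTrapezoid N s) + (-((N : ℂ) ^ (-s) / 2) + (N : ℂ) ^ (1 - s) / (s - 1)) := by
    rw [zetaTrapezoid, ← Finset.Ico_add_one_right_eq_Icc, Finset.sum_Ico_succ_top hN]
    ring
  rw [h2]
  have h3 : ‖-((N : ℂ) ^ (-s) / 2)‖ ≤ (N : ℝ) ^ (-s.re) := by
    rw [norm_neg, norm_div, Complex.norm_natCast_cpow_of_pos hN0, neg_re]
    have : 0 ≤ (N : ℝ) ^ (-s.re) := Real.rpow_nonneg (by linarith) _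
    norm_num
    linarith
  have h4 : ‖(N : ℂ) ^ (1 - s) / (s - 1)‖ = (N : ℝ) ^ (1 - s.re) / ‖s - 1‖ := by
    rw [norm_div, Complex.norm_natCast_cpow_of_pos hN0, sub_re, one_re]
  have h5 := norm_add_le (riemannZeta s - zetaTrapezoid N s)
    (-((N : ℂ) ^ (-s) / 2) + (N : ℂ) ^ (1 - s) / (s - 1))
  have h6 := norm_add_le (-((N : ℂ) ^ (-s) / 2)) ((N : ℂ) ^ (1 - s) / (s - 1))
  linarith

/-- With the slightly excessive length `T^(1+ε)` each integration by parts saves about `T^ε`, so a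
number of them depending on `ε` alone removes the integral, while the pole term `N^(1-s)/(s-1)`
stays `O(T^(-1/4))`. -/
theorem exists_norm_zeta_sub_sum_le {ε : ℝ} (hε : 0 < ε) (hε' : ε ≤ 1 / 2) :
    ∃ C T₀ : ℝ, 0 < C ∧ 1 ≤ T₀ ∧ ∀ T : ℝ, T₀ ≤ T → ∀ s : ℂ, 1 / 2 ≤ s.re → s.re ≤ 6 →
      T / 2 ≤ s.im → s.im ≤ 3 * T →
      ‖riemannZeta s - ∑ n ∈ Finset.Icc 1 ⌈T ^ (1 + ε)⌉₊, (n : ℂ) ^ (-s)‖ ≤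
        C * T ^ (-(1 / 4) : ℝ) := by
  obtain ⟨k, hk⟩ := exists_nat_gt (3 / ε)
  have hk3 : 3 ≤ ε * k := by
    rw [div_lt_iff₀ hε] at hk
    linarith
  -- `2k + 3` comes from the trapezoid error and its half end term, `4` from the pole term. The
  -- thresholds ensure `|s + 2| + k ≤ 4T`, `T^ε ≥ 4` and `2 · 4^k ≤ T`.
  refine ⟨2 * k + 7, max (max 8 (8 + k)) (max (4 ^ (1 / ε)) (2 * 4 ^ k)), by positivity,
    ((by norm_num : (1 : ℝ) ≤ 8).trans (le_max_left _ _)).trans (le_max_left _ _), ?_⟩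
  intro T hT s hs hs6 hi hi3
  simp only [max_le_iff] at hT
  obtain ⟨⟨hT8, hTk⟩, hT4, hTk4⟩ := hT
  have hT0 : 0 < T := by linarith
  have hT1 : 1 ≤ T := by linarith
  set N := ⌈T ^ (1 + ε)⌉₊ with hN
  have hTε : 4 ≤ T ^ ε := by
    calc (4 : ℝ) = (4 ^ (1 / ε)) ^ ε := by
          rw [← Real.rpow_mul (by norm_num), one_div, inv_mul_cancel₀ hε.ne', Real.rpow_one]
      _ ≤ T ^ ε := by gcongr
  have hT1ε : T ^ (1 + ε) = T * T ^ ε := by rw [Real.rpow_add hT0, Real.rpow_one]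
  have hNl : T ^ (1 + ε) ≤ N := Nat.le_ceil _
  have hNu : (N : ℝ) ≤ 2 * T ^ (1 + ε) := by
    have := (Nat.ceil_lt_add_one (show 0 ≤ T ^ (1 + ε) by positivity)).le
    have h1 : 1 ≤ T ^ (1 + ε) := Real.one_le_rpow hT1 (by linarith)
    linarith
  have hN4T : 4 * T ≤ N := by nlinarith
  have hN0 : (0 : ℝ) < N := by linarith
  have hNT : T ≤ N := by linarith
  have hs2 : ‖s + 2‖ + k ≤ 4 * T := by
    have := Complex.norm_le_abs_re_add_abs_im (s + 2)
    simp only [add_re, re_ofNat, add_im, im_ofNat, add_zero] at this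
    rw [abs_of_nonneg (by linarith), abs_of_nonneg (by linarith)] at this
    linarith
  have hpow : N * ((‖s + 2‖ + k) / N) ^ k ≤ 1 := by
    have h1 : (‖s + 2‖ + k) / N ≤ 4 * T ^ (-ε) := by
      rw [div_le_iff₀ hN0]
      calc ‖s + 2‖ + k ≤ 4 * T := hs2
        _ = 4 * T ^ (-ε) * T ^ (1 + ε) := by
          rw [mul_assoc, ← Real.rpow_add hT0]; simp
        _ ≤ _ := by gcongr
    have h2 : (T ^ (-ε)) ^ k ≤ T ^ (-3 : ℝ) := by
      rw [← Real.rpow_natCast, ← Real.rpow_mul hT0.le]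
      apply Real.rpow_le_rpow_of_exponent_le hT1
      linarith
    have h3 : T ^ (1 + ε) ≤ T ^ (2 : ℝ) := Real.rpow_le_rpow_of_exponent_le hT1 (by linarith)
    calc (N : ℝ) * ((‖s + 2‖ + k) / N) ^ k ≤ 2 * T ^ (1 + ε) * (4 * T ^ (-ε)) ^ k := by gcongr
      _ = 2 * T ^ (1 + ε) * (4 ^ k * (T ^ (-ε)) ^ k) := by rw [mul_pow]
      _ ≤ 2 * T ^ (2 : ℝ) * (4 ^ k * T ^ (-3 : ℝ)) := by gcongr
      _ = 2 * 4 ^ k * (T ^ (2 : ℝ) * T ^ (-3 : ℝ)) := by ring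
      _ = 2 * 4 ^ k / T := by
        rw [← Real.rpow_add hT0, div_eq_mul_inv, ← Real.rpow_neg_one]; norm_num
      _ ≤ 1 := by rw [div_le_one hT0]; exact hTk4
  have hN1 : 1 ≤ N := by
    have : (1 : ℝ) ≤ N := by linarith
    exact_mod_cast this
  have h := norm_zeta_sub_sum_le (k := k) (N := N) (s := s) (by linarith) (by linarith) hN1
    (by linarith) hpow
  refine h.trans ?_
  have hNR : (1 : ℝ) ≤ N := by linarith
  have e1 : (N : ℝ) ^ (-s.re) ≤ T ^ (-(1 / 4) : ℝ) := by
    calc (N : ℝ) ^ (-s.re) ≤ (N : ℝ) ^ (-(1 / 4) : ℝ) :=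
          Real.rpow_le_rpow_of_exponent_le hNR (by linarith)
      _ ≤ T ^ (-(1 / 4) : ℝ) := Real.rpow_le_rpow_of_nonpos hT0 hNT (by norm_num)
  have e2 : (N : ℝ) ^ (1 - s.re) ≤ 2 * T ^ (3 / 4 : ℝ) := by
    calc (N : ℝ) ^ (1 - s.re) ≤ (N : ℝ) ^ (1 / 2 : ℝ) :=
          Real.rpow_le_rpow_of_exponent_le hNR (by linarith)
      _ ≤ (4 * T ^ (3 / 2 : ℝ)) ^ (1 / 2 : ℝ) := by
        gcongr
        refine hNu.trans ?_
        have : T ^ (1 + ε) ≤ T ^ (3 / 2 : ℝ) := Real.rpow_le_rpow_of_exponent_le hT1 (by linarith)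
        have : 0 ≤ T ^ (3 / 2 : ℝ) := by positivity
        linarith
      _ = 2 * T ^ (3 / 4 : ℝ) := by
        rw [Real.mul_rpow (by norm_num) (by positivity), ← Real.rpow_mul hT0.le,
          show (4 : ℝ) = 2 ^ (2 : ℝ) by norm_num, ← Real.rpow_mul (by norm_num)]
        norm_num
  have e3 : T / 2 ≤ ‖s - 1‖ := by
    refine hi.trans ?_
    have := Complex.abs_im_le_norm (s - 1)
    simp only [sub_im, one_im, sub_zero] at this
    exact (le_abs_self _).trans this
  have e4 : (N : ℝ) ^ (1 - s.re) / ‖s - 1‖ ≤ 4 * T ^ (-(1 / 4) : ℝ) := by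
    calc (N : ℝ) ^ (1 - s.re) / ‖s - 1‖ ≤ 2 * T ^ (3 / 4 : ℝ) / (T / 2) := by gcongr
      _ = 4 * (T ^ (3 / 4 : ℝ) * T⁻¹) := by field_simp; ring
      _ = _ := by rw [← Real.rpow_neg_one, ← Real.rpow_add hT0]; norm_num
  have : (2 * (k : ℝ) + 3) * (N : ℝ) ^ (-s.re) ≤ (2 * k + 3) * T ^ (-(1 / 4) : ℝ) := by gcongr
  linarith

theorem exists_norm_zeta_le_pow : ∃ T₀ : ℝ, 1 ≤ T₀ ∧ ∀ T : ℝ, T₀ ≤ T → ∀ s : ℂ, 1 / 2 ≤ s.re →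
    s.re ≤ 6 → T / 2 ≤ s.im → s.im ≤ 3 * T → ‖riemannZeta s‖ ≤ T ^ 3 := by
  obtain ⟨C, T₀, hC, hT₀, h⟩ := exists_norm_zeta_sub_sum_le (ε := 1 / 2) (by norm_num) le_rfl
  refine ⟨max T₀ (2 + C), hT₀.trans (le_max_left _ _), fun T hT s h1 h2 h3 h4 => ?_⟩
  simp only [max_le_iff] at hT
  have hT1 : 1 ≤ T := by linarith
  have h5 := h T hT.1 s h1 h2 h3 h4
  set N := ⌈T ^ (1 + 1 / 2 : ℝ)⌉₊
  have hNu : (N : ℝ) ≤ T ^ 2 + 1 := by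
    have h6 := (Nat.ceil_lt_add_one (show 0 ≤ T ^ (1 + 1 / 2 : ℝ) by positivity)).le
    have h7 : T ^ (1 + 1 / 2 : ℝ) ≤ T ^ (2 : ℝ) :=
      Real.rpow_le_rpow_of_exponent_le hT1 (by norm_num)
    rw [Real.rpow_ofNat] at h7
    exact h6.trans (by linarith)
  have h8 : ‖∑ n ∈ Finset.Icc 1 N, (n : ℂ) ^ (-s)‖ ≤ N := by
    refine (norm_sum_le _ _).trans ?_
    calc ∑ n ∈ Finset.Icc 1 N, ‖(n : ℂ) ^ (-s)‖ ≤ ∑ n ∈ Finset.Icc 1 N, (1 : ℝ) := by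
          refine Finset.sum_le_sum fun n hn => ?_
          have hn1 := (Finset.mem_Icc.mp hn).1
          rw [Complex.norm_natCast_cpow_of_pos hn1, neg_re]
          exact Real.rpow_le_one_of_one_le_of_nonpos (by exact_mod_cast hn1) (by linarith)
      _ = N := by simp
  have h9 : T ^ (-(1 / 4) : ℝ) ≤ 1 := Real.rpow_le_one_of_one_le_of_nonpos hT1 (by norm_num)
  have h10 := norm_sub_norm_le (riemannZeta s) (∑ n ∈ Finset.Icc 1 N, (n : ℂ) ^ (-s))
  nlinarith [hT.2, sq_nonneg T]

/-! ### The divisor bound and the off-diagonal sums. -/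

/-- By multiplicativity only `(e + 1) / p^(eε)` matters: it is at most `1` once `p ≥ 2^(1/ε)`, and
at most `K` for the finitely many smaller primes. -/
theorem exists_card_divisors_le {ε : ℝ} (hε : 0 < ε) :
    ∃ C : ℝ, 0 < C ∧ ∀ n : ℕ, n ≠ 0 → (n.divisors.card : ℝ) ≤ C * (n : ℝ) ^ ε := by
  obtain ⟨P, hP⟩ := exists_nat_ge ((2 : ℝ) ^ (1 / ε))
  have hl2 : 0 < Real.log 2 := Real.log_pos (by norm_num)
  set K : ℝ := 1 + 1 / (ε * Real.log 2) with hK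
  have hK1 : 1 ≤ K := by
    rw [hK]
    have : 0 < 1 / (ε * Real.log 2) := by positivity
    linarith
  have hloc : ∀ p : ℕ, 2 ≤ p → ∀ e : ℕ,
      ((e : ℝ) + 1) ≤ (if p < P then K else 1) * ((p : ℝ) ^ e) ^ ε := by
    intro p hp e
    have hp2 : (2 : ℝ) ≤ p := by exact_mod_cast hp
    split_ifs with h
    · have h1 : 1 + e * (ε * Real.log 2) ≤ ((p : ℝ) ^ e) ^ ε := by
        calc 1 + e * (ε * Real.log 2) ≤ Real.exp (e * (ε * Real.log 2)) := by
              rw [add_comm]; exact Real.add_one_le_exp _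
          _ = ((2 : ℝ) ^ e) ^ ε := by
            rw [← Real.rpow_natCast, ← Real.rpow_mul (by norm_num), Real.rpow_def_of_pos (by norm_num)]
            congr 1; ring
          _ ≤ _ := by gcongr
      have h2 : 1 ≤ ((p : ℝ) ^ e) ^ ε :=
        Real.one_le_rpow (one_le_pow₀ (by linarith)) hε.le
      have h3 : K * (1 + e * (ε * Real.log 2)) = 1 + e + e * (ε * Real.log 2) + 1 / (ε * Real.log 2) := by
        rw [hK]; field_simp; ring
      have h4 : 0 ≤ 1 / (ε * Real.log 2) := by positivity
      have h5 : 0 ≤ e * (ε * Real.log 2) := by positivity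
      calc (e : ℝ) + 1 ≤ K * (1 + e * (ε * Real.log 2)) := by rw [h3]; linarith
        _ ≤ _ := by gcongr
    · push Not at h
      rw [one_mul]
      have h1 : (2 : ℝ) ≤ (p : ℝ) ^ ε := by
        calc (2 : ℝ) = (2 ^ (1 / ε)) ^ ε := by
              rw [← Real.rpow_mul (by norm_num), one_div, inv_mul_cancel₀ hε.ne', Real.rpow_one]
          _ ≤ (p : ℝ) ^ ε := by
            gcongr
            exact hP.trans (by exact_mod_cast h)
      calc (e : ℝ) + 1 ≤ 2 ^ e := by
            exact_mod_cast Nat.lt_two_pow_self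
        _ ≤ ((p : ℝ) ^ ε) ^ e := by gcongr
        _ = _ := by
          rw [← Real.rpow_natCast, ← Real.rpow_natCast, ← Real.rpow_mul (by positivity),
            ← Real.rpow_mul (by positivity), mul_comm]
  refine ⟨K ^ P, by positivity, fun n hn => ?_⟩
  rw [Nat.card_divisors hn]
  push_cast
  calc ∏ p ∈ n.primeFactors, ((n.factorization p : ℝ) + 1)
      ≤ ∏ p ∈ n.primeFactors, (if p < P then K else 1) * ((p : ℝ) ^ n.factorization p) ^ ε := by
        refine Finset.prod_le_prod (fun p _ => by positivity) fun p hp => ?_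
        exact hloc p (Nat.prime_of_mem_primeFactors hp).two_le _
    _ = (∏ p ∈ n.primeFactors, if p < P then K else 1) * (n : ℝ) ^ ε := by
      rw [Finset.prod_mul_distrib, Real.finsetProd_rpow _ _ (fun p _ => by positivity)]
      congr 2
      conv_rhs => rw [← Nat.prod_factorization_pow_eq_self hn]
      rw [Finsupp.prod]
      push_cast
      rfl
    _ ≤ K ^ P * (n : ℝ) ^ ε := by
      gcongr
      rw [← Finset.prod_filter, Finset.prod_const]
      apply pow_le_pow_right₀ hK1
      calc _ ≤ (Finset.range P).card := by
            apply Finset.card_le_card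
            intro p hp
            simpa using (Finset.mem_filter.mp hp).2
        _ = P := Finset.card_range P

theorem sum_rpow_neg_le {β : ℝ} (hβ0 : 0 ≤ β) (hβ : β < 1) (L : ℕ) :
    ∑ n ∈ Finset.Icc 1 L, (n : ℝ) ^ (-β) ≤ (L : ℝ) ^ (1 - β) / (1 - β) := by
  have hb : 0 < 1 - β := by linarith
  induction L with
  | zero => simp; positivity
  | succ L ih =>
    rw [Finset.sum_Icc_succ_top (by lia)]
    have hL0 : (0 : ℝ) < (L : ℝ) + 1 := by positivity
    have h1 : (L : ℝ) ^ (1 - β) ≤ ((L : ℝ) + 1) ^ (1 - β) - (1 - β) * ((L : ℝ) + 1) ^ (-β) := by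
      have h2 := rpow_one_add_le_one_add_mul_self (s := -1 / ((L : ℝ) + 1)) (p := 1 - β)
        (by rw [le_div_iff₀ hL0]; linarith [(Nat.cast_nonneg L : (0 : ℝ) ≤ L)]) hb.le (by linarith)
      have h3 : (L : ℝ) = ((L : ℝ) + 1) * (1 + -1 / ((L : ℝ) + 1)) := by field_simp; ring
      have h4 : 0 ≤ 1 + -1 / ((L : ℝ) + 1) := by
        have : 1 + -1 / ((L : ℝ) + 1) = L / (L + 1) := by field_simp; ring
        rw [this]; positivity
      calc (L : ℝ) ^ (1 - β) = (((L : ℝ) + 1) * (1 + -1 / ((L : ℝ) + 1))) ^ (1 - β) := by rw [← h3]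
        _ = ((L : ℝ) + 1) ^ (1 - β) * (1 + -1 / ((L : ℝ) + 1)) ^ (1 - β) :=
          Real.mul_rpow hL0.le h4
        _ ≤ ((L : ℝ) + 1) ^ (1 - β) * (1 + (1 - β) * (-1 / ((L : ℝ) + 1))) := by gcongr
        _ = ((L : ℝ) + 1) ^ (1 - β) - (1 - β) * (((L : ℝ) + 1) ^ (1 - β) * ((L : ℝ) + 1)⁻¹) := by
          field_simp; ring
        _ = _ := by
          rw [← Real.rpow_neg_one, ← Real.rpow_add hL0]; ring_nf
    push_cast
    calc _ ≤ (L : ℝ) ^ (1 - β) / (1 - β) + ((L : ℝ) + 1) ^ (-β) := by gcongr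
      _ ≤ (((L : ℝ) + 1) ^ (1 - β) - (1 - β) * ((L : ℝ) + 1) ^ (-β)) / (1 - β) +
          ((L : ℝ) + 1) ^ (-β) := by gcongr
      _ = _ := by field_simp; ring

theorem inv_abs_log_sub_le {m n : ℕ} (hm : 1 ≤ m) (hmn : m < n) :
    1 / |Real.log n - Real.log m| ≤ 1 + m / ((n : ℝ) - m) := by
  have hm0 : (0 : ℝ) < m := by exact_mod_cast hm
  have hmn' : (m : ℝ) < n := by exact_mod_cast hmn
  have hn0 : (0 : ℝ) < n := by linarith
  have h1 : ((n : ℝ) - m) / n ≤ Real.log n - Real.log m := by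
    have := Real.one_sub_inv_le_log_of_pos (x := (n : ℝ) / m) (by positivity)
    rw [Real.log_div hn0.ne' hm0.ne', inv_div] at this
    calc ((n : ℝ) - m) / n = 1 - m / n := by field_simp
      _ ≤ _ := this
  have h2 : 0 < ((n : ℝ) - m) / n := div_pos (by linarith) hn0
  rw [abs_of_pos (by linarith)]
  calc 1 / (Real.log n - Real.log m) ≤ 1 / (((n : ℝ) - m) / n) := by gcongr
    _ = 1 + m / ((n : ℝ) - m) := by
      have : (n : ℝ) - m ≠ 0 := by linarith
      field_simp
      ring

/-- For `m < n`, `1 / log (n/m) ≤ 1 + m/(n-m)`, and `m · m^(-α) n^(-α) ≤ m^(1-2α)`. The right side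
is made symmetric in `m` and `n` so that it can be summed over all pairs. -/
theorem rpow_mul_rpow_inv_abs_log_le {α : ℝ} (hα : 1 / 2 ≤ α) {m n : ℕ} (hm : 1 ≤ m)
    (hn : 1 ≤ n) (hmn : m ≠ n) :
    (m : ℝ) ^ (-α) * (n : ℝ) ^ (-α) * (2 / |Real.log n - Real.log m|) ≤
      2 * ((m : ℝ) ^ (-α) * (n : ℝ) ^ (-α)) +
      2 * (((m : ℝ) ^ (1 - 2 * α) + (n : ℝ) ^ (1 - 2 * α)) * |(n : ℝ) - m|⁻¹) := by
  wlog h : m < n generalizing m n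
  · have := this hn hm hmn.symm (lt_of_le_of_ne (not_lt.mp h) hmn.symm)
    rw [abs_sub_comm (Real.log n), abs_sub_comm (n : ℝ), mul_comm ((m : ℝ) ^ (-α)),
      add_comm ((m : ℝ) ^ (1 - 2 * α))]
    exact this
  have hm0 : (0 : ℝ) < m := by exact_mod_cast hm
  have hmn' : (m : ℝ) < n := by exact_mod_cast h
  have hn0 : (0 : ℝ) < n := by linarith
  have h1 := inv_abs_log_sub_le hm h
  have h2 : (n : ℝ) ^ (-α) ≤ (m : ℝ) ^ (-α) := Real.rpow_le_rpow_of_nonpos hm0 hmn'.le (by linarith)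
  have h3 : (m : ℝ) ^ (-α) * (m : ℝ) ^ (-α) * m = (m : ℝ) ^ (1 - 2 * α) := by
    rw [← Real.rpow_add hm0, ← Real.rpow_add_one hm0.ne']
    ring_nf
  have h4 : 0 ≤ (n : ℝ) ^ (1 - 2 * α) := by positivity
  have h5 : 0 < (n : ℝ) - m := by linarith
  rw [abs_of_pos h5]
  have hma : 0 ≤ (m : ℝ) ^ (-α) := by positivity
  calc (m : ℝ) ^ (-α) * (n : ℝ) ^ (-α) * (2 / |Real.log n - Real.log m|)
      = 2 * ((m : ℝ) ^ (-α) * (n : ℝ) ^ (-α)) * (1 / |Real.log n - Real.log m|) := by ring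
    _ ≤ 2 * ((m : ℝ) ^ (-α) * (n : ℝ) ^ (-α)) * (1 + m / ((n : ℝ) - m)) := by gcongr
    _ = 2 * ((m : ℝ) ^ (-α) * (n : ℝ) ^ (-α)) +
        2 * ((m : ℝ) ^ (-α) * (n : ℝ) ^ (-α) * m * ((n : ℝ) - m)⁻¹) := by ring
    _ ≤ 2 * ((m : ℝ) ^ (-α) * (n : ℝ) ^ (-α)) +
        2 * ((m : ℝ) ^ (-α) * (m : ℝ) ^ (-α) * m * ((n : ℝ) - m)⁻¹) := by gcongr
    _ ≤ _ := by
      rw [h3]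
      gcongr
      linarith

theorem sum_inv_abs_sub_le (L m : ℕ) (hm : m ∈ Finset.Icc 1 L) :
    ∑ n ∈ (Finset.Icc 1 L).erase m, |(n : ℝ) - m|⁻¹ ≤ 2 * (1 + Real.log L) := by
  have hH : ∀ J : ℕ, J ≤ L → ∑ j ∈ Finset.Icc 1 J, ((j : ℝ))⁻¹ ≤ 1 + Real.log L := by
    intro J hJ
    have h1 := harmonic_le_one_add_log L
    rw [harmonic_eq_sum_Icc] at h1
    push_cast at h1
    refine le_trans ?_ h1
    exact Finset.sum_le_sum_of_subset_of_nonneg (Finset.Icc_subset_Icc_right hJ)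
      fun _ _ _ => by positivity
  obtain ⟨hm1, hmL⟩ := Finset.mem_Icc.mp hm
  have hsplit : (Finset.Icc 1 L).erase m = Finset.Ico 1 m ∪ Finset.Ioc m L := by
    ext n
    simp only [Finset.mem_erase, Finset.mem_Icc, Finset.mem_union, Finset.mem_Ico, Finset.mem_Ioc]
    lia
  have hdisj : Disjoint (Finset.Ico 1 m) (Finset.Ioc m L) := by
    rw [Finset.disjoint_left]
    intro n h1 h2
    simp only [Finset.mem_Ico, Finset.mem_Ioc] at h1 h2
    lia
  rw [hsplit, Finset.sum_union hdisj]
  have hA : ∑ n ∈ Finset.Ico 1 m, |(n : ℝ) - m|⁻¹ = ∑ j ∈ Finset.Icc 1 (m - 1), ((j : ℝ))⁻¹ := by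
    refine Finset.sum_nbij' (fun n => m - n) (fun j => m - j) ?_ ?_ ?_ ?_ ?_
    · intro n hn; simp only [Finset.mem_Ico, Finset.mem_Icc] at *; lia
    · intro n hn; simp only [Finset.mem_Ico, Finset.mem_Icc] at *; lia
    · intro n hn; simp only [Finset.mem_Ico] at *; lia
    · intro n hn; simp only [Finset.mem_Icc] at *; lia
    · intro n hn
      have hn' := (Finset.mem_Ico.mp hn).2
      have : (n : ℝ) < m := by exact_mod_cast hn'
      rw [abs_of_neg (by linarith), Nat.cast_sub hn'.le, neg_sub]
  have hB : ∑ n ∈ Finset.Ioc m L, |(n : ℝ) - m|⁻¹ = ∑ j ∈ Finset.Icc 1 (L - m), ((j : ℝ))⁻¹ := by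
    refine Finset.sum_nbij' (fun n => n - m) (fun j => j + m) ?_ ?_ ?_ ?_ ?_
    · intro n hn; simp only [Finset.mem_Ioc, Finset.mem_Icc] at *; lia
    · intro n hn; simp only [Finset.mem_Ioc, Finset.mem_Icc] at *; lia
    · intro n hn; simp only [Finset.mem_Ioc] at *; lia
    · intro n hn; simp only [Finset.mem_Icc] at *; lia
    · intro n hn
      have hn' := (Finset.mem_Ioc.mp hn).1
      have : (m : ℝ) < n := by exact_mod_cast hn'
      rw [abs_of_pos (by linarith), Nat.cast_sub hn'.le]
  rw [hA, hB]
  have := hH (m - 1) (by lia)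
  have := hH (L - m) (by lia)
  linarith

/-- The first part of the pairwise bound factors into two sums. In the second, exchanging `m` and
`n` leaves the power on the outer variable, so the inner sum is harmonic and costs a logarithm. -/
theorem sum_offDiag_le {α : ℝ} (hα : 1 / 2 ≤ α) (hα1 : α < 1) (L : ℕ) (hL : 1 ≤ L) :
    ∑ m ∈ Finset.Icc 1 L, ∑ n ∈ (Finset.Icc 1 L).erase m,
      (m : ℝ) ^ (-α) * (n : ℝ) ^ (-α) * (2 / |Real.log n - Real.log m|) ≤
      (2 / (1 - α) ^ 2 + 4 / (1 - α)) * ((L : ℝ) ^ (2 - 2 * α) * (1 + Real.log L)) := by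
  set s := Finset.Icc 1 L with hs
  have h1 : ∀ n ∈ s, 1 ≤ n := fun n hn => (Finset.mem_Icc.mp hn).1
  have hL1 : (1 : ℝ) ≤ L := by exact_mod_cast hL
  have hlog : 0 ≤ Real.log L := Real.log_nonneg hL1
  have ha : 0 < 1 - α := by linarith
  have hstep : ∑ m ∈ s, ∑ n ∈ s.erase m,
      (m : ℝ) ^ (-α) * (n : ℝ) ^ (-α) * (2 / |Real.log n - Real.log m|) ≤
      ∑ m ∈ s, ∑ n ∈ s.erase m, (2 * ((m : ℝ) ^ (-α) * (n : ℝ) ^ (-α)) +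
      2 * (((m : ℝ) ^ (1 - 2 * α) + (n : ℝ) ^ (1 - 2 * α)) * |(n : ℝ) - m|⁻¹)) := by
    refine Finset.sum_le_sum fun m hm => Finset.sum_le_sum fun n hn => ?_
    exact rpow_mul_rpow_inv_abs_log_le hα (h1 m hm) (h1 n (Finset.mem_erase.mp hn).2)
      (Finset.mem_erase.mp hn).1.symm
  refine hstep.trans ?_
  have hsym : ∑ m ∈ s, ∑ n ∈ s.erase m, (n : ℝ) ^ (1 - 2 * α) * |(n : ℝ) - m|⁻¹ =
      ∑ m ∈ s, ∑ n ∈ s.erase m, (m : ℝ) ^ (1 - 2 * α) * |(n : ℝ) - m|⁻¹ := by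
    rw [Finset.sum_comm' (s' := fun n => s.erase n) (t' := s)]
    · refine Finset.sum_congr rfl fun m _ => Finset.sum_congr rfl fun n _ => ?_
      rw [abs_sub_comm]
    · intro m n
      simp only [Finset.mem_erase]
      tauto
  have e1 : ∑ m ∈ s, ∑ n ∈ s.erase m, ((m : ℝ) ^ (-α) * (n : ℝ) ^ (-α)) ≤
      (L : ℝ) ^ (2 - 2 * α) / (1 - α) ^ 2 := by
    calc _ ≤ ∑ m ∈ s, ∑ n ∈ s, ((m : ℝ) ^ (-α) * (n : ℝ) ^ (-α)) := by
          refine Finset.sum_le_sum fun m _ => ?_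
          exact Finset.sum_le_sum_of_subset_of_nonneg (Finset.erase_subset _ _)
            fun _ _ _ => by positivity
      _ = (∑ m ∈ s, (m : ℝ) ^ (-α)) * ∑ n ∈ s, (n : ℝ) ^ (-α) := by rw [Finset.sum_mul_sum]
      _ ≤ ((L : ℝ) ^ (1 - α) / (1 - α)) * ((L : ℝ) ^ (1 - α) / (1 - α)) := by
        have := sum_rpow_neg_le (by linarith : 0 ≤ α) hα1 L
        have h0 : 0 ≤ ∑ m ∈ s, (m : ℝ) ^ (-α) := Finset.sum_nonneg fun _ _ => by positivity
        gcongr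
      _ = _ := by
        rw [div_mul_div_comm, ← Real.rpow_add (by linarith)]
        ring_nf
  have e2 : ∑ m ∈ s, ∑ n ∈ s.erase m, (m : ℝ) ^ (1 - 2 * α) * |(n : ℝ) - m|⁻¹ ≤
      (L : ℝ) ^ (2 - 2 * α) / (2 - 2 * α) * (2 * (1 + Real.log L)) := by
    calc _ = ∑ m ∈ s, (m : ℝ) ^ (-(2 * α - 1)) * ∑ n ∈ s.erase m, |(n : ℝ) - m|⁻¹ := by
          refine Finset.sum_congr rfl fun m _ => ?_
          rw [Finset.mul_sum, neg_sub]
      _ ≤ ∑ m ∈ s, (m : ℝ) ^ (-(2 * α - 1)) * (2 * (1 + Real.log L)) := by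
        refine Finset.sum_le_sum fun m hm => ?_
        gcongr
        exact sum_inv_abs_sub_le L m hm
      _ = (∑ m ∈ s, (m : ℝ) ^ (-(2 * α - 1))) * (2 * (1 + Real.log L)) := by rw [Finset.sum_mul]
      _ ≤ _ := by
        have := sum_rpow_neg_le (β := 2 * α - 1) (by linarith) (by linarith) L
        rw [show 1 - (2 * α - 1) = 2 - 2 * α by ring] at this
        gcongr
  have hexp : ∑ m ∈ s, ∑ n ∈ s.erase m, (2 * ((m : ℝ) ^ (-α) * (n : ℝ) ^ (-α)) +
      2 * (((m : ℝ) ^ (1 - 2 * α) + (n : ℝ) ^ (1 - 2 * α)) * |(n : ℝ) - m|⁻¹)) =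
      2 * ∑ m ∈ s, ∑ n ∈ s.erase m, ((m : ℝ) ^ (-α) * (n : ℝ) ^ (-α)) +
      2 * (∑ m ∈ s, ∑ n ∈ s.erase m, (m : ℝ) ^ (1 - 2 * α) * |(n : ℝ) - m|⁻¹ +
        ∑ m ∈ s, ∑ n ∈ s.erase m, (n : ℝ) ^ (1 - 2 * α) * |(n : ℝ) - m|⁻¹) := by
    simp only [Finset.sum_add_distrib, Finset.mul_sum, add_mul, mul_add]
  rw [hexp, hsym]
  have h0 : 0 ≤ (L : ℝ) ^ (2 - 2 * α) / (1 - α) ^ 2 := by positivity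
  calc _ ≤ 2 * ((L : ℝ) ^ (2 - 2 * α) / (1 - α) ^ 2) +
        2 * ((L : ℝ) ^ (2 - 2 * α) / (2 - 2 * α) * (2 * (1 + Real.log L)) +
        (L : ℝ) ^ (2 - 2 * α) / (2 - 2 * α) * (2 * (1 + Real.log L))) := by gcongr
    _ = 2 * ((L : ℝ) ^ (2 - 2 * α) / (1 - α) ^ 2) * 1 +
        4 * ((L : ℝ) ^ (2 - 2 * α) / (1 - α)) * (1 + Real.log L) := by
      rw [show 2 - 2 * α = 2 * (1 - α) by ring]
      field_simp
      ring
    _ ≤ 2 * ((L : ℝ) ^ (2 - 2 * α) / (1 - α) ^ 2) * (1 + Real.log L) +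
        4 * ((L : ℝ) ^ (2 - 2 * α) / (1 - α)) * (1 + Real.log L) := by
      gcongr
      linarith
    _ = _ := by ring

/-! ### The mollified zeta function and the rarity of its zeros. -/

/-- The Dirichlet coefficients of `(∑_{n ≤ N} n^{-s}) (∑_{m ≤ X} μ(m) m^{-s})`. -/
def mollifiedCoeff (N X n : ℕ) : ℤ :=
  ∑ q ∈ (Finset.Icc 1 N ×ˢ Finset.Icc 1 X) with q.1 * q.2 = n, ArithmeticFunction.moebius q.2

theorem sum_mul_sum_moebius (N X : ℕ) (s : ℂ) :
    (∑ n ∈ Finset.Icc 1 N, (n : ℂ) ^ (-s)) *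
      (∑ m ∈ Finset.Icc 1 X, (ArithmeticFunction.moebius m : ℂ) * (m : ℂ) ^ (-s)) =
    ∑ n ∈ Finset.Icc 1 (N * X), (mollifiedCoeff N X n : ℂ) * (n : ℂ) ^ (-s) := by
  rw [Finset.sum_mul_sum, ← Finset.sum_product',
    ← Finset.sum_fiberwise_of_maps_to (g := fun q : ℕ × ℕ => q.1 * q.2) (t := Finset.Icc 1 (N * X))]
  · refine Finset.sum_congr rfl fun n _ => ?_
    rw [mollifiedCoeff]
    push_cast
    rw [Finset.sum_mul]
    refine Finset.sum_congr rfl fun q hq => ?_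
    rw [← (Finset.mem_filter.mp hq).2, Nat.cast_mul, Complex.natCast_mul_natCast_cpow]
    ring
  · intro q hq
    simp only [Finset.mem_product, Finset.mem_Icc] at hq ⊢
    exact ⟨Nat.mul_pos hq.1.1 hq.2.1, Nat.mul_le_mul hq.1.2 hq.2.2⟩

theorem abs_mollifiedCoeff_le_card (N X n : ℕ) :
    |(mollifiedCoeff N X n : ℝ)| ≤
      (((Finset.Icc 1 N ×ˢ Finset.Icc 1 X).filter fun q => q.1 * q.2 = n).card : ℝ) := by
  rw [mollifiedCoeff]
  push_cast
  refine (Finset.abs_sum_le_sum_abs _ _).trans ?_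
  rw [← nsmul_one, ← Finset.sum_const]
  refine Finset.sum_le_sum fun q _ => ?_
  have := ArithmeticFunction.abs_moebius_le_one (n := q.2)
  exact_mod_cast this

/-- Serves the diagonal terms, where losing `n^ε` is harmless. -/
theorem abs_mollifiedCoeff_le_card_divisors (N X n : ℕ) :
    |(mollifiedCoeff N X n : ℝ)| ≤ n.divisors.card := by
  refine (abs_mollifiedCoeff_le_card N X n).trans ?_
  norm_cast
  refine Finset.card_le_card_of_injOn (fun q => q.1) ?_ ?_
  · intro q hq
    simp only [Finset.coe_filter, Finset.mem_product, Finset.mem_Icc, Set.mem_ofPred_eq] at hq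
    simp only [Finset.mem_coe, Nat.mem_divisors]
    exact ⟨⟨q.2, hq.2.symm⟩, by rw [← hq.2]; exact (Nat.mul_pos hq.1.1.1 hq.1.2.1).ne'⟩
  · intro q hq q' hq' h
    simp only [Finset.coe_filter, Finset.mem_product, Finset.mem_Icc, Set.mem_ofPred_eq] at hq hq'
    refine Prod.ext h ?_
    have h1 := hq.2.trans hq'.2.symm
    rw [show q.1 = q'.1 from h] at h1
    exact Nat.eq_of_mul_eq_mul_left hq'.1.1.1 h1

/-- A factorisation of `n` is fixed by its second factor. This bound serves the off-diagonal terms,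
`X` being a small power of `T`. -/
theorem abs_mollifiedCoeff_le (N X n : ℕ) : |(mollifiedCoeff N X n : ℝ)| ≤ X := by
  refine (abs_mollifiedCoeff_le_card N X n).trans ?_
  norm_cast
  calc _ ≤ (Finset.Icc 1 X).card := by
        refine Finset.card_le_card_of_injOn (fun q => q.2) ?_ ?_
        · intro q hq
          simp only [Finset.coe_filter, Finset.mem_product, Set.mem_ofPred_eq] at hq
          exact hq.1.2
        · intro q hq q' hq' h
          simp only [Finset.coe_filter, Finset.mem_product, Finset.mem_Icc, Set.mem_ofPred_eq] at hq hq'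
          refine Prod.ext ?_ h
          have h1 := hq.2.trans hq'.2.symm
          rw [show q.2 = q'.2 from h] at h1
          exact Nat.eq_of_mul_eq_mul_right hq'.1.2.1 h1
    _ = X := by simp

/-- Neither truncation is felt for `n ≤ X`, so the coefficient is that of `1 * μ = δ`. -/
theorem mollifiedCoeff_of_le {N X n : ℕ} (hXN : X ≤ N) (hn : 1 ≤ n) (hnX : n ≤ X) :
    mollifiedCoeff N X n = if n = 1 then 1 else 0 := by
  have h1 : (Finset.Icc 1 N ×ˢ Finset.Icc 1 X).filter (fun q => q.1 * q.2 = n) =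
      n.divisorsAntidiagonal := by
    ext q
    simp only [Finset.mem_filter, Finset.mem_product, Finset.mem_Icc, Nat.mem_divisorsAntidiagonal]
    constructor
    · rintro ⟨-, h⟩
      exact ⟨h, by lia⟩
    · rintro ⟨h, -⟩
      have hq1 : 1 ≤ q.1 := Nat.pos_of_ne_zero (by rintro h0; rw [h0] at h; simp at h; lia)
      have hq2 : 1 ≤ q.2 := Nat.pos_of_ne_zero (by rintro h0; rw [h0] at h; simp at h; lia)
      have hq3 : q.1 ≤ n := Nat.le_of_dvd hn ⟨q.2, h.symm⟩
      have hq4 : q.2 ≤ n := Nat.le_of_dvd hn ⟨q.1, by rw [mul_comm]; exact h.symm⟩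
      exact ⟨⟨⟨hq1, by lia⟩, hq2, by lia⟩, h⟩
  rw [mollifiedCoeff, h1]
  have h2 := congrArg (fun f : ArithmeticFunction ℤ => f n) ArithmeticFunction.coe_zeta_mul_moebius
  simp only [ArithmeticFunction.mul_apply, ArithmeticFunction.one_apply] at h2
  rw [← h2]
  refine Finset.sum_congr rfl fun q hq => ?_
  have : q.1 ≠ 0 := by
    intro h0
    have := Nat.mem_divisorsAntidiagonal.mp hq
    rw [h0] at this
    simp at this
    lia
  simp [ArithmeticFunction.natCoe_apply, ArithmeticFunction.zeta_apply, this]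

/-- Only `n > X` contributes. With `η = 2α - 1`, the divisor bound at exponent `η/8` leaves
`n^(-1-3η/4)`, split as `n^(-η/2)`, at most `X^(-η/2)`, times the summable `n^(-1-η/4)`. -/
theorem exists_sum_mollifiedCoeff_sq_le {α : ℝ} (hα : 1 / 2 < α) :
    ∃ C : ℝ, 0 < C ∧ ∀ N X L : ℕ, 1 ≤ X → X ≤ N →
      ∑ n ∈ Finset.Icc 2 L, ((mollifiedCoeff N X n : ℝ)) ^ 2 * (n : ℝ) ^ (-(2 * α)) ≤
        C * (X : ℝ) ^ (-((2 * α - 1) / 2)) := by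
  set η := 2 * α - 1 with hη
  have hη0 : 0 < η := by linarith
  obtain ⟨C, hC, hd⟩ := exists_card_divisors_le (ε := η / 8) (by linarith)
  have hsum : Summable fun n : ℕ => (n : ℝ) ^ (-(1 + η / 4)) :=
    Real.summable_nat_rpow.mpr (by linarith)
  set S := ∑' n : ℕ, (n : ℝ) ^ (-(1 + η / 4)) with hS
  have hS0 : 0 ≤ S := tsum_nonneg fun n => by positivity
  refine ⟨C ^ 2 * (S + 1), by positivity, fun N X L hX hXN => ?_⟩
  have hX0 : (0 : ℝ) < X := by exact_mod_cast hX
  have hterm : ∀ n ∈ Finset.Icc 2 L, ((mollifiedCoeff N X n : ℝ)) ^ 2 * (n : ℝ) ^ (-(2 * α)) ≤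
      C ^ 2 * (X : ℝ) ^ (-(η / 2)) * (n : ℝ) ^ (-(1 + η / 4)) := by
    intro n hn
    have hn2 := (Finset.mem_Icc.mp hn).1
    have hn0 : (0 : ℝ) < n := by exact_mod_cast (by lia : 0 < n)
    rcases le_or_gt n X with h | h
    · rw [mollifiedCoeff_of_le hXN (by lia) h, if_neg (by lia)]
      simp only [Int.cast_zero, ne_eq, OfNat.ofNat_ne_zero, not_false_eq_true, zero_pow, zero_mul]
      positivity
    · have h1 : |(mollifiedCoeff N X n : ℝ)| ≤ C * (n : ℝ) ^ (η / 8) :=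
        (abs_mollifiedCoeff_le_card_divisors N X n).trans (hd n (by lia))
      have h2 : ((mollifiedCoeff N X n : ℝ)) ^ 2 ≤ C ^ 2 * (n : ℝ) ^ (η / 4) := by
        rw [← sq_abs]
        calc |(mollifiedCoeff N X n : ℝ)| ^ 2 ≤ (C * (n : ℝ) ^ (η / 8)) ^ 2 := by gcongr
          _ = _ := by
            rw [mul_pow, ← Real.rpow_natCast ((n : ℝ) ^ (η / 8)), ← Real.rpow_mul hn0.le]
            congr 2
            push_cast
            ring
      have h3 : (n : ℝ) ^ (-(η / 2)) ≤ (X : ℝ) ^ (-(η / 2)) :=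
        Real.rpow_le_rpow_of_nonpos hX0 (by exact_mod_cast h.le) (by linarith)
      calc _ ≤ C ^ 2 * (n : ℝ) ^ (η / 4) * (n : ℝ) ^ (-(2 * α)) := by gcongr
        _ = C ^ 2 * (n : ℝ) ^ (-(η / 2)) * (n : ℝ) ^ (-(1 + η / 4)) := by
          rw [mul_assoc, mul_assoc, ← Real.rpow_add hn0, ← Real.rpow_add hn0]
          congr 2
          rw [hη]
          ring
        _ ≤ _ := by gcongr
  calc _ ≤ ∑ n ∈ Finset.Icc 2 L, C ^ 2 * (X : ℝ) ^ (-(η / 2)) * (n : ℝ) ^ (-(1 + η / 4)) :=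
        Finset.sum_le_sum hterm
    _ = C ^ 2 * (X : ℝ) ^ (-(η / 2)) * ∑ n ∈ Finset.Icc 2 L, (n : ℝ) ^ (-(1 + η / 4)) := by
      rw [Finset.mul_sum]
    _ ≤ C ^ 2 * (X : ℝ) ^ (-(η / 2)) * (S + 1) := by
      gcongr
      have := hsum.sum_le_tsum (Finset.Icc 2 L) (fun n _ => by positivity)
      linarith
    _ = _ := by ring

theorem exists_integral_mollified_le {α : ℝ} (hα : 1 / 2 < α) (hα1 : α < 1) :
    ∃ C : ℝ, 0 < C ∧ ∀ (N X : ℕ) (T : ℝ) (w : ℂ), 1 ≤ X → X ≤ N → 0 ≤ T → α ≤ w.re →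
      ∫ t in T..2 * T, ‖∑ n ∈ Finset.Icc 2 (N * X),
        (mollifiedCoeff N X n : ℂ) * (n : ℂ) ^ (-(w + t * I))‖ ^ 2 ≤
      C * (T * (X : ℝ) ^ (-((2 * α - 1) / 2)) + (X : ℝ) ^ 2 *
        (((N * X : ℕ) : ℝ) ^ (2 - 2 * α) * (1 + Real.log (N * X : ℕ)))) := by
  obtain ⟨C₁, hC₁, hdiag⟩ := exists_sum_mollifiedCoeff_sq_le hα
  set C₂ := 2 / (1 - α) ^ 2 + 4 / (1 - α) with hC₂
  have ha : 0 < 1 - α := by linarith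
  have hC₂0 : 0 < C₂ := by positivity
  refine ⟨C₁ + C₂, by positivity, fun N X T w hX hXN hT hw => ?_⟩
  set L := N * X with hL
  have hL1 : 1 ≤ L := Nat.mul_pos (hX.trans hXN) hX
  set s := Finset.Icc 2 L with hs
  have hs0 : ∀ n ∈ s, n ≠ 0 := fun n hn => by have := (Finset.mem_Icc.mp hn).1; lia
  set a : ℕ → ℂ := fun n => (mollifiedCoeff N X n : ℂ) * (n : ℂ) ^ (-w) with ha'
  have hnorm : ∀ n ∈ s, ‖a n‖ ≤ |(mollifiedCoeff N X n : ℝ)| * (n : ℝ) ^ (-α) := by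
    intro n hn
    have hn1 : 1 ≤ n := Nat.pos_of_ne_zero (hs0 n hn)
    rw [ha', norm_mul, Complex.norm_natCast_cpow_of_pos hn1, Complex.norm_intCast, neg_re]
    gcongr
    exact_mod_cast hn1
  have hrew : ∀ t : ℝ, ∑ n ∈ s, (mollifiedCoeff N X n : ℂ) * (n : ℂ) ^ (-(w + t * I)) =
      ∑ n ∈ s, a n * (n : ℂ) ^ (-(t * I)) := by
    intro t
    refine Finset.sum_congr rfl fun n hn => ?_
    rw [ha', neg_add, Complex.cpow_add _ _ (by exact_mod_cast hs0 n hn), mul_assoc]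
  simp_rw [hrew]
  refine (integral_norm_sq_dirichlet_le s hs0 a T (2 * T)).trans ?_
  have e1 : ∑ n ∈ s, ‖a n‖ ^ 2 ≤ C₁ * (X : ℝ) ^ (-((2 * α - 1) / 2)) := by
    refine le_trans (Finset.sum_le_sum fun n hn => ?_) (hdiag N X L hX hXN)
    have hn0 : (0 : ℝ) ≤ n := by positivity
    calc ‖a n‖ ^ 2 ≤ (|(mollifiedCoeff N X n : ℝ)| * (n : ℝ) ^ (-α)) ^ 2 := by
          gcongr; exact hnorm n hn
      _ = _ := by
        rw [mul_pow, sq_abs, ← Real.rpow_natCast ((n : ℝ) ^ (-α)), ← Real.rpow_mul hn0]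
        congr 2
        push_cast
        ring
  have e2 : ∑ m ∈ s, ∑ n ∈ s.erase m, ‖a m‖ * ‖a n‖ * (2 / |Real.log n - Real.log m|) ≤
      (X : ℝ) ^ 2 * (C₂ * ((L : ℝ) ^ (2 - 2 * α) * (1 + Real.log L))) := by
    have hsub : s ⊆ Finset.Icc 1 L := Finset.Icc_subset_Icc_left (by norm_num)
    have hX' : ∀ n ∈ s, ‖a n‖ ≤ X * (n : ℝ) ^ (-α) := fun n hn =>
      (hnorm n hn).trans (by gcongr; exact abs_mollifiedCoeff_le N X n)
    calc _ ≤ ∑ m ∈ s, ∑ n ∈ s.erase m, (X * (m : ℝ) ^ (-α)) * (X * (n : ℝ) ^ (-α)) *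
          (2 / |Real.log n - Real.log m|) := by
          refine Finset.sum_le_sum fun m hm => Finset.sum_le_sum fun n hn => ?_
          gcongr
          · exact hX' m hm
          · exact hX' n (Finset.mem_erase.mp hn).2
      _ = (X : ℝ) ^ 2 * ∑ m ∈ s, ∑ n ∈ s.erase m,
          (m : ℝ) ^ (-α) * (n : ℝ) ^ (-α) * (2 / |Real.log n - Real.log m|) := by
        simp only [Finset.mul_sum]
        refine Finset.sum_congr rfl fun m _ => Finset.sum_congr rfl fun n _ => ?_
        ring
      _ ≤ (X : ℝ) ^ 2 * ∑ m ∈ Finset.Icc 1 L, ∑ n ∈ (Finset.Icc 1 L).erase m,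
          (m : ℝ) ^ (-α) * (n : ℝ) ^ (-α) * (2 / |Real.log n - Real.log m|) := by
        gcongr
        calc _ ≤ ∑ m ∈ s, ∑ n ∈ (Finset.Icc 1 L).erase m,
              (m : ℝ) ^ (-α) * (n : ℝ) ^ (-α) * (2 / |Real.log n - Real.log m|) := by
              refine Finset.sum_le_sum fun m _ => ?_
              exact Finset.sum_le_sum_of_subset_of_nonneg (Finset.erase_subset_erase _ hsub)
                fun _ _ _ => by positivity
          _ ≤ _ := Finset.sum_le_sum_of_subset_of_nonneg hsub
                fun _ _ _ => Finset.sum_nonneg fun _ _ => by positivity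
      _ ≤ _ := by
        gcongr
        exact sum_offDiag_le hα.le hα1 L hL1
  have hlog : 0 ≤ Real.log L := Real.log_natCast_nonneg L
  have p1 : 0 ≤ T * (X : ℝ) ^ (-((2 * α - 1) / 2)) := by positivity
  have p2 : 0 ≤ (X : ℝ) ^ 2 * ((L : ℝ) ^ (2 - 2 * α) * (1 + Real.log L)) := by positivity
  have e3 : (2 * T - T) * ∑ n ∈ s, ‖a n‖ ^ 2 ≤ T * (C₁ * (X : ℝ) ^ (-((2 * α - 1) / 2))) := by
    rw [show 2 * T - T = T by ring]
    gcongr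
  nlinarith [mul_nonneg hC₁.le p2, mul_nonneg hC₂0.le p1]

theorem exists_integral_zeta_mul_mollifier_sub_one_le {α : ℝ} (hα : 1 / 2 < α) (hα1 : α ≤ 3 / 4) :
    ∃ δ c C T₀ : ℝ, 0 < c ∧ 0 < C ∧ 6 ≤ T₀ ∧ ∀ T : ℝ, T₀ ≤ T → ∀ w : ℂ, α ≤ w.re →
      w.re ≤ 6 → |w.im| ≤ 3 →
      ∫ t in T..2 * T, ‖riemannZeta (w + t * I) * (∑ m ∈ Finset.Icc 1 ⌊T ^ δ⌋₊,
        (ArithmeticFunction.moebius m : ℂ) * (m : ℂ) ^ (-(w + t * I))) - 1‖ ^ 2 ≤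
      C * T ^ (1 - c) := by
  set η := 2 * α - 1 with hη
  have hη0 : 0 < η := by linarith
  have hη1 : η ≤ 1 / 2 := by linarith
  obtain ⟨C₁, hC₁, hpoly⟩ := exists_integral_mollified_le hα (by linarith)
  obtain ⟨C₂, T₀, hC₂, hT₀, happrox⟩ := exists_norm_zeta_sub_sum_le (ε := η / 4) (by linarith)
    (by linarith)
  -- The mollifier has length `X ≈ T^(η/12)`, and the diagonal saving `X^(-η/2)` is `T^(-η²/24)`.
  -- The off-diagonal terms and the error of the approximation to `ζ` save at least as much.
  refine ⟨η / 12, η ^ 2 / 24, 2 * (C₁ * (2 + 2 * (1 + 8 / η))) + 2 * C₂ ^ 2, max T₀ 6,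
    by positivity, by positivity, le_max_right _ _, ?_⟩
  intro T hT w hw hw6 hwi
  simp only [max_le_iff] at hT
  obtain ⟨hTT₀, hT6⟩ := hT
  have hT0 : 0 < T := by linarith
  have hT1 : 1 ≤ T := by linarith
  set N := ⌈T ^ (1 + η / 4)⌉₊ with hN
  set X := ⌊T ^ (η / 12)⌋₊ with hX
  have hTδ : 1 ≤ T ^ (η / 12) := Real.one_le_rpow hT1 (by positivity)
  have hX1 : 1 ≤ X := by rw [hX, Nat.one_le_floor_iff]; exact hTδ
  have hXu : (X : ℝ) ≤ T ^ (η / 12) := Nat.floor_le (by positivity)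
  have hX1' : (1 : ℝ) ≤ X := by exact_mod_cast hX1
  have hXl : T ^ (η / 12) / 2 ≤ X := by
    have := Nat.lt_floor_add_one (T ^ (η / 12))
    linarith
  have hNl : T ^ (1 + η / 4) ≤ N := Nat.le_ceil _
  have hNu : (N : ℝ) ≤ 2 * T ^ (1 + η / 4) := by
    have := (Nat.ceil_lt_add_one (show 0 ≤ T ^ (1 + η / 4) by positivity)).le
    have h1 : 1 ≤ T ^ (1 + η / 4) := Real.one_le_rpow hT1 (by linarith)
    linarith
  have hXN : X ≤ N := by
    have h1 : T ^ (η / 12) ≤ T ^ (1 + η / 4) := Real.rpow_le_rpow_of_exponent_le hT1 (by linarith)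
    have : (X : ℝ) ≤ N := by linarith
    exact_mod_cast this
  set P : ℝ → ℂ := fun t => ∑ n ∈ Finset.Icc 2 (N * X),
        (mollifiedCoeff N X n : ℂ) * (n : ℂ) ^ (-(w + t * I)) with hP
  set M : ℝ → ℂ := fun t => ∑ m ∈ Finset.Icc 1 X,
        (ArithmeticFunction.moebius m : ℂ) * (m : ℂ) ^ (-(w + t * I)) with hM
  have hre : ∀ t : ℝ, (w + t * I).re = w.re := by intro t; simp
  have him : ∀ t : ℝ, (w + t * I).im = w.im + t := by intro t; simp
  have hAM : ∀ t : ℝ, (∑ n ∈ Finset.Icc 1 N, (n : ℂ) ^ (-(w + t * I))) * M t = 1 + P t := by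
    intro t
    rw [hM, sum_mul_sum_moebius, ← Finset.add_sum_Ioc_eq_sum_Icc (Nat.mul_pos (hX1.trans hXN) hX1),
      mollifiedCoeff_of_le hXN le_rfl hX1]
    simp [hP]
    rfl
  have hMn : ∀ t, ‖M t‖ ≤ T ^ (η / 12) := by
    intro t
    refine le_trans ?_ hXu
    rw [hM]
    refine (norm_sum_le _ _).trans ?_
    calc _ ≤ ∑ m ∈ Finset.Icc 1 X, (1 : ℝ) := by
          refine Finset.sum_le_sum fun m hm => ?_
          have hm1 := (Finset.mem_Icc.mp hm).1
          rw [norm_mul, Complex.norm_natCast_cpow_of_pos hm1, neg_re, hre, Complex.norm_intCast]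
          have h1 : |((ArithmeticFunction.moebius m : ℤ) : ℝ)| ≤ 1 := by
            exact_mod_cast ArithmeticFunction.abs_moebius_le_one
          have h2 : (m : ℝ) ^ (-w.re) ≤ 1 :=
            Real.rpow_le_one_of_one_le_of_nonpos (by exact_mod_cast hm1) (by linarith)
          exact mul_le_one₀ h1 (by positivity) h2
      _ = X := by simp
  have hpt : ∀ t ∈ Set.Icc T (2 * T), ‖riemannZeta (w + t * I) * M t - 1‖ ^ 2 ≤
      2 * ‖P t‖ ^ 2 + 2 * C₂ ^ 2 * T ^ (-(η ^ 2 / 24)) := by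
    intro t ht
    have him3 := abs_le.mp hwi
    have h1 := happrox T hTT₀ (w + t * I) (by rw [hre]; linarith) (by rw [hre]; exact hw6)
      (by rw [him]; linarith [ht.1]) (by rw [him]; linarith [ht.2])
    set A := ∑ n ∈ Finset.Icc 1 N, (n : ℂ) ^ (-(w + t * I)) with hA
    have h2 : riemannZeta (w + t * I) * M t - 1 = P t + (riemannZeta (w + t * I) - A) * M t := by
      have := hAM t
      linear_combination this
    rw [h2]
    have h3 : ‖(riemannZeta (w + t * I) - A) * M t‖ ≤ C₂ * T ^ (-(1 / 4) + η / 12 : ℝ) := by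
      rw [norm_mul, Real.rpow_add hT0, ← mul_assoc]
      exact mul_le_mul h1 (hMn t) (norm_nonneg _) (by positivity)
    have h4 : ‖(riemannZeta (w + t * I) - A) * M t‖ ^ 2 ≤ C₂ ^ 2 * T ^ (-(η ^ 2 / 24)) := by
      calc _ ≤ (C₂ * T ^ (-(1 / 4) + η / 12 : ℝ)) ^ 2 := by gcongr
        _ = C₂ ^ 2 * T ^ ((-(1 / 4) + η / 12) * 2 : ℝ) := by
          rw [mul_pow, ← Real.rpow_natCast (T ^ (-(1 / 4) + η / 12 : ℝ)), ← Real.rpow_mul hT0.le]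
          norm_num
        _ ≤ _ := by
          gcongr
          nlinarith
    have h5 := norm_add_le (P t) ((riemannZeta (w + t * I) - A) * M t)
    have h6 : ‖P t + (riemannZeta (w + t * I) - A) * M t‖ ^ 2 ≤
        (‖P t‖ + ‖(riemannZeta (w + t * I) - A) * M t‖) ^ 2 := by gcongr
    nlinarith [sq_nonneg (‖P t‖ - ‖(riemannZeta (w + t * I) - A) * M t‖)]
  have hcpow : ∀ n : ℕ, n ≠ 0 → Continuous fun t : ℝ => (n : ℂ) ^ (-(w + t * I)) := by
    intro n hn
    exact Continuous.const_cpow (by fun_prop) (Or.inl (by exact_mod_cast hn))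
  have hPc : Continuous P := by
    refine continuous_finsetSum _ fun n hn => continuous_const.mul (hcpow n ?_)
    have := (Finset.mem_Icc.mp hn).1
    lia
  have hMc : Continuous M := by
    refine continuous_finsetSum _ fun n hn => continuous_const.mul (hcpow n ?_)
    have := (Finset.mem_Icc.mp hn).1
    lia
  have hTle : T ≤ 2 * T := by linarith
  have hZc : ContinuousOn (fun t : ℝ => ‖riemannZeta (w + t * I) * M t - 1‖ ^ 2)
      (Set.uIcc T (2 * T)) := by
    rw [Set.uIcc_of_le hTle]
    refine (((ContinuousOn.mul ?_ hMc.continuousOn).sub continuousOn_const).norm).pow 2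
    intro t ht
    have hne : w + t * I ≠ 1 := by
      intro h
      have h1 := congrArg Complex.im h
      rw [him, one_im] at h1
      linarith [(abs_le.mp hwi).1, ht.1]
    have h2 : ContinuousAt (fun t : ℝ => w + t * I) t := by fun_prop
    exact (ContinuousAt.comp (f := fun t : ℝ => w + t * I)
      (differentiableAt_riemannZeta hne).continuousAt h2).continuousWithinAt
  have hPint : IntervalIntegrable (fun t => 2 * ‖P t‖ ^ 2) volume T (2 * T) :=
    ((hPc.norm.pow 2).const_mul 2 |>.intervalIntegrable _ _)
  have hmain := intervalIntegral.integral_mono_on hTle hZc.intervalIntegrable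
    (hPint.add intervalIntegrable_const) hpt
  refine hmain.trans ?_
  rw [intervalIntegral.integral_add hPint intervalIntegrable_const,
    intervalIntegral.integral_const_mul, intervalIntegral.integral_const, smul_eq_mul]
  have hTc : T ^ (1 - η ^ 2 / 24) = T * T ^ (-(η ^ 2 / 24)) := by
    rw [sub_eq_add_neg, Real.rpow_add hT0, Real.rpow_one]
  have b1 : T * (X : ℝ) ^ (-(η / 2)) ≤ 2 * T ^ (1 - η ^ 2 / 24) := by
    have h1 : (X : ℝ) ^ (-(η / 2)) ≤ (T ^ (η / 12) / 2) ^ (-(η / 2)) :=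
      Real.rpow_le_rpow_of_nonpos (by positivity) hXl (by linarith)
    have h2 : (T ^ (η / 12) / 2) ^ (-(η / 2)) = T ^ (-(η ^ 2 / 24)) * 2 ^ (η / 2) := by
      rw [Real.div_rpow (by positivity) (by norm_num), ← Real.rpow_mul hT0.le,
        Real.rpow_neg (by norm_num : (0 : ℝ) ≤ 2), div_inv_eq_mul]
      congr 2
      ring
    have h3 : (2 : ℝ) ^ (η / 2) ≤ 2 := by
      calc (2 : ℝ) ^ (η / 2) ≤ 2 ^ (1 : ℝ) :=
            Real.rpow_le_rpow_of_exponent_le (by norm_num) (by linarith)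
        _ = 2 := Real.rpow_one 2
    rw [hTc]
    calc T * (X : ℝ) ^ (-(η / 2)) ≤ T * (T ^ (-(η ^ 2 / 24)) * 2) := by
          gcongr
          rw [h2] at h1
          exact h1.trans (by gcongr)
      _ = _ := by ring
  have hL1 : (1 : ℝ) ≤ (N * X : ℕ) := by exact_mod_cast Nat.mul_pos (hX1.trans hXN) hX1
  have b2 : (X : ℝ) ^ 2 * (((N * X : ℕ) : ℝ) ^ (2 - 2 * α) * (1 + Real.log (N * X : ℕ))) ≤
      2 * (1 + 8 / η) * T ^ (1 - η ^ 2 / 24) := by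
    have hLu : ((N * X : ℕ) : ℝ) ≤ 2 * T ^ (1 + η / 3) := by
      push_cast
      calc (N : ℝ) * X ≤ 2 * T ^ (1 + η / 4) * T ^ (η / 12) := by gcongr
        _ = _ := by
          rw [mul_assoc, ← Real.rpow_add hT0]
          ring_nf
    set L : ℝ := ((N * X : ℕ) : ℝ) with hL
    have hL0 : 0 < L := by linarith
    have hlog : 1 + Real.log L ≤ (1 + 8 / η) * L ^ (η / 8) := by
      have h1 := Real.log_le_rpow_div hL0.le (show 0 < η / 8 by positivity)
      have h2 : 1 ≤ L ^ (η / 8) := Real.one_le_rpow hL1 (by positivity)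
      calc 1 + Real.log L ≤ L ^ (η / 8) + L ^ (η / 8) / (η / 8) := by linarith
        _ = _ := by field_simp
    have hexp : 2 - 2 * α + η / 8 = 1 - 7 * η / 8 := by rw [hη]; ring
    calc (X : ℝ) ^ 2 * (L ^ (2 - 2 * α) * (1 + Real.log L))
        ≤ (T ^ (η / 12)) ^ 2 * (L ^ (2 - 2 * α) * ((1 + 8 / η) * L ^ (η / 8))) := by gcongr
      _ = (1 + 8 / η) * ((T ^ (η / 12)) ^ 2 * L ^ (1 - 7 * η / 8)) := by
        rw [← hexp, Real.rpow_add hL0]; ring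
      _ ≤ (1 + 8 / η) * (T ^ (η / 6) * (2 * T ^ ((1 + η / 3) * (1 - 7 * η / 8)))) := by
        gcongr
        · rw [← Real.rpow_natCast, ← Real.rpow_mul hT0.le]
          apply le_of_eq
          congr 1
          push_cast
          ring
        · calc L ^ (1 - 7 * η / 8) ≤ (2 * T ^ (1 + η / 3)) ^ (1 - 7 * η / 8) := by
                gcongr
                linarith
            _ = 2 ^ (1 - 7 * η / 8) * T ^ ((1 + η / 3) * (1 - 7 * η / 8)) := by
              rw [Real.mul_rpow (by norm_num) (by positivity), ← Real.rpow_mul hT0.le]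
            _ ≤ _ := by
              gcongr
              calc (2 : ℝ) ^ (1 - 7 * η / 8) ≤ 2 ^ (1 : ℝ) :=
                    Real.rpow_le_rpow_of_exponent_le (by norm_num) (by linarith)
                _ = 2 := Real.rpow_one 2
      _ = 2 * (1 + 8 / η) * T ^ (η / 6 + (1 + η / 3) * (1 - 7 * η / 8)) := by
        rw [Real.rpow_add hT0]; ring
      -- The exponent equals `1 - 3η/8 - 7η²/24`.
      _ ≤ _ := by
        gcongr
        nlinarith
  have h7 := hpoly N X T w hX1 hXN hT0.le hw
  have h8 : ∫ t in T..2 * T, ‖P t‖ ^ 2 ≤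
      C₁ * (2 * T ^ (1 - η ^ 2 / 24) + 2 * (1 + 8 / η) * T ^ (1 - η ^ 2 / 24)) := by
    refine h7.trans ?_
    gcongr
  calc _ ≤ 2 * (C₁ * (2 * T ^ (1 - η ^ 2 / 24) + 2 * (1 + 8 / η) * T ^ (1 - η ^ 2 / 24))) +
        (2 * T - T) * (2 * C₂ ^ 2 * T ^ (-(η ^ 2 / 24))) := by gcongr
    _ = _ := by rw [hTc]; ring

theorem measureReal_Icc_inter_mono {a b : ℝ} {p q : ℝ → Prop} (h : ∀ t ∈ Set.Icc a b, p t → q t) :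
    volume.real {t ∈ Set.Icc a b | p t} ≤ volume.real {t ∈ Set.Icc a b | q t} := by
  refine measureReal_mono (fun t ht => ⟨ht.1, h t ht.1 ht.2⟩) ?_
  refine ne_top_of_le_ne_top ?_ (measure_mono (Set.sep_subset _ _))
  simp

/-- At a zero of `ζ` the function `ζM - 1` equals `-1`, so its modulus reaches `1` on the disc,
which its mean square makes rare. -/
theorem exists_measure_zeta_zero_le {ρ : ℝ} (hρ : 2 ≤ ρ) (hρ' : ρ < 5 / 2) :
    ∃ c C T₀ : ℝ, 0 < c ∧ 0 < C ∧ ∀ T : ℝ, T₀ ≤ T →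
      volume.real {t ∈ Set.Icc T (2 * T) |
        ∃ z ∈ Metric.closedBall ((3 : ℂ) + t * I) ρ, riemannZeta z = 0} ≤ C * T ^ (1 - c) := by
  -- A radius strictly between `ρ` and `5/2`: the circle about `3 + it` stays in `Re ≥ 3 - ρ' >
  -- 1/2`, and `ρ ≥ 2` gives `3 - ρ' ≤ 3/4`.
  set ρ' := (ρ + 5 / 2) / 2 with hρ'def
  have h1 : ρ < ρ' := by rw [hρ'def]; linarith
  have h2 : ρ' < 5 / 2 := by rw [hρ'def]; linarith
  have h3 : 9 / 4 ≤ ρ' := by rw [hρ'def]; linarith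
  obtain ⟨δ, c, C, T₀, hc, hC, hT₀, hint⟩ := exists_integral_zeta_mul_mollifier_sub_one_le
    (α := 3 - ρ') (by linarith) (by linarith)
  refine ⟨c, ρ' / (ρ' - ρ) * C, T₀, hc, mul_pos (div_pos (by linarith) (by linarith)) hC, ?_⟩
  intro T hT
  have hT6 : 6 ≤ T := hT₀.trans hT
  set M : ℂ → ℂ := fun z => ∑ m ∈ Finset.Icc 1 ⌊T ^ δ⌋₊,
    (ArithmeticFunction.moebius m : ℂ) * (m : ℂ) ^ (-z) with hM
  have hMd : Differentiable ℂ M := by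
    intro z
    refine DifferentiableAt.fun_sum fun m hm => ?_
    have hm1 := (Finset.mem_Icc.mp hm).1
    exact (DifferentiableAt.const_cpow (by fun_prop)
      (Or.inl (by exact_mod_cast Nat.pos_iff_ne_zero.mp hm1))).const_mul _
  have hmem : ∀ t ∈ Set.Icc T (2 * T), ∀ w ∈ Metric.closedBall ((3 : ℂ) + t * I) ρ', w ≠ 1 := by
    rintro t ht w hw rfl
    have h4 := (Complex.abs_im_le_norm _).trans (mem_closedBall_iff_norm.mp hw)
    simp at h4
    linarith [neg_le_abs t, le_abs_self t, ht.1]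
  have key := measure_large_values_le (F := fun z => riemannZeta z * M z - 1) (c := 3)
    (ρ := ρ) (ρ' := ρ') (T₁ := T) (T₂ := 2 * T) (B := C * T ^ (1 - c)) (lam := 1)
    (by linarith) h1 (by linarith) one_pos
    (fun t ht w hw => ((differentiableAt_riemannZeta (hmem t ht w hw)).mul (hMd w)).sub_const 1)
    (by
      intro θ
      set w : ℂ := circleMap 3 ρ' θ with hw
      have h5 : ‖w - 3‖ = ρ' := by
        rw [hw, circleMap_sub_center, norm_circleMap_zero, abs_of_pos (by linarith)]
      have h6 := (Complex.abs_re_le_norm (w - 3)).trans h5.le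
      have h7 := (Complex.abs_im_le_norm (w - 3)).trans h5.le
      simp only [sub_re, sub_im, re_ofNat, im_ofNat, sub_zero] at h6 h7
      rw [abs_le] at h6
      have h8 := hint T hT w (by linarith [h6.1]) (by linarith [h6.2]) (by linarith)
      have h9 : ∀ t : ℝ, circleMap (3 + t * I) ρ' θ = w + t * I := by
        intro t
        rw [hw, circleMap, circleMap]
        ring
      simp_rw [h9]
      exact h8)
  rw [div_one, ← mul_assoc] at key
  refine le_trans ?_ key
  refine measureReal_Icc_inter_mono fun t _ => ?_
  rintro ⟨z, hz, h0⟩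
  exact ⟨z, hz, by simp [h0]⟩

/-! ### High moments of Dirichlet polynomials over primes. -/

/-- By unique factorisation all such tuples are rearrangements of one list. This is the source of
the `k!` in the moments. -/
theorem card_prod_eq_le {k n : ℕ} (F : Finset (Fin k → ℕ))
    (hF : ∀ g ∈ F, (∀ i, (g i).Prime) ∧ ∏ i, g i = n) : F.card ≤ k.factorial := by
  rcases F.eq_empty_or_nonempty with rfl | ⟨g₀, hg₀⟩
  · simp
  have hperm : ∀ g ∈ F, (List.ofFn g).Perm n.primeFactorsList := by
    intro g hg
    refine Nat.primeFactorsList_unique ?_ ?_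
    · rw [List.prod_ofFn]
      exact (hF g hg).2
    · intro p hp
      obtain ⟨i, rfl⟩ := List.mem_ofFn.mp hp
      exact (hF g hg).1 i
  have hlen : n.primeFactorsList.length = k := by
    rw [← (hperm g₀ hg₀).length_eq, List.length_ofFn]
  calc F.card ≤ n.primeFactorsList.permutations.toFinset.card := by
        refine Finset.card_le_card_of_injOn List.ofFn ?_ (fun _ _ _ _ h => List.ofFn_injective h)
        intro g hg
        simpa [List.mem_permutations] using hperm g hg
    _ ≤ n.primeFactorsList.permutations.length := List.toFinset_card_le _
    _ = k.factorial := by rw [List.length_permutations, hlen]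

/-- Distinct integers up to `N` satisfy `|log (n/m)| ≥ 1/N`; Cauchy–Schwarz turns the off-diagonal
part into `2N²` times the diagonal sum. This is lossless up to a constant when `N² ≤ T`. -/
theorem integral_norm_sq_dirichlet_le_of_subset_Icc {s : Finset ℕ} {N : ℕ}
    (hs : s ⊆ Finset.Icc 1 N) (a : ℕ → ℂ) (T₁ T₂ : ℝ) :
    ∫ t in T₁..T₂, ‖∑ n ∈ s, a n * (n : ℂ) ^ (-(t * I))‖ ^ 2 ≤
      (T₂ - T₁ + 2 * (N : ℝ) ^ 2) * ∑ n ∈ s, ‖a n‖ ^ 2 := by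
  have h1 : ∀ n ∈ s, 1 ≤ n ∧ n ≤ N := fun n hn => Finset.mem_Icc.mp (hs hn)
  refine (integral_norm_sq_dirichlet_le s (fun n hn => by have := (h1 n hn).1; lia) a T₁ T₂).trans ?_
  rw [add_mul]
  gcongr
  have hlog : ∀ m ∈ s, ∀ n ∈ s, m ≠ n → 2 / |Real.log n - Real.log m| ≤ 2 * N := by
    intro m hm n hn hmn
    wlog h : m < n generalizing m n
    · rw [abs_sub_comm]
      exact this n hn m hm hmn.symm (lt_of_le_of_ne (not_lt.mp h) hmn.symm)
    have h2 := inv_abs_log_sub_le (h1 m hm).1 h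
    have h3 : (1 : ℝ) ≤ (n : ℝ) - m := by
      have : (m : ℝ) + 1 ≤ n := by exact_mod_cast h
      linarith
    have h4 : (m : ℝ) / ((n : ℝ) - m) ≤ m := div_le_self (by positivity) h3
    have h5 : (n : ℝ) ≤ N := by exact_mod_cast (h1 n hn).2
    calc 2 / |Real.log n - Real.log m| = 2 * (1 / |Real.log n - Real.log m|) := by ring
      _ ≤ 2 * N := by linarith
  calc ∑ m ∈ s, ∑ n ∈ s.erase m, ‖a m‖ * ‖a n‖ * (2 / |Real.log n - Real.log m|)
      ≤ ∑ m ∈ s, ∑ n ∈ s.erase m, ‖a m‖ * ‖a n‖ * (2 * N) := by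
        refine Finset.sum_le_sum fun m hm => Finset.sum_le_sum fun n hn => ?_
        gcongr
        exact hlog m hm n (Finset.mem_erase.mp hn).2 (Finset.mem_erase.mp hn).1.symm
    _ ≤ ∑ m ∈ s, ∑ n ∈ s, ‖a m‖ * ‖a n‖ * (2 * N) := by
      refine Finset.sum_le_sum fun m _ => ?_
      exact Finset.sum_le_sum_of_subset_of_nonneg (Finset.erase_subset _ _)
        fun _ _ _ => by positivity
    _ = 2 * N * (∑ n ∈ s, ‖a n‖) ^ 2 := by
      rw [sq, Finset.sum_mul_sum, Finset.mul_sum]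
      refine Finset.sum_congr rfl fun m _ => ?_
      rw [Finset.mul_sum]
      refine Finset.sum_congr rfl fun n _ => ?_
      ring
    _ ≤ 2 * N * (s.card * ∑ n ∈ s, ‖a n‖ ^ 2) := by
      gcongr
      exact sq_sum_le_card_mul_sum_sq
    _ ≤ 2 * N * (N * ∑ n ∈ s, ‖a n‖ ^ 2) := by
      gcongr
      simpa using Finset.card_le_card hs
    _ = _ := by ring

/-- High moments of a Dirichlet polynomial supported on primes. -/
theorem integral_prime_sum_pow_le {P : Finset ℕ} {Y : ℕ} (hP : ∀ p ∈ P, p.Prime)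
    (hPY : ∀ p ∈ P, p ≤ Y) (x : ℕ → ℂ) (k : ℕ) {T₁ T₂ : ℝ} (hT : T₁ ≤ T₂) :
    ∫ t in T₁..T₂, ‖(∑ p ∈ P, x p * (p : ℂ) ^ (-(t * I))) ^ k‖ ^ 2 ≤
      (T₂ - T₁ + 2 * ((Y : ℝ) ^ k) ^ 2) * (k.factorial * (∑ p ∈ P, ‖x p‖ ^ 2) ^ k) := by
  set G := Fintype.piFinset fun _ : Fin k => P with hG
  set π : (Fin k → ℕ) → ℕ := fun g => ∏ i, g i with hπ
  set b : ℕ → ℂ := fun n => ∑ g ∈ G with π g = n, ∏ i, x (g i) with hb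
  set s := G.image π with hs
  have hGP : ∀ g ∈ G, ∀ i, g i ∈ P := fun g hg i => Fintype.mem_piFinset.mp hg i
  have hsN : s ⊆ Finset.Icc 1 (Y ^ k) := by
    intro n hn
    obtain ⟨g, hg, rfl⟩ := Finset.mem_image.mp hn
    rw [Finset.mem_Icc]
    refine ⟨Finset.prod_pos fun i _ => (hP _ (hGP g hg i)).pos, ?_⟩
    calc ∏ i, g i ≤ ∏ _i : Fin k, Y := Finset.prod_le_prod' fun i _ => hPY _ (hGP g hg i)
      _ = Y ^ k := by simp
  have hexp : ∀ t : ℝ, (∑ p ∈ P, x p * (p : ℂ) ^ (-(t * I))) ^ k =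
      ∑ n ∈ s, b n * (n : ℂ) ^ (-(t * I)) := by
    intro t
    have h1 := Finset.prod_univ_sum (fun _ : Fin k => P)
      (fun _ (p : ℕ) => x p * (p : ℂ) ^ (-(t * I)))
    rw [Finset.prod_const, Finset.card_univ, Fintype.card_fin] at h1
    rw [h1, ← Finset.sum_fiberwise_of_maps_to (g := π) (t := s)
      (fun g hg => Finset.mem_image_of_mem π hg)]
    refine Finset.sum_congr rfl fun n _ => ?_
    rw [hb, Finset.sum_mul]
    refine Finset.sum_congr rfl fun g hg => ?_
    rw [Finset.prod_mul_distrib, ← (Finset.mem_filter.mp hg).2]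
    congr 1
    have h2 : ∀ u : Finset (Fin k), ∏ i ∈ u, ((g i : ℕ) : ℂ) ^ (-(t * I)) =
        ((∏ i ∈ u, g i : ℕ) : ℂ) ^ (-(t * I)) := by
      intro u
      induction u using Finset.cons_induction with
      | empty => simp
      | cons i u hi ih =>
        rw [Finset.prod_cons, Finset.prod_cons, ih, Nat.cast_mul, Complex.natCast_mul_natCast_cpow]
    exact h2 Finset.univ
  simp_rw [hexp]
  have hT' : 0 ≤ T₂ - T₁ := by linarith
  refine (integral_norm_sq_dirichlet_le_of_subset_Icc hsN b T₁ T₂).trans ?_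
  push_cast
  gcongr
  -- Cauchy–Schwarz over the at most `k!` tuples with product `n`.
  have hfib : ∀ n ∈ s, ‖b n‖ ^ 2 ≤ k.factorial * ∑ g ∈ G with π g = n, ∏ i, ‖x (g i)‖ ^ 2 := by
    intro n _
    have hcard : (G.filter fun g => π g = n).card ≤ k.factorial := by
      apply card_prod_eq_le (n := n)
      intro g hg
      have := Finset.mem_filter.mp hg
      exact ⟨fun i => hP _ (hGP g this.1 i), this.2⟩
    calc ‖b n‖ ^ 2 ≤ (∑ g ∈ G with π g = n, ‖∏ i, x (g i)‖) ^ 2 := by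
          gcongr
          exact norm_sum_le _ _
      _ ≤ (G.filter fun g => π g = n).card * ∑ g ∈ G with π g = n, ‖∏ i, x (g i)‖ ^ 2 :=
        sq_sum_le_card_mul_sum_sq
      _ ≤ k.factorial * ∑ g ∈ G with π g = n, ‖∏ i, x (g i)‖ ^ 2 := by
        gcongr
      _ = _ := by
        congr 1
        refine Finset.sum_congr rfl fun g _ => ?_
        rw [norm_prod, Finset.prod_pow]
  calc ∑ n ∈ s, ‖b n‖ ^ 2 ≤ ∑ n ∈ s, k.factorial * ∑ g ∈ G with π g = n, ∏ i, ‖x (g i)‖ ^ 2 :=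
        Finset.sum_le_sum hfib
    _ = k.factorial * ∑ g ∈ G, ∏ i, ‖x (g i)‖ ^ 2 := by
      rw [← Finset.mul_sum, Finset.sum_fiberwise_of_maps_to (fun g hg => Finset.mem_image_of_mem π hg)]
    _ = k.factorial * (∑ p ∈ P, ‖x p‖ ^ 2) ^ k := by
      have h1 := Finset.prod_univ_sum (fun _ : Fin k => P) (fun _ (p : ℕ) => ‖x p‖ ^ 2)
      rw [Finset.prod_const, Finset.card_univ, Fintype.card_fin] at h1
      rw [h1]

/-! ### Chebyshev bounds for sums of prime powers. -/

/-- Chebyshev's `θ(2x) ≤ 2x log 4 ≤ 3x` bounds the number of primes involved by `3x/ℓ`. -/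
theorem sum_prime_rpow_neg_dyadic_le {P : Finset ℕ} (hP : ∀ p ∈ P, p.Prime) {x ℓ a : ℝ}
    (hx : 0 < x) (hℓ : 0 < ℓ) (ha : 0 ≤ a) (hPx : ∀ p ∈ P, x ≤ p ∧ (p : ℝ) ≤ 2 * x)
    (hPℓ : ∀ p ∈ P, ℓ ≤ Real.log p) :
    ∑ p ∈ P, (p : ℝ) ^ (-a) ≤ 3 * x ^ (1 - a) / ℓ := by
  have hcard : P.card * ℓ ≤ 3 * x := by
    calc (P.card : ℝ) * ℓ = ∑ p ∈ P, ℓ := by simp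
      _ ≤ ∑ p ∈ P, Real.log p := Finset.sum_le_sum hPℓ
      _ ≤ Chebyshev.theta (2 * x) := by
        rw [Chebyshev.theta]
        refine Finset.sum_le_sum_of_subset_of_nonneg ?_ fun p _ _ => Real.log_natCast_nonneg p
        intro p hp
        simp only [Finset.mem_filter, Finset.mem_Ioc]
        exact ⟨⟨(hP p hp).pos, Nat.le_floor (hPx p hp).2⟩, hP p hp⟩
      _ ≤ Real.log 4 * (2 * x) := Chebyshev.theta_le_log4_mul_x (by linarith)
      _ ≤ 3 * x := by
        have : Real.log 4 = 2 * Real.log 2 := by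
          rw [show (4 : ℝ) = 2 ^ 2 by norm_num, Real.log_pow]; norm_num
        nlinarith [Real.log_two_lt_d9]
  rw [le_div_iff₀ hℓ]
  calc (∑ p ∈ P, (p : ℝ) ^ (-a)) * ℓ ≤ (∑ p ∈ P, x ^ (-a)) * ℓ := by
        refine mul_le_mul_of_nonneg_right (Finset.sum_le_sum fun p hp => ?_) hℓ.le
        exact Real.rpow_le_rpow_of_nonpos hx (hPx p hp).1 (neg_nonpos.mpr ha)
    _ = x ^ (-a) * (P.card * ℓ) := by rw [Finset.sum_const, nsmul_eq_mul]; ring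
    _ ≤ x ^ (-a) * (3 * x) := by gcongr
    _ = _ := by
      rw [show 1 - a = -a + 1 by ring, Real.rpow_add hx, Real.rpow_one]; ring

theorem finset_sum_geometric_le {q : ℝ} (hq0 : 0 ≤ q) (hq1 : q < 1) (t : Finset ℕ) :
    ∑ j ∈ t, q ^ j ≤ (1 - q)⁻¹ := by
  rw [← tsum_geometric_of_lt_one hq0 hq1]
  exact (summable_geometric_of_lt_one hq0 hq1).sum_le_tsum t fun j _ => by positivity

/-- Dyadic blocks above `y` form a geometric series of ratio at most `2^(1-a₀)`, so the constant is
uniform in `a ≥ a₀`; later the exponent varies with `k`. -/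
theorem exists_sum_prime_gt_le {a₀ : ℝ} (ha₀ : 1 < a₀) :
    ∃ C : ℝ, 0 < C ∧ ∀ (P : Finset ℕ) (y a : ℝ), 1 < y → a₀ ≤ a → (∀ p ∈ P, p.Prime) →
      (∀ p ∈ P, y ≤ p) → ∑ p ∈ P, (p : ℝ) ^ (-a) ≤ C * y ^ (1 - a) / Real.log y := by
  set q : ℝ := 2 ^ (1 - a₀) with hq
  have hq0 : 0 ≤ q := by positivity
  have hq1 : q < 1 := Real.rpow_lt_one_of_one_lt_of_neg (by norm_num) (by linarith)
  have hq2 : 0 < (1 - q)⁻¹ := inv_pos.mpr (by linarith)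
  refine ⟨3 * (1 - q)⁻¹, by positivity, fun P y a hy ha hP hPy => ?_⟩
  have hy0 : 0 < y := by linarith
  have hly : 0 < Real.log y := Real.log_pos hy
  set g : ℕ → ℕ := fun p => Nat.log 2 ⌊(p : ℝ) / y⌋₊ with hg
  rw [← Finset.sum_fiberwise_of_maps_to (g := g) (t := P.image g)
    (fun p hp => Finset.mem_image_of_mem g hp)]
  have hfib : ∀ j ∈ P.image g, ∑ p ∈ P with g p = j, (p : ℝ) ^ (-a) ≤
      3 * y ^ (1 - a) / Real.log y * q ^ j := by
    intro j _
    have hmem : ∀ p ∈ P.filter (fun p => g p = j), (2 : ℝ) ^ j * y ≤ p ∧ (p : ℝ) ≤ 2 * (2 ^ j * y) := by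
      intro p hp
      obtain ⟨hpP, hpj⟩ := Finset.mem_filter.mp hp
      have h1 : 1 ≤ (p : ℝ) / y := by rw [le_div_iff₀ hy0, one_mul]; exact hPy p hpP
      have h2 : ⌊(p : ℝ) / y⌋₊ ≠ 0 := by
        have := Nat.one_le_floor_iff _ |>.mpr h1
        lia
      have h3 := Nat.pow_log_le_self 2 h2
      have h4 := Nat.lt_pow_succ_log_self (b := 2) (by norm_num) ⌊(p : ℝ) / y⌋₊
      rw [show Nat.log 2 ⌊(p : ℝ) / y⌋₊ = j from hpj] at h3 h4
      have h5 : (2 : ℝ) ^ j ≤ p / y := by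
        have := (Nat.le_floor_iff (by positivity)).mp h3
        exact_mod_cast this
      have h6 : (p : ℝ) / y < 2 ^ (j + 1) := by
        have := (Nat.floor_lt (by positivity)).mp h4
        exact_mod_cast this
      rw [le_div_iff₀ hy0] at h5
      rw [div_lt_iff₀ hy0, pow_succ] at h6
      exact ⟨h5, by linarith⟩
    have h7 := sum_prime_rpow_neg_dyadic_le (P := P.filter (fun p => g p = j))
      (fun p hp => hP p (Finset.mem_filter.mp hp).1) (x := 2 ^ j * y) (ℓ := Real.log y) (a := a)
      (by positivity) hly (by linarith) hmem
      (fun p hp => Real.log_le_log hy0 (hPy p (Finset.mem_filter.mp hp).1))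
    refine h7.trans ?_
    have h8 : ((2 : ℝ) ^ j) ^ (1 - a) ≤ q ^ j := by
      rw [← Real.rpow_natCast, ← Real.rpow_mul (by norm_num), mul_comm, Real.rpow_mul (by norm_num),
        Real.rpow_natCast]
      gcongr
      rw [hq]
      exact Real.rpow_le_rpow_of_exponent_le (by norm_num) (by linarith)
    rw [Real.mul_rpow (by positivity) hy0.le]
    calc 3 * (((2 : ℝ) ^ j) ^ (1 - a) * y ^ (1 - a)) / Real.log y
        ≤ 3 * (q ^ j * y ^ (1 - a)) / Real.log y := by gcongr
      _ = _ := by ring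
  calc _ ≤ ∑ j ∈ P.image g, 3 * y ^ (1 - a) / Real.log y * q ^ j := Finset.sum_le_sum hfib
    _ = 3 * y ^ (1 - a) / Real.log y * ∑ j ∈ P.image g, q ^ j := by rw [Finset.mul_sum]
    _ ≤ 3 * y ^ (1 - a) / Real.log y * (1 - q)⁻¹ := by
      gcongr
      exact finset_sum_geometric_le hq0 hq1 _
    _ = _ := by ring

/-- Primes below `√y` are replaced by all integers, the spare `y^((1-a)/2)` absorbing `log y`. Above
`√y`, `log p ≥ (log y)/2` and dyadic blocks descending from `y` decay geometrically. -/
theorem exists_sum_prime_le_le {a : ℝ} (ha0 : 0 ≤ a) (ha : a < 1) :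
    ∃ C : ℝ, 0 < C ∧ ∀ (P : Finset ℕ) (y : ℝ), 1 < y → (∀ p ∈ P, p.Prime) →
      (∀ p ∈ P, (p : ℝ) ≤ y) → ∑ p ∈ P, (p : ℝ) ^ (-a) ≤ C * y ^ (1 - a) / Real.log y := by
  have hb : 0 < 1 - a := by linarith
  set q : ℝ := 2 ^ (-(1 - a)) with hq
  have hq0 : 0 ≤ q := by positivity
  have hq1 : q < 1 := Real.rpow_lt_one_of_one_lt_of_neg (by norm_num) (by linarith)
  have hq2 : 0 < (1 - q)⁻¹ := inv_pos.mpr (by linarith)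
  refine ⟨2 / (1 - a) ^ 2 + 6 * (1 - q)⁻¹, by positivity, fun P y hy hP hPy => ?_⟩
  have hy0 : 0 < y := by linarith
  have hly : 0 < Real.log y := Real.log_pos hy
  rw [← Finset.sum_filter_add_sum_filter_not P (fun p : ℕ => (p : ℝ) < √y)]
  have hsmall : ∑ p ∈ P.filter (fun p : ℕ => (p : ℝ) < √y), (p : ℝ) ^ (-a) ≤
      2 / (1 - a) ^ 2 * y ^ (1 - a) / Real.log y := by
    have h1 : ∑ p ∈ P.filter (fun p : ℕ => (p : ℝ) < √y), (p : ℝ) ^ (-a) ≤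
        ∑ n ∈ Finset.Icc 1 ⌊√y⌋₊, (n : ℝ) ^ (-a) := by
      refine Finset.sum_le_sum_of_subset_of_nonneg ?_ fun _ _ _ => by positivity
      intro p hp
      obtain ⟨hpP, hpy⟩ := Finset.mem_filter.mp hp
      exact Finset.mem_Icc.mpr ⟨(hP p hpP).pos, Nat.le_floor hpy.le⟩
    have h2 := sum_rpow_neg_le ha0 ha ⌊√y⌋₊
    have h3 : ((⌊√y⌋₊ : ℕ) : ℝ) ^ (1 - a) ≤ y ^ ((1 - a) / 2) := by
      calc ((⌊√y⌋₊ : ℕ) : ℝ) ^ (1 - a) ≤ (√y) ^ (1 - a) := by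
            gcongr
            exact Nat.floor_le (Real.sqrt_nonneg y)
        _ = _ := by
          rw [Real.sqrt_eq_rpow, ← Real.rpow_mul hy0.le]
          ring_nf
    have h4 := Real.log_le_rpow_div hy0.le (show 0 < (1 - a) / 2 by positivity)
    rw [le_div_iff₀ hly]
    calc _ ≤ y ^ ((1 - a) / 2) / (1 - a) * (y ^ ((1 - a) / 2) / ((1 - a) / 2)) := by
          gcongr
          exact h1.trans (h2.trans (by gcongr))
      _ = 2 / (1 - a) ^ 2 * (y ^ ((1 - a) / 2) * y ^ ((1 - a) / 2)) := by field_simp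
      _ = _ := by rw [← Real.rpow_add hy0]; ring_nf
  set Q := P.filter (fun p : ℕ => ¬ (p : ℝ) < √y) with hQ
  have hQP : ∀ p ∈ Q, p ∈ P ∧ √y ≤ p := fun p hp => by
    have := Finset.mem_filter.mp hp
    exact ⟨this.1, not_lt.mp this.2⟩
  have hlarge : ∑ p ∈ Q, (p : ℝ) ^ (-a) ≤ 6 * (1 - q)⁻¹ * y ^ (1 - a) / Real.log y := by
    set g : ℕ → ℕ := fun p => Nat.log 2 ⌊y / (p : ℝ)⌋₊ with hg
    rw [← Finset.sum_fiberwise_of_maps_to (g := g) (t := Q.image g)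
      (fun p hp => Finset.mem_image_of_mem g hp)]
    have hfib : ∀ j ∈ Q.image g, ∑ p ∈ Q with g p = j, (p : ℝ) ^ (-a) ≤
        6 * y ^ (1 - a) / Real.log y * q ^ j := by
      intro j _
      have hmem : ∀ p ∈ Q.filter (fun p => g p = j),
          y / 2 ^ (j + 1) ≤ p ∧ (p : ℝ) ≤ 2 * (y / 2 ^ (j + 1)) := by
        intro p hp
        obtain ⟨hpQ, hpj⟩ := Finset.mem_filter.mp hp
        have hpP := (hQP p hpQ).1
        have hp0 : (0 : ℝ) < p := by exact_mod_cast (hP p hpP).pos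
        have h1 : 1 ≤ y / (p : ℝ) := by rw [le_div_iff₀ hp0, one_mul]; exact hPy p hpP
        have h2 : ⌊y / (p : ℝ)⌋₊ ≠ 0 := by
          have := Nat.one_le_floor_iff _ |>.mpr h1
          lia
        have h3 := Nat.pow_log_le_self 2 h2
        have h4 := Nat.lt_pow_succ_log_self (b := 2) (by norm_num) ⌊y / (p : ℝ)⌋₊
        rw [show Nat.log 2 ⌊y / (p : ℝ)⌋₊ = j from hpj] at h3 h4
        have h5 : (2 : ℝ) ^ j ≤ y / p := by
          have := (Nat.le_floor_iff (by positivity)).mp h3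
          exact_mod_cast this
        have h6 : y / (p : ℝ) < 2 ^ (j + 1) := by
          have := (Nat.floor_lt (by positivity)).mp h4
          exact_mod_cast this
        rw [le_div_iff₀ hp0] at h5
        rw [div_lt_iff₀ hp0] at h6
        constructor
        · rw [div_le_iff₀ (by positivity)]
          linarith
        · rw [pow_succ, ← mul_div_assoc, le_div_iff₀ (by positivity)]
          linarith
      have h7 := sum_prime_rpow_neg_dyadic_le (P := Q.filter (fun p => g p = j))
        (fun p hp => hP p (hQP p (Finset.mem_filter.mp hp).1).1) (x := y / 2 ^ (j + 1))
        (ℓ := Real.log y / 2) (a := a) (by positivity) (by linarith) ha0 hmem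
        (fun p hp => by
          rw [← Real.log_sqrt hy0.le]
          exact Real.log_le_log (Real.sqrt_pos.mpr hy0) (hQP p (Finset.mem_filter.mp hp).1).2)
      refine h7.trans ?_
      have h8 : (y / 2 ^ (j + 1)) ^ (1 - a) ≤ y ^ (1 - a) * q ^ j := by
        rw [Real.div_rpow hy0.le (by positivity), div_eq_mul_inv]
        gcongr
        rw [← Real.rpow_neg (by positivity), ← Real.rpow_natCast 2 (j + 1),
          ← Real.rpow_mul (by norm_num), hq, ← Real.rpow_natCast (2 ^ (-(1 - a))),
          ← Real.rpow_mul (by norm_num)]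
        apply Real.rpow_le_rpow_of_exponent_le (by norm_num)
        push_cast
        nlinarith
      calc 3 * (y / 2 ^ (j + 1)) ^ (1 - a) / (Real.log y / 2)
          ≤ 3 * (y ^ (1 - a) * q ^ j) / (Real.log y / 2) := by gcongr
        _ = _ := by field_simp; ring
    calc _ ≤ ∑ j ∈ Q.image g, 6 * y ^ (1 - a) / Real.log y * q ^ j := Finset.sum_le_sum hfib
      _ = 6 * y ^ (1 - a) / Real.log y * ∑ j ∈ Q.image g, q ^ j := by rw [Finset.mul_sum]
      _ ≤ 6 * y ^ (1 - a) / Real.log y * (1 - q)⁻¹ := by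
        gcongr
        exact finset_sum_geometric_le hq0 hq1 _
      _ = _ := by ring
  calc _ ≤ 2 / (1 - a) ^ 2 * y ^ (1 - a) / Real.log y + 6 * (1 - q)⁻¹ * y ^ (1 - a) / Real.log y :=
        add_le_add hsmall hlarge
    _ = _ := by ring

/-! ### Finite Euler products and the bound for `ζ` by a short prime sum. -/

/-- The sum `∑_{p < N} p^{-w}` over primes. -/
noncomputable def primeSum (N : ℕ) (w : ℂ) : ℂ := ∑ p ∈ N.primesBelow, (p : ℂ) ^ (-w)

/-- The finite Euler product `∏_{p < N} (1 - p^{-w})`. -/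
noncomputable def eulerFactor (N : ℕ) (w : ℂ) : ℂ := ∏ p ∈ N.primesBelow, (1 - (p : ℂ) ^ (-w))

theorem differentiable_natCast_cpow_neg {n : ℕ} (hn : n ≠ 0) :
    Differentiable ℂ fun w : ℂ => (n : ℂ) ^ (-w) := fun w =>
  DifferentiableAt.const_cpow (by fun_prop) (Or.inl (by exact_mod_cast hn))

theorem differentiable_eulerFactor (N : ℕ) : Differentiable ℂ (eulerFactor N) := by
  intro w
  refine DifferentiableAt.fun_finsetProd fun p hp => ?_
  exact ((differentiable_natCast_cpow_neg (Nat.prime_of_mem_primesBelow hp).ne_zero) w).const_sub 1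

theorem norm_primeSum_le {N : ℕ} {w : ℂ} : ‖primeSum N w‖ ≤ ∑ p ∈ N.primesBelow, (p : ℝ) ^ (-w.re) := by
  refine (norm_sum_le _ _).trans (Finset.sum_le_sum fun p hp => ?_)
  rw [Complex.norm_natCast_cpow_of_pos (Nat.prime_of_mem_primesBelow hp).pos, neg_re]

/-- `log (1 - x) = -x + O(|x|²)` with `|x| ≤ p^(-α) ≤ 3/4`, and `∑ p^(-2α)` converges for `α > 1/2`.
-/
theorem exists_eulerFactor_eq_exp {α : ℝ} (hα : 1 / 2 < α) :
    ∃ C : ℝ, 0 < C ∧ ∀ (N : ℕ) (w : ℂ), α ≤ w.re →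
      ∃ g : ℂ, eulerFactor N w = Complex.exp g ∧ ‖g + primeSum N w‖ ≤ C := by
  have hsum : Summable fun n : ℕ => (n : ℝ) ^ (-(2 * α)) :=
    Real.summable_nat_rpow.mpr (by linarith)
  have hS0 : 0 ≤ ∑' n : ℕ, (n : ℝ) ^ (-(2 * α)) := tsum_nonneg fun n => by positivity
  refine ⟨2 * ∑' n : ℕ, (n : ℝ) ^ (-(2 * α)) + 1, by positivity, fun N w hw => ?_⟩
  refine ⟨∑ p ∈ N.primesBelow, Complex.log (1 - (p : ℂ) ^ (-w)), ?_, ?_⟩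
  · rw [eulerFactor, Complex.exp_sum]
    refine Finset.prod_congr rfl fun p hp => ?_
    have hpp := Nat.prime_of_mem_primesBelow hp
    rw [Complex.exp_log]
    intro h
    have h1 : ‖(p : ℂ) ^ (-w)‖ = 1 := by rw [← sub_eq_zero.mp h, norm_one]
    rw [Complex.norm_natCast_cpow_of_pos hpp.pos, neg_re] at h1
    have h2 : (p : ℝ) ^ (-w.re) < 1 :=
      Real.rpow_lt_one_of_one_lt_of_neg (by exact_mod_cast hpp.one_lt) (by linarith)
    linarith
  · rw [primeSum, ← Finset.sum_add_distrib]
    have hterm : ∀ p ∈ N.primesBelow,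
        ‖Complex.log (1 - (p : ℂ) ^ (-w)) + (p : ℂ) ^ (-w)‖ ≤ 2 * (p : ℝ) ^ (-(2 * α)) := by
      intro p hp
      have hpp := Nat.prime_of_mem_primesBelow hp
      have hp2 : (2 : ℝ) ≤ p := by exact_mod_cast hpp.two_le
      have hp0 : (0 : ℝ) < p := by linarith
      set x := (p : ℂ) ^ (-w) with hx
      have hxn : ‖x‖ ≤ (p : ℝ) ^ (-α) := by
        rw [hx, Complex.norm_natCast_cpow_of_pos hpp.pos, neg_re]
        exact Real.rpow_le_rpow_of_exponent_le (by linarith) (by linarith)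
      have hsq : ((p : ℝ) ^ (-α)) ^ 2 = (p : ℝ) ^ (-(2 * α)) := by
        rw [← Real.rpow_natCast, ← Real.rpow_mul hp0.le]
        congr 1
        push_cast
        ring
      have hhalf : ((p : ℝ) ^ (-α)) ^ 2 ≤ 1 / 2 := by
        rw [hsq]
        calc (p : ℝ) ^ (-(2 * α)) ≤ (p : ℝ) ^ (-1 : ℝ) :=
              Real.rpow_le_rpow_of_exponent_le (by linarith) (by linarith)
          _ = (p : ℝ)⁻¹ := Real.rpow_neg_one _
          _ ≤ 1 / 2 := by rw [one_div]; gcongr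
      have hpos : 0 ≤ (p : ℝ) ^ (-α) := by positivity
      have hx34 : ‖x‖ ≤ 3 / 4 := by nlinarith [norm_nonneg x]
      have h1 := Complex.norm_log_one_add_sub_self_le (z := -x) (by rw [norm_neg]; linarith)
      rw [norm_neg, sub_neg_eq_add, ← sub_eq_add_neg] at h1
      have h2 : (1 - ‖x‖)⁻¹ ≤ 4 := by
        rw [inv_le_comm₀ (by linarith) (by norm_num)]
        linarith
      calc _ ≤ ‖x‖ ^ 2 * (1 - ‖x‖)⁻¹ / 2 := h1
        _ ≤ ((p : ℝ) ^ (-α)) ^ 2 * 4 / 2 := by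
          have : 0 ≤ (1 - ‖x‖)⁻¹ := inv_nonneg.mpr (by linarith)
          gcongr
        _ = _ := by rw [hsq]; ring
    calc _ ≤ ∑ p ∈ N.primesBelow, 2 * (p : ℝ) ^ (-(2 * α)) :=
          (norm_sum_le _ _).trans (Finset.sum_le_sum hterm)
      _ = 2 * ∑ p ∈ N.primesBelow, (p : ℝ) ^ (-(2 * α)) := by rw [Finset.mul_sum]
      _ ≤ 2 * ∑' n : ℕ, (n : ℝ) ^ (-(2 * α)) := by
        gcongr
        exact hsum.sum_le_tsum _ fun n _ => by positivity
      _ ≤ _ := by linarith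

theorem zeta_sub_inv_eulerFactor {w : ℂ} (hw : 1 < w.re) (N : ℕ) :
    riemannZeta w - (eulerFactor N w)⁻¹ =
      ∑' n : ↥(N.smoothNumbers : Set ℕ)ᶜ, ((n : ℕ) : ℂ) ^ (-w) := by
  set f : ℕ →* ℂ := (riemannZetaSummandHom (ne_zero_of_one_lt_re hw)).toMonoidHom with hf
  have hfs : Summable fun n : ℕ => f n := (summable_riemannZetaSummand hw).of_norm
  have hz : riemannZeta w = ∑' n, f n := (tsum_riemannZetaSummand hw).symm
  have hprod : (eulerFactor N w)⁻¹ = ∑' n : N.smoothNumbers, f n := by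
    have h := EulerProduct.prod_primesBelow_geometric_eq_tsum_smoothNumbers hfs N
    rw [Finset.prod_inv_distrib] at h
    exact h
  rw [hz, hprod, ← hfs.tsum_subtype_add_tsum_subtype_compl N.smoothNumbers, add_sub_cancel_left]
  rfl

/-- Positive integers that are not `N`-smooth are at least `N`, so `ζ` minus the finite product is a
tail of an absolutely convergent series, while the product itself is bounded for `Re w ≥ 2`. -/
theorem exists_norm_zeta_mul_eulerFactor_sub_one_le :
    ∃ C : ℝ, 0 < C ∧ ∀ (N : ℕ) (w : ℂ), 1 ≤ N → 2 ≤ w.re →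
      ‖riemannZeta w * eulerFactor N w - 1‖ ≤ C * (N : ℝ) ^ (-(1 / 2) : ℝ) := by
  obtain ⟨C₁, hC₁, hexp⟩ := exists_eulerFactor_eq_exp (α := 2) (by norm_num)
  have hsum2 : Summable fun n : ℕ => (n : ℝ) ^ (-2 : ℝ) :=
    Real.summable_nat_rpow.mpr (by norm_num)
  have hsum : Summable fun n : ℕ => (n : ℝ) ^ (-(3 / 2) : ℝ) :=
    Real.summable_nat_rpow.mpr (by norm_num)
  set S₂ := ∑' n : ℕ, (n : ℝ) ^ (-2 : ℝ)
  set S := ∑' n : ℕ, (n : ℝ) ^ (-(3 / 2) : ℝ) with hS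
  have hS0 : 0 ≤ S := tsum_nonneg fun n => by positivity
  refine ⟨Real.exp (C₁ + S₂) * (S + 1), by positivity, fun N w hN hw => ?_⟩
  have hw0 : w ≠ 0 := by rintro rfl; norm_num at hw
  have hw1 : 1 < w.re := by linarith
  have hN0 : (0 : ℝ) < N := by exact_mod_cast hN
  have hdiff := zeta_sub_inv_eulerFactor hw1 N
  have hbound : ‖riemannZeta w - (eulerFactor N w)⁻¹‖ ≤ (N : ℝ) ^ (-(1 / 2) : ℝ) * S := by
    rw [hdiff, hS, ← tsum_mul_left]
    have hg : Summable fun n : ℕ => (N : ℝ) ^ (-(1 / 2) : ℝ) * (n : ℝ) ^ (-(3 / 2) : ℝ) :=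
      hsum.mul_left _
    refine (tsum_of_norm_bounded
      (f := fun n : ↥(N.smoothNumbers : Set ℕ)ᶜ => ((n : ℕ) : ℂ) ^ (-w))
      (g := fun n : ↥(N.smoothNumbers : Set ℕ)ᶜ =>
        (N : ℝ) ^ (-(1 / 2) : ℝ) * ((n : ℕ) : ℝ) ^ (-(3 / 2) : ℝ))
      (hg.subtype _).hasSum ?_).trans ?_
    · rintro ⟨n, hn⟩
      rcases Nat.eq_zero_or_pos n with rfl | hn0
      · simp only [Nat.cast_zero, Complex.zero_cpow (neg_ne_zero.mpr hw0), norm_zero]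
        positivity
      · have hNn : N ≤ n := by
          by_contra h
          exact hn (Nat.mem_smoothNumbers_of_lt hn0 (not_le.mp h))
        have hn0' : (0 : ℝ) < n := by exact_mod_cast hn0
        rw [Complex.norm_natCast_cpow_of_pos hn0, neg_re]
        calc (n : ℝ) ^ (-w.re) ≤ (n : ℝ) ^ (-(1 / 2) + -(3 / 2) : ℝ) :=
              Real.rpow_le_rpow_of_exponent_le (by exact_mod_cast hn0) (by linarith)
          _ = (n : ℝ) ^ (-(1 / 2) : ℝ) * (n : ℝ) ^ (-(3 / 2) : ℝ) := Real.rpow_add hn0' _ _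
          _ ≤ _ := by
            refine mul_le_mul_of_nonneg_right ?_ (by positivity)
            exact Real.rpow_le_rpow_of_nonpos hN0 (by exact_mod_cast hNn) (by norm_num)
    · exact Summable.tsum_subtype_le _ _ (fun n => by positivity) hg
  obtain ⟨g, hg, hgC⟩ := hexp N w hw
  have hne : eulerFactor N w ≠ 0 := by rw [hg]; exact Complex.exp_ne_zero g
  have hEn : ‖eulerFactor N w‖ ≤ Real.exp (C₁ + S₂) := by
    rw [hg, Complex.norm_exp]
    refine Real.exp_le_exp.mpr ((Complex.re_le_norm g).trans ?_)
    have h1 : ‖primeSum N w‖ ≤ S₂ := by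
      refine norm_primeSum_le.trans ?_
      refine le_trans (Finset.sum_le_sum fun p hp => ?_)
        (hsum2.sum_le_tsum N.primesBelow fun n _ => by positivity)
      exact Real.rpow_le_rpow_of_exponent_le
        (by exact_mod_cast (Nat.prime_of_mem_primesBelow hp).one_le) (by linarith)
    have h2 := norm_sub_le (g + primeSum N w) (primeSum N w)
    rw [add_sub_cancel_right] at h2
    linarith
  have hfin : riemannZeta w * eulerFactor N w - 1 =
      eulerFactor N w * (riemannZeta w - (eulerFactor N w)⁻¹) := by
    field_simp
  rw [hfin, norm_mul]
  calc _ ≤ Real.exp (C₁ + S₂) * ((N : ℝ) ^ (-(1 / 2) : ℝ) * S) := by gcongr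
    _ ≤ Real.exp (C₁ + S₂) * ((N : ℝ) ^ (-(1 / 2) : ℝ) * (S + 1)) := by gcongr; linarith
    _ = _ := by ring

/-- Where `ζ` has no zeros and the prime sum is not exceptionally large, `ζ` is controlled by a
short sum over primes. -/
theorem exists_norm_zeta_le_exp_primeSum {ρ₁ ρ₃ : ℝ} (h1 : 1 < ρ₁) (h13 : ρ₁ < ρ₃)
    (h3 : ρ₃ < 5 / 2) :
    ∃ A C T₀ : ℝ, 0 < A ∧ ∀ T : ℝ, T₀ ≤ T → ∀ t ∈ Set.Icc T (2 * T),
      (∀ z ∈ Metric.closedBall ((3 : ℂ) + t * I) ρ₃, riemannZeta z ≠ 0) →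
      (∀ z ∈ Metric.closedBall ((3 : ℂ) + t * I) ρ₃,
        ‖primeSum ⌈Real.log T ^ A⌉₊ z‖ ≤ Real.log T) →
      ∀ z ∈ Metric.closedBall ((3 : ℂ) + t * I) ρ₁,
        ‖riemannZeta z‖ ≤ Real.exp (C + ‖primeSum ⌈Real.log T ^ A⌉₊ z‖) := by
  obtain ⟨K, θ, hK, hθ0, hθ1, hconf⟩ := norm_le_exp_of_ne_zero h1 h13
  obtain ⟨C₁, hC₁, hexp⟩ := exists_eulerFactor_eq_exp (α := 3 - ρ₃) (by linarith)
  obtain ⟨C₂, hC₂, hsmall⟩ := exists_norm_zeta_mul_eulerFactor_sub_one_le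
  obtain ⟨T₁, hT₁, hpoly⟩ := exists_norm_zeta_le_pow
  -- With `N ≥ (log T)^A`, the deviation from `1` is `η ≍ (log T)^(-A/2)`, so `η^θ ≍ 1 / log T`,
  -- which outweighs the factor `(log T)^(1-θ)`.
  set A := 2 / θ with hA
  have hA0 : 0 < A := by positivity
  have hA1 : 1 ≤ A / 2 := by rw [hA, le_div_iff₀ (by norm_num), le_div_iff₀ hθ0]; linarith
  refine ⟨A, K * (5 * C₂ ^ θ) + C₁,
    max (max T₁ 6) (max (Real.exp 1) (max (Real.exp C₁) (Real.exp (2 * C₂)))), hA0, ?_⟩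
  intro T hT t ht hne hS z hz
  simp only [max_le_iff] at hT
  obtain ⟨⟨hTT₁, hT6⟩, hTe, hTC₁, hTC₂⟩ := hT
  have hT0 : 0 < T := by linarith
  set ℓ := Real.log T with hℓ
  have hℓ1 : 1 ≤ ℓ := (Real.le_log_iff_exp_le hT0).mpr hTe
  have hℓC₁ : C₁ ≤ ℓ := (Real.le_log_iff_exp_le hT0).mpr hTC₁
  have hℓC₂ : 2 * C₂ ≤ ℓ := (Real.le_log_iff_exp_le hT0).mpr hTC₂
  set N := ⌈ℓ ^ A⌉₊ with hN
  have hNl : ℓ ^ A ≤ N := Nat.le_ceil _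
  have hℓA : 1 ≤ ℓ ^ A := Real.one_le_rpow hℓ1 hA0.le
  have hN1 : 1 ≤ N := by
    have : (1 : ℝ) ≤ N := by linarith
    exact_mod_cast this
  have hcre : ∀ R : ℝ, ∀ w ∈ Metric.closedBall ((3 : ℂ) + t * I) R,
      3 - R ≤ w.re ∧ w.re ≤ 3 + R ∧ t - R ≤ w.im ∧ w.im ≤ t + R := by
    intro R w hw
    have hw' := mem_closedBall_iff_norm.mp hw
    have e1 := abs_le.mp ((Complex.abs_re_le_norm _).trans hw')
    have e2 := abs_le.mp ((Complex.abs_im_le_norm _).trans hw')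
    simp at e1 e2
    exact ⟨by linarith, by linarith, by linarith, by linarith⟩
  have hsub : Metric.ball ((3 : ℂ) + t * I) ρ₃ ⊆ Metric.closedBall ((3 : ℂ) + t * I) ρ₃ :=
    Metric.ball_subset_closedBall
  have hEl : ∀ w ∈ Metric.closedBall ((3 : ℂ) + t * I) ρ₃,
      ‖eulerFactor N w‖ ≤ Real.exp (C₁ + ‖primeSum N w‖) ∧
      Real.exp (-(C₁ + ‖primeSum N w‖)) ≤ ‖eulerFactor N w‖ := by
    intro w hw
    obtain ⟨g, hg, hgC⟩ := hexp N w (hcre _ w hw).1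
    have e1 : ‖g‖ ≤ C₁ + ‖primeSum N w‖ := by
      have := norm_sub_le (g + primeSum N w) (primeSum N w)
      rw [add_sub_cancel_right] at this
      linarith
    have e2 := abs_le.mp ((Complex.abs_re_le_norm g).trans e1)
    rw [hg, Complex.norm_exp]
    exact ⟨Real.exp_le_exp.mpr e2.2, Real.exp_le_exp.mpr e2.1⟩
  have hE0 : ∀ w ∈ Metric.closedBall ((3 : ℂ) + t * I) ρ₃, 0 < ‖eulerFactor N w‖ := fun w hw =>
    (Real.exp_pos _).trans_le (hEl w hw).2
  set η := C₂ * ℓ ^ (-(A / 2)) with hη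
  have hη0 : 0 < η := by positivity
  have hη12 : η ≤ 1 / 2 := by
    have e1 : ℓ ^ (-(A / 2)) ≤ ℓ ^ (-1 : ℝ) :=
      Real.rpow_le_rpow_of_exponent_le hℓ1 (by linarith)
    rw [Real.rpow_neg_one] at e1
    calc η ≤ C₂ * ℓ⁻¹ := by rw [hη]; gcongr
      _ ≤ 1 / 2 := by
        rw [← div_eq_mul_inv, div_le_iff₀ (by linarith)]
        linarith
  -- The bound `exp (5 log T)` combines `|ζ| ≤ T^3` with an Euler factor of at most `exp (C₁ + log
  -- T)`, where `C₁ ≤ log T`.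
  have hQ := hconf (fun w => riemannZeta w * eulerFactor N w) (3 + t * I) (5 * ℓ) η
    (by linarith) hη0 hη12
    (by
      intro w hw
      have hb := hcre _ w (hsub hw)
      have hw1 : w ≠ 1 := by
        rintro rfl
        have := hb.2.2.1
        rw [one_im] at this
        linarith [ht.1]
      exact ((differentiableAt_riemannZeta hw1).mul
        (differentiable_eulerFactor N w)).differentiableWithinAt)
    (fun w hw => mul_ne_zero (hne w (hsub hw)) (norm_pos_iff.mp (hE0 w (hsub hw))))
    (by
      intro w hw
      have hb := hcre _ w (hsub hw)
      have e1 := hpoly T hTT₁ w (by linarith) (by linarith) (by linarith [ht.1])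
        (by linarith [ht.2])
      have e2 := (hEl w (hsub hw)).1
      have e3 : T ^ 3 = Real.exp (3 * ℓ) := by
        rw [hℓ, ← Real.log_rpow hT0, Real.exp_log (by positivity)]
        norm_cast
      rw [norm_mul]
      calc _ ≤ Real.exp (3 * ℓ) * Real.exp (C₁ + ‖primeSum N w‖) := by
            rw [← e3]; gcongr
        _ = Real.exp (3 * ℓ + (C₁ + ‖primeSum N w‖)) := (Real.exp_add _ _).symm
        _ ≤ _ := Real.exp_le_exp.mpr (by linarith [hS w (hsub hw)]))
    (by
      intro w hw
      have hb := hcre _ w hw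
      refine (hsmall N w hN1 (by linarith)).trans ?_
      rw [hη]
      gcongr
      calc (N : ℝ) ^ (-(1 / 2) : ℝ) ≤ (ℓ ^ A) ^ (-(1 / 2) : ℝ) :=
            Real.rpow_le_rpow_of_nonpos (by linarith) hNl (by norm_num)
        _ = _ := by
          rw [← Real.rpow_mul (by linarith)]
          ring_nf)
    z hz
  have hzρ : z ∈ Metric.closedBall ((3 : ℂ) + t * I) ρ₃ := Metric.closedBall_subset_closedBall h13.le hz
  have hKb : K * (5 * ℓ) ^ (1 - θ) * η ^ θ ≤ K * (5 * C₂ ^ θ) := by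
    have e1 : (5 * ℓ) ^ (1 - θ) ≤ 5 * ℓ ^ (1 - θ) := by
      rw [Real.mul_rpow (by norm_num) (by linarith)]
      gcongr
      calc (5 : ℝ) ^ (1 - θ) ≤ 5 ^ (1 : ℝ) :=
            Real.rpow_le_rpow_of_exponent_le (by norm_num) (by linarith)
        _ = 5 := Real.rpow_one _
    have e2 : η ^ θ = C₂ ^ θ * ℓ ^ (-1 : ℝ) := by
      rw [hη, Real.mul_rpow hC₂.le (by positivity), ← Real.rpow_mul (by linarith), hA]
      congr 2
      field_simp
    have e3 : ℓ ^ (1 - θ) * ℓ ^ (-1 : ℝ) ≤ 1 := by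
      rw [← Real.rpow_add (by linarith)]
      exact Real.rpow_le_one_of_one_le_of_nonpos hℓ1 (by linarith)
    rw [mul_assoc, e2]
    refine mul_le_mul_of_nonneg_left ?_ hK.le
    calc (5 * ℓ) ^ (1 - θ) * (C₂ ^ θ * ℓ ^ (-1 : ℝ))
        ≤ 5 * ℓ ^ (1 - θ) * (C₂ ^ θ * ℓ ^ (-1 : ℝ)) := by gcongr
      _ = 5 * C₂ ^ θ * (ℓ ^ (1 - θ) * ℓ ^ (-1 : ℝ)) := by ring
      _ ≤ 5 * C₂ ^ θ * 1 := by gcongr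
      _ = _ := mul_one _
  have hζ : ‖riemannZeta z‖ = ‖riemannZeta z * eulerFactor N z‖ * ‖eulerFactor N z‖⁻¹ := by
    rw [norm_mul, mul_assoc, mul_inv_cancel₀ (hE0 z hzρ).ne', mul_one]
  rw [hζ]
  calc _ ≤ Real.exp (K * (5 * C₂ ^ θ)) * (Real.exp (-(C₁ + ‖primeSum N z‖)))⁻¹ := by
        gcongr
        · exact hQ.trans (Real.exp_le_exp.mpr hKb)
        · exact (hEl z hzρ).2
    _ = _ := by
      rw [← Real.exp_neg, ← Real.exp_add]
      congr 1
      ring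

/-! ### Large deviations of prime sums. -/

/-- Large values, on discs moving along a vertical line, of a sum over primes. -/
theorem measure_prime_sum_large_le {P : Finset ℕ} {Y : ℕ} (hP : ∀ p ∈ P, p.Prime)
    (hPY : ∀ p ∈ P, p ≤ Y) {k : ℕ} {T ρ ρ' lam : ℝ} (hT : 0 ≤ T) (hYT : ((Y : ℝ) ^ k) ^ 2 ≤ T)
    (hρ : 0 ≤ ρ) (hρ' : ρ < ρ') (hlam : 0 < lam) :
    volume.real {t ∈ Set.Icc T (2 * T) | ∃ z ∈ Metric.closedBall ((3 : ℂ) + t * I) ρ,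
      lam ≤ ‖∑ p ∈ P, (p : ℂ) ^ (-z)‖} ≤
      ρ' / (ρ' - ρ) * (3 * T) *
        (k * (∑ p ∈ P, (p : ℝ) ^ (-(2 * (3 - ρ')))) / lam ^ 2) ^ k := by
  set F : ℂ → ℂ := fun z => (∑ p ∈ P, (p : ℂ) ^ (-z)) ^ k with hF
  set E := ∑ p ∈ P, (p : ℝ) ^ (-(2 * (3 - ρ'))) with hE'
  have hE0 : 0 ≤ E := Finset.sum_nonneg fun _ _ => by positivity
  have hFd : Differentiable ℂ F := by
    refine Differentiable.pow (fun z => ?_) k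
    exact DifferentiableAt.fun_sum fun p hp => differentiable_natCast_cpow_neg (hP p hp).ne_zero z
  have key := measure_large_values_le (F := F) (c := 3) (ρ := ρ) (ρ' := ρ') (T₁ := T) (T₂ := 2 * T)
    (B := 3 * T * (k * E) ^ k) (lam := (lam ^ k) ^ 2) hρ hρ' (by linarith) (by positivity)
    (fun t _ w _ => hFd w)
    (by
      intro θ
      set w : ℂ := circleMap 3 ρ' θ with hw
      have h5 : ‖w - 3‖ = ρ' := by
        rw [hw, circleMap_sub_center, norm_circleMap_zero, abs_of_pos (by linarith)]
      have h6 := abs_le.mp ((Complex.abs_re_le_norm (w - 3)).trans h5.le)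
      simp only [sub_re, re_ofNat] at h6
      have h9 : ∀ t : ℝ, F (circleMap (3 + t * I) ρ' θ) =
          (∑ p ∈ P, (p : ℂ) ^ (-w) * (p : ℂ) ^ (-(t * I))) ^ k := by
        intro t
        have h10 : circleMap (3 + t * I) ρ' θ = w + t * I := by
          rw [hw, circleMap, circleMap]
          ring
        rw [h10, hF]
        simp only
        congr 1
        refine Finset.sum_congr rfl fun p hp => ?_
        rw [neg_add, Complex.cpow_add _ _ (by exact_mod_cast (hP p hp).ne_zero)]
      simp_rw [h9]
      refine (integral_prime_sum_pow_le hP hPY (fun p => (p : ℂ) ^ (-w)) k (by linarith)).trans ?_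
      have h11 : ∑ p ∈ P, ‖(p : ℂ) ^ (-w)‖ ^ 2 ≤ E := by
        refine Finset.sum_le_sum fun p hp => ?_
        have hp1 : (1 : ℝ) ≤ p := by exact_mod_cast (hP p hp).one_le
        rw [Complex.norm_natCast_cpow_of_pos (hP p hp).pos, neg_re, ← Real.rpow_natCast,
          ← Real.rpow_mul (by positivity)]
        apply Real.rpow_le_rpow_of_exponent_le hp1
        push_cast
        linarith [h6.1]
      have h12 : (k.factorial : ℝ) ≤ (k : ℝ) ^ k := by exact_mod_cast Nat.factorial_le_pow k
      calc _ ≤ (3 * T) * ((k : ℝ) ^ k * E ^ k) := by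
            gcongr
            · linarith
        _ = _ := by rw [mul_pow])
  have hsub : volume.real {t ∈ Set.Icc T (2 * T) | ∃ z ∈ Metric.closedBall ((3 : ℂ) + t * I) ρ,
      lam ≤ ‖∑ p ∈ P, (p : ℂ) ^ (-z)‖} ≤ _ :=
    (measureReal_Icc_inter_mono fun t _ ⟨z, hz, hl⟩ => ⟨z, hz, by
      rw [hF]
      simp only [norm_pow]
      gcongr⟩).trans key
  refine hsub.trans (le_of_eq ?_)
  rw [div_pow, ← pow_mul, ← pow_mul]
  ring

theorem primesBelow_subset_Icc {N p : ℕ} (hp : p ∈ N.primesBelow) : p ≤ N :=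
  (Nat.lt_of_mem_primesBelow hp).le

/-- Expresses Chebyshev-type bounds at the cut `y = k log k` in terms of `k` and `log k`. -/
theorem rpow_div_log_le {a x y l : ℝ} (hx : 0 < x) (hl : 1 ≤ l) (hy : y = x * l)
    (hly : l ≤ Real.log y) : y ^ (1 - a) / Real.log y ≤ x ^ (1 - a) * l ^ (-a) := by
  have hl0 : 0 < l := by linarith
  have hy0 : 0 < y := by rw [hy]; positivity
  calc y ^ (1 - a) / Real.log y ≤ y ^ (1 - a) / l := by gcongr
    _ = x ^ (1 - a) * (l ^ (1 - a) * l⁻¹) := by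
      rw [hy, Real.mul_rpow hx.le hl0.le]; ring
    _ = _ := by
      rw [← Real.rpow_neg_one, ← Real.rpow_add hl0]; ring_nf

/-- Large deviations of prime sums up to the edge of the disc. -/
theorem exists_measure_primeSum_large_le {σ : ℝ} (hσ : 1 / 2 < σ) (hσ1 : σ < 1) :
    ∃ C k₀ : ℝ, 0 < C ∧ ∀ (k N : ℕ) (T : ℝ), k₀ ≤ k → 0 ≤ T → ((N : ℝ) ^ k) ^ 2 ≤ T →
      volume.real {t ∈ Set.Icc T (2 * T) |
        ∃ z ∈ Metric.closedBall ((3 : ℂ) + t * I) (3 - σ + 1 / Real.log k),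
          C * ((k : ℝ) ^ (1 - σ) * Real.log k ^ (-σ)) ≤ ‖primeSum N z‖} ≤
      C * T * Real.exp (-k) := by
  obtain ⟨C₁, hC₁, hsmall⟩ := exists_sum_prime_le_le (a := σ) (by linarith) hσ1
  obtain ⟨C₂, hC₂, hlarge⟩ := exists_sum_prime_gt_le (a₀ := σ + 1 / 2) (by linarith)
  -- Chosen so that `C₂ e^8 / D² ≤ e^(-2)`; the `e^8` is the cost of shifting the abscissa of the
  -- squared sum.
  set D := Real.exp 5 * (C₂ + 1) with hD
  have hD0 : 0 < D := by positivity
  -- `e² C₁` covers the primes up to `y`, `D` those beyond, and `9` the factor in the final measure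
  -- bound. The lower limit for `k` gives `4ε ≤ σ - 1/2`, which keeps the exponent `2(σ - 2ε)` at
  -- least `σ + 1/2 > 1`.
  refine ⟨Real.exp 2 * C₁ + D + 9, Real.exp (4 / (σ - 1 / 2)), by positivity, ?_⟩
  intro k N T hk hT hNT
  set x : ℝ := (k : ℝ) with hx
  have hx0 : 0 < x := (Real.exp_pos _).trans_le hk
  set l := Real.log x with hl
  have hlσ : 4 / (σ - 1 / 2) ≤ l := (Real.le_log_iff_exp_le hx0).mpr hk
  have hl8 : 8 ≤ l := by
    refine le_trans ?_ hlσ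
    rw [le_div_iff₀ (by linarith)]
    linarith
  have hl0 : 0 < l := by linarith
  have hlσ' : 4 / l ≤ σ - 1 / 2 := by
    rw [div_le_iff₀ (by linarith)] at hlσ
    rw [div_le_iff₀ hl0]
    linarith
  have hx1 : 1 < x := by
    by_contra h
    have := Real.log_nonpos hx0.le (not_lt.mp h)
    linarith
  have hlx : l ≤ x := by
    have := Real.log_le_sub_one_of_pos hx0
    linarith
  set ε := 1 / l with hε
  have hε0 : 0 < ε := by positivity
  have hε4 : 4 * ε ≤ σ - 1 / 2 := by rw [hε]; linarith [show 4 * (1 / l) = 4 / l by ring]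
  -- At this cut the trivial bound for `∑_{p≤y} p^(-σ)` and the square root of `k ∑_{p>y} p^(-2σ)`
  -- both have order `W = k^(1-σ) (log k)^(-σ)`.
  set y := x * l with hy
  have hyx : x ≤ y := by nlinarith
  have hy1 : 1 < y := by linarith
  have hy0 : 0 < y := by linarith
  have hly : l ≤ Real.log y := Real.log_le_log hx0 hyx
  have hly2 : Real.log y ≤ 2 * l := by
    rw [hy, Real.log_mul hx0.ne' hl0.ne']
    have := Real.log_le_log hl0 hlx
    linarith
  -- Moving the abscissa by a multiple of `1 / log k` costs only a constant factor, since `log y ≤ 2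
  -- log k`.
  have hyε : ∀ c : ℝ, 0 ≤ c → y ^ (c * ε) ≤ Real.exp (2 * c) := by
    intro c hc
    rw [Real.rpow_def_of_pos hy0]
    refine Real.exp_le_exp.mpr ?_
    calc Real.log y * (c * ε) ≤ 2 * l * (c * ε) := by gcongr
      _ = 2 * c := by rw [hε]; field_simp
  set W := x ^ (1 - σ) * l ^ (-σ) with hW
  have hW0 : 0 < W := by positivity
  set P₁ := N.primesBelow.filter (fun p : ℕ => (p : ℝ) ≤ y) with hP₁
  set P₂ := N.primesBelow.filter (fun p : ℕ => ¬ (p : ℝ) ≤ y) with hP₂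
  have hP₁p : ∀ p ∈ P₁, p.Prime ∧ (p : ℝ) ≤ y := fun p hp =>
    ⟨Nat.prime_of_mem_primesBelow (Finset.mem_filter.mp hp).1, (Finset.mem_filter.mp hp).2⟩
  have hP₂p : ∀ p ∈ P₂, p.Prime ∧ y ≤ p := fun p hp =>
    ⟨Nat.prime_of_mem_primesBelow (Finset.mem_filter.mp hp).1, (not_le.mp (Finset.mem_filter.mp hp).2).le⟩
  have hsplit : ∀ z, primeSum N z = ∑ p ∈ P₁, (p : ℂ) ^ (-z) + ∑ p ∈ P₂, (p : ℂ) ^ (-z) := fun z =>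
    (Finset.sum_filter_add_sum_filter_not _ _ _).symm
  have hS₁ : ∀ z : ℂ, σ - ε ≤ z.re → ‖∑ p ∈ P₁, (p : ℂ) ^ (-z)‖ ≤ Real.exp 2 * C₁ * W := by
    intro z hz
    calc ‖∑ p ∈ P₁, (p : ℂ) ^ (-z)‖ ≤ ∑ p ∈ P₁, Real.exp 2 * (p : ℝ) ^ (-σ) := by
          refine (norm_sum_le _ _).trans (Finset.sum_le_sum fun p hp => ?_)
          obtain ⟨hpp, hpy⟩ := hP₁p p hp
          have hp1 : (1 : ℝ) ≤ p := by exact_mod_cast hpp.one_le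
          have hp0 : (0 : ℝ) < p := by linarith
          rw [Complex.norm_natCast_cpow_of_pos hpp.pos, neg_re]
          calc (p : ℝ) ^ (-z.re) ≤ (p : ℝ) ^ (1 * ε + -σ) :=
                Real.rpow_le_rpow_of_exponent_le hp1 (by linarith)
            _ = (p : ℝ) ^ (1 * ε) * (p : ℝ) ^ (-σ) := Real.rpow_add hp0 _ _
            _ ≤ y ^ (1 * ε) * (p : ℝ) ^ (-σ) := by gcongr
            _ ≤ _ := by
              gcongr
              have := hyε 1 zero_le_one
              rwa [mul_one] at this
      _ = Real.exp 2 * ∑ p ∈ P₁, (p : ℝ) ^ (-σ) := by rw [Finset.mul_sum]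
      _ ≤ Real.exp 2 * (C₁ * y ^ (1 - σ) / Real.log y) := by
        gcongr
        exact hsmall P₁ y hy1 (fun p hp => (hP₁p p hp).1) (fun p hp => (hP₁p p hp).2)
      _ = Real.exp 2 * C₁ * (y ^ (1 - σ) / Real.log y) := by ring
      _ ≤ _ := by
        gcongr
        exact rpow_div_log_le hx0 (by linarith) hy hly
  have hS₂ : x * ∑ p ∈ P₂, (p : ℝ) ^ (-(2 * (3 - (3 - σ + 2 * ε)))) / (D * W) ^ 2 ≤
      Real.exp (-2) := by
    have h1 := hlarge P₂ y (2 * (3 - (3 - σ + 2 * ε))) hy1 (by linarith)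
      (fun p hp => (hP₂p p hp).1) (fun p hp => (hP₂p p hp).2)
    rw [show 1 - 2 * (3 - (3 - σ + 2 * ε)) = 4 * ε + (1 - 2 * σ) by ring, Real.rpow_add hy0] at h1
    have h2 := rpow_div_log_le (a := 2 * σ) hx0 (by linarith) hy hly
    have h3 : x * (x ^ (1 - 2 * σ) * l ^ (-(2 * σ))) = W ^ 2 := by
      have e1 : x * x ^ (1 - 2 * σ) = (x ^ (1 - σ)) ^ 2 := by
        rw [← Real.rpow_natCast (x ^ (1 - σ)), ← Real.rpow_mul hx0.le]
        conv_lhs => rw [← Real.rpow_one x, ← Real.rpow_mul hx0.le, ← Real.rpow_add hx0]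
        congr 1
        push_cast
        ring
      have e2 : l ^ (-(2 * σ)) = (l ^ (-σ)) ^ 2 := by
        rw [← Real.rpow_natCast (l ^ (-σ)), ← Real.rpow_mul hl0.le]
        congr 1
        push_cast
        ring
      rw [hW, mul_pow, ← e1, ← e2]
      ring
    have h4 : ∑ p ∈ P₂, (p : ℝ) ^ (-(2 * (3 - (3 - σ + 2 * ε)))) ≤
        C₂ * Real.exp 8 * (x ^ (1 - 2 * σ) * l ^ (-(2 * σ))) := by
      have h5 := hyε 4 (by norm_num)
      norm_num at h5
      have h6 : 0 < Real.log y := by linarith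
      calc _ ≤ C₂ * (y ^ (4 * ε) * y ^ (1 - 2 * σ)) / Real.log y := h1
        _ = C₂ * y ^ (4 * ε) * (y ^ (1 - 2 * σ) / Real.log y) := by ring
        _ ≤ _ := by gcongr
    have h7 : Real.exp (-2) * D ^ 2 = Real.exp 8 * (C₂ + 1) ^ 2 := by
      rw [hD, mul_pow, ← mul_assoc, ← Real.exp_nat_mul, ← Real.exp_add]
      norm_num
    rw [← Finset.sum_div, ← mul_div_assoc, div_le_iff₀ (by positivity)]
    calc _ ≤ x * (C₂ * Real.exp 8 * (x ^ (1 - 2 * σ) * l ^ (-(2 * σ)))) := by gcongr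
      _ = C₂ * Real.exp 8 * W ^ 2 := by rw [← h3]; ring
      _ ≤ (C₂ + 1) ^ 2 * Real.exp 8 * W ^ 2 := by gcongr; nlinarith
      _ = Real.exp 8 * (C₂ + 1) ^ 2 * W ^ 2 := by ring
      _ = _ := by rw [← h7]; ring
  have key := measure_prime_sum_large_le (P := P₂) (Y := N) (fun p hp => (hP₂p p hp).1)
    (fun p hp => primesBelow_subset_Icc (Finset.mem_filter.mp hp).1) (k := k) (T := T)
    (ρ := 3 - σ + ε) (ρ' := 3 - σ + 2 * ε) (lam := D * W) hT hNT (by linarith) (by linarith)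
    (by positivity)
  refine le_trans (measureReal_Icc_inter_mono fun t _ => ?_) (key.trans ?_)
  · rintro ⟨z, hz, hzl⟩
    refine ⟨z, hz, ?_⟩
    have h8 := abs_le.mp ((Complex.abs_re_le_norm _).trans (mem_closedBall_iff_norm.mp hz))
    simp at h8
    have h9 := hS₁ z (by linarith [h8.1])
    have h10 := norm_add_le (∑ p ∈ P₁, (p : ℂ) ^ (-z)) (∑ p ∈ P₂, (p : ℂ) ^ (-z))
    rw [← hsplit] at h10
    nlinarith
  · have h11 : (x * (∑ p ∈ P₂, (p : ℝ) ^ (-(2 * (3 - (3 - σ + 2 * ε))))) / (D * W) ^ 2) ^ k ≤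
        Real.exp (-2) ^ k := by
      gcongr
      rw [← Finset.sum_div, ← mul_div_assoc] at hS₂
      exact hS₂
    -- One factor `e^(-k)` is the saving; the other pays for the factor `3k` due to the narrow gap
    -- between the radii.
    have h12 : Real.exp (-2) ^ k = Real.exp (-x) * Real.exp (-x) := by
      rw [← Real.exp_nat_mul, ← Real.exp_add]
      congr 1
      ring
    have h13 : (3 - σ + 2 * ε) / (3 - σ + 2 * ε - (3 - σ + ε)) ≤ 3 * x := by
      rw [show 3 - σ + 2 * ε - (3 - σ + ε) = ε by ring, hε, div_div_eq_mul_div, div_one]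
      calc (3 - σ + 2 * (1 / l)) * l ≤ 3 * l := by gcongr; linarith
        _ ≤ 3 * x := by gcongr
    have h14 : x * Real.exp (-x) ≤ 1 := by
      rw [Real.exp_neg, ← div_eq_mul_inv, div_le_one (Real.exp_pos x)]
      linarith [Real.add_one_le_exp x]
    calc _ ≤ 3 * x * (3 * T) * (Real.exp (-x) * Real.exp (-x)) := by
          rw [← h12]; gcongr
      _ = 9 * T * Real.exp (-x) * (x * Real.exp (-x)) := by ring
      _ ≤ 9 * T * Real.exp (-x) * 1 := by gcongr
      _ ≤ _ := by
        rw [mul_one]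
        gcongr
        linarith [show 0 < Real.exp 2 * C₁ by positivity]

/-- At the threshold `log T` no splitting is needed: `∑ p^(-2 Re z)` is bounded, so for `k ≤ log T`
the base of the `k`-th power is `O(1 / log T)`. -/
theorem exists_measure_log_le_primeSum_le {ρ : ℝ} (hρ : 2 ≤ ρ) (hρ' : ρ < 5 / 2) :
    ∃ C T₀ : ℝ, 0 < C ∧ ∀ (k N : ℕ) (T : ℝ), T₀ ≤ T → ((N : ℝ) ^ k) ^ 2 ≤ T → k ≤ Real.log T →
      volume.real {t ∈ Set.Icc T (2 * T) | ∃ z ∈ Metric.closedBall ((3 : ℂ) + t * I) ρ,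
          Real.log T ≤ ‖primeSum N z‖} ≤ C * T * Real.exp (-k) := by
  set ρ' := (ρ + 5 / 2) / 2 with hρ'd
  have h1 : ρ < ρ' := by rw [hρ'd]; linarith
  have h2 : ρ' < 5 / 2 := by rw [hρ'd]; linarith
  have hsum : Summable fun n : ℕ => (n : ℝ) ^ (-(2 * (3 - ρ'))) :=
    Real.summable_nat_rpow.mpr (by linarith)
  set S := ∑' n : ℕ, (n : ℝ) ^ (-(2 * (3 - ρ'))) with hS
  have hS0 : 0 ≤ S := tsum_nonneg fun n => by positivity
  refine ⟨ρ' / (ρ' - ρ) * 3, Real.exp (S * Real.exp 1 + 1),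
    mul_pos (div_pos (by linarith) (by linarith)) (by norm_num), ?_⟩
  intro k N T hT hNT hk
  have hT0 : 0 < T := (Real.exp_pos _).trans_le hT
  set ℓ := Real.log T with hℓ
  have hℓS : S * Real.exp 1 + 1 ≤ ℓ := (Real.le_log_iff_exp_le hT0).mpr hT
  have hℓ0 : 0 < ℓ := by
    have : 0 ≤ S * Real.exp 1 := by positivity
    linarith
  have key := measure_prime_sum_large_le (P := N.primesBelow) (Y := N)
    (fun p hp => Nat.prime_of_mem_primesBelow hp)
    (fun p hp => primesBelow_subset_Icc hp) (k := k) (T := T)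
    (ρ := ρ) (ρ' := ρ') (lam := ℓ) hT0.le hNT (by linarith) h1 hℓ0
  refine key.trans ?_
  have h3 : (k : ℝ) * (∑ p ∈ N.primesBelow, (p : ℝ) ^ (-(2 * (3 - ρ')))) / ℓ ^ 2 ≤ Real.exp (-1) := by
    rw [div_le_iff₀ (by positivity), Real.exp_neg, ← div_eq_inv_mul, le_div_iff₀ (Real.exp_pos 1)]
    calc _ ≤ ℓ * S * Real.exp 1 := by
          gcongr
          exact hsum.sum_le_tsum _ fun n _ => by positivity
      _ ≤ ℓ * ℓ := by rw [mul_assoc]; gcongr; linarith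
      _ = _ := by ring
  have h4 : Real.exp (-1) ^ k = Real.exp (-k) := by
    rw [← Real.exp_nat_mul]
    congr 1
    ring
  have h5 : 0 < ρ' / (ρ' - ρ) := div_pos (by linarith) (by linarith)
  rw [← h4, mul_assoc _ 3 T]
  gcongr

/-! ### Cauchy's estimate, the choice of parameters and the theorem. -/

/-- Cauchy's estimate on circles of radius `ε`. The centres `3/4 + it` and `3 + it` are `9/4` apart,
and `r + 9/4 = 3 - sigmaOf r`. -/
theorem maxZetaDeriv_le {r t ε M : ℝ} (hr0 : 0 ≤ r) (hr : r < 1 / 4) (ht : 6 ≤ t) (hε : 0 < ε)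
    (hε' : ε ≤ 1)
    (hM : ∀ z ∈ Metric.closedBall ((3 : ℂ) + t * I) (3 - sigmaOf r + ε), ‖riemannZeta z‖ ≤ M) :
    maxZetaDeriv r t ≤ M / ε := by
  obtain ⟨z, hz, hzmax⟩ := (isGreatest_maxZetaDeriv hr0 hr t).1
  rw [← hzmax]
  set s : ℂ := 3 / 4 + I * t + z with hs
  have hz' : ‖z‖ ≤ r := mem_closedBall_zero_iff.mp hz
  have hsub : Metric.closedBall s ε ⊆ Metric.closedBall ((3 : ℂ) + t * I) (3 - sigmaOf r + ε) := by
    intro w hw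
    rw [mem_closedBall_iff_norm] at hw ⊢
    have h1 : w - (3 + t * I) = (w - s) + (z - 9 / 4) := by rw [hs]; ring
    rw [h1]
    have h2 : ‖z - 9 / 4‖ ≤ r + 9 / 4 := by
      refine (norm_sub_le _ _).trans (add_le_add hz' (le_of_eq ?_))
      norm_num
    refine (norm_add_le _ _).trans ?_
    rw [sigmaOf]
    linarith
  refine Complex.norm_deriv_le_of_forall_mem_sphere_norm_le hε ?_
    (fun w hw => hM w (hsub (Metric.sphere_subset_closedBall hw)))
  apply DifferentiableOn.diffContOnCl
  intro w hw
  have hw' := hsub (Metric.closure_ball_subset_closedBall hw)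
  have hw1 : w ≠ 1 := by
    rintro rfl
    have h3 := (Complex.abs_im_le_norm _).trans (mem_closedBall_iff_norm.mp hw')
    simp [sigmaOf] at h3
    have := le_abs_self t
    linarith
  exact (differentiableAt_riemannZeta hw1).differentiableWithinAt

/-- The parameters of the moment method attached to a value `V`, for large `V`. -/
theorem moment_order_bounds {σ κ V : ℝ} (hσ : 1 / 2 < σ) (hσ1 : σ < 3 / 4) (hκ : 0 < κ)
    (hκ1 : κ ≤ 1) (hV : 256 ≤ V) (hVκ : 2 / κ ≤ V) {D : ℝ}
    (hD : D = V ^ (1 / (1 - σ)) * Real.log V ^ (σ / (1 - σ))) {k : ℕ} (hk : k = ⌊κ * D⌋₊) :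
    κ * D / 2 ≤ k ∧ (k : ℝ) ≤ κ * D ∧ V ≤ k ∧ 1 ≤ Real.log k ∧
      Real.log k ≤ Real.exp (V / 4) ∧
      (k : ℝ) ^ (1 - σ) * Real.log k ^ (-σ) ≤ κ ^ (1 - σ) * V := by
  have hV0 : 0 < V := by linarith
  have hV1 : 1 ≤ V := by linarith
  set L := Real.log V with hL
  have hL1 : 1 ≤ L := by
    rw [hL, Real.le_log_iff_exp_le hV0]
    linarith [Real.exp_one_lt_d9]
  have hL0 : 0 < L := by linarith
  have hLV : L ≤ V := by
    have := Real.log_le_sub_one_of_pos hV0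
    linarith
  have hβ : 0 < 1 - σ := by linarith
  have hD0 : 0 < D := by rw [hD]; positivity
  have hDV : V ^ 2 ≤ D := by
    rw [hD, ← Real.rpow_natCast V 2]
    have h1 : V ^ ((2 : ℕ) : ℝ) ≤ V ^ (1 / (1 - σ)) := by
      refine Real.rpow_le_rpow_of_exponent_le hV1 ?_
      rw [le_div_iff₀ hβ]
      push_cast
      linarith
    have h2 : 1 ≤ L ^ (σ / (1 - σ)) := Real.one_le_rpow hL1 (by positivity)
    calc V ^ ((2 : ℕ) : ℝ) ≤ V ^ (1 / (1 - σ)) := h1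
      _ ≤ _ := le_mul_of_one_le_right (by positivity) h2
  have hDV8 : D ≤ V ^ 8 := by
    have h1 : V ^ (1 / (1 - σ)) ≤ V ^ (4 : ℝ) := by
      refine Real.rpow_le_rpow_of_exponent_le hV1 ?_
      rw [div_le_iff₀ hβ]
      linarith
    have h2 : L ^ (σ / (1 - σ)) ≤ V ^ (4 : ℝ) := by
      refine (Real.rpow_le_rpow hL0.le hLV (by positivity)).trans
        (Real.rpow_le_rpow_of_exponent_le hV1 ?_)
      rw [div_le_iff₀ hβ]
      linarith
    calc D ≤ V ^ (4 : ℝ) * V ^ (4 : ℝ) := by rw [hD]; gcongr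
      _ = V ^ 8 := by
        rw [← Real.rpow_add hV0, ← Real.rpow_natCast]
        norm_num
  have hκD : 2 * V ≤ κ * D := by
    rw [div_le_iff₀ hκ] at hVκ
    calc 2 * V ≤ V * κ * V := by gcongr
      _ = κ * V ^ 2 := by ring
      _ ≤ κ * D := by gcongr
  have hkle : (k : ℝ) ≤ κ * D := by
    rw [hk]; exact Nat.floor_le (by positivity)
  have hklt : κ * D < k + 1 := by
    rw [hk]; exact Nat.lt_floor_add_one _
  have hVk : V ≤ k := by linarith
  have hk0 : (0 : ℝ) < k := by linarith
  have hlog : L ≤ Real.log k := Real.log_le_log hV0 hVk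
  refine ⟨by linarith, hkle, hVk, by linarith, ?_, ?_⟩
  · have h1 : Real.log k ≤ 8 * L := by
      calc Real.log k ≤ Real.log (V ^ 8) := by
            refine Real.log_le_log hk0 (hkle.trans ?_)
            calc κ * D ≤ 1 * D := by gcongr
              _ ≤ _ := by linarith
        _ = 8 * L := by rw [Real.log_pow, hL]; norm_num
    -- `V ≥ 256` enters here: `(V/4)²/2 ≥ 8V ≥ 8 log V ≥ log k`.
    have h2 := Real.quadratic_le_exp_of_nonneg (show 0 ≤ V / 4 by positivity)
    nlinarith
  · have h1 : Real.log k ^ (-σ) ≤ L ^ (-σ) :=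
      Real.rpow_le_rpow_of_nonpos hL0 hlog (by linarith)
    have h2 : (k : ℝ) ^ (1 - σ) ≤ κ ^ (1 - σ) * (V * L ^ σ) := by
      calc (k : ℝ) ^ (1 - σ) ≤ (κ * D) ^ (1 - σ) := by gcongr
        _ = _ := by
          rw [Real.mul_rpow hκ.le hD0.le, hD, Real.mul_rpow (by positivity) (by positivity),
            ← Real.rpow_mul hV0.le, ← Real.rpow_mul hL0.le, div_mul_cancel₀ _ hβ.ne',
            div_mul_cancel₀ _ hβ.ne', Real.rpow_one]
    calc _ ≤ κ ^ (1 - σ) * (V * L ^ σ) * L ^ (-σ) := by gcongr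
      _ = κ ^ (1 - σ) * V * (L ^ σ * L ^ (-σ)) := by ring
      _ = _ := by rw [← Real.rpow_add hL0]; simp

/-- Translates the upper limit for `V` into `D log log T ≤ b log T`, the form in which the moments
of order `k ≤ D` need it. -/
theorem value_rpow_mul_log_rpow_le {σ b V ℓ : ℝ} (hσ : 1 / 2 < σ) (hσ1 : σ < 1) (hb : 0 < b)
    (hb1 : b ≤ 1) (hV : 1 ≤ V) (hℓ : Real.exp 1 ≤ ℓ)
    (h : V ≤ b * ℓ ^ (1 - σ) / Real.log ℓ) :
    V ^ (1 / (1 - σ)) * Real.log V ^ (σ / (1 - σ)) ≤ b * ℓ / Real.log ℓ := by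
  have hℓ0 : 0 < ℓ := (Real.exp_pos _).trans_le hℓ
  have hV0 : 0 < V := by linarith
  have hβ : 0 < 1 - σ := by linarith
  set m := Real.log ℓ with hm
  have hm1 : 1 ≤ m := (Real.le_log_iff_exp_le hℓ0).mpr hℓ
  have hm0 : 0 < m := by linarith
  have hℓ1 : 1 ≤ ℓ := by linarith [Real.add_one_le_exp 1]
  have hVℓ : V ≤ ℓ := by
    refine h.trans ?_
    rw [div_le_iff₀ hm0]
    calc b * ℓ ^ (1 - σ) ≤ 1 * ℓ ^ (1 : ℝ) := by
          have := Real.rpow_le_rpow_of_exponent_le hℓ1 (show 1 - σ ≤ 1 by linarith)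
          gcongr
      _ = ℓ * 1 := by rw [Real.rpow_one]; ring
      _ ≤ ℓ * m := by gcongr
  have hL : Real.log V ≤ m := Real.log_le_log hV0 hVℓ
  calc V ^ (1 / (1 - σ)) * Real.log V ^ (σ / (1 - σ))
      ≤ (b * ℓ ^ (1 - σ) / m) ^ (1 / (1 - σ)) * m ^ (σ / (1 - σ)) := by
        have := Real.log_nonneg hV
        gcongr
    _ = b ^ (1 / (1 - σ)) * ℓ * (m ^ (-(1 / (1 - σ))) * m ^ (σ / (1 - σ))) := by
        rw [Real.div_rpow (by positivity) hm0.le, Real.mul_rpow hb.le (by positivity),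
          ← Real.rpow_mul hℓ0.le, mul_one_div_cancel hβ.ne', Real.rpow_one, Real.rpow_neg hm0.le]
        ring
    _ = b ^ (1 / (1 - σ)) * ℓ / m := by
        rw [← Real.rpow_add hm0, show -(1 / (1 - σ)) + σ / (1 - σ) = -1 by field_simp; ring,
          Real.rpow_neg_one, ← div_eq_mul_inv]
    _ ≤ b ^ (1 : ℝ) * ℓ / m := by
        gcongr ?_ * ℓ / m
        refine Real.rpow_le_rpow_of_exponent_ge hb hb1 ?_
        rw [le_div_iff₀ hβ]
        linarith
    _ = _ := by rw [Real.rpow_one]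

/-- The exponent `A + 1` in place of `A` absorbs the rounding up, since `log T ≥ 2`. -/
theorem natCeil_log_rpow_pow_le {A T : ℝ} {k : ℕ} (hA : 0 < A) (hT : 1 < T)
    (hℓ : 2 ≤ Real.log T)
    (hk : 2 * (A + 1) * (k * Real.log (Real.log T)) ≤ Real.log T) :
    (((⌈Real.log T ^ A⌉₊ : ℕ) : ℝ) ^ k) ^ 2 ≤ T := by
  set ℓ := Real.log T with hℓd
  have hℓ0 : 0 < ℓ := by linarith
  have h1 : 1 ≤ ℓ ^ A := Real.one_le_rpow (by linarith) hA.le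
  have hN : ((⌈ℓ ^ A⌉₊ : ℕ) : ℝ) ≤ ℓ ^ (A + 1) := by
    rw [Real.rpow_add hℓ0, Real.rpow_one]
    have := Nat.ceil_lt_add_one (show 0 ≤ ℓ ^ A by positivity)
    nlinarith
  calc (((⌈ℓ ^ A⌉₊ : ℕ) : ℝ) ^ k) ^ 2 ≤ ((ℓ ^ (A + 1)) ^ k) ^ 2 := by gcongr
    _ = Real.exp (2 * (A + 1) * (k * Real.log ℓ)) := by
      rw [Real.rpow_def_of_pos hℓ0, ← Real.exp_nat_mul, ← Real.exp_nat_mul]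
      congr 1
      push_cast
      ring
    _ ≤ Real.exp ℓ := Real.exp_le_exp.mpr hk
    _ = T := Real.exp_log (by linarith)

set_option maxHeartbeats 400000 in
theorem proposition2p1 (r : ℝ) (hr0 : 0 < r) (hr : r < 1 / 4) :
    ∃ b₁ b₂ b₃ C : ℝ, 0 < b₁ ∧ 0 < b₂ ∧ 0 < b₃ ∧ 0 < C ∧
      ∀ T V : ℝ, 3 ≤ T → b₂ < V →
        V ≤ b₃ * Real.log T ^ (1 - sigmaOf r) / Real.log (Real.log T) →
        probT T {t : ℝ | maxZetaDeriv r t > Real.exp V} ≤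
          C * Real.exp (-b₁ * V ^ (1 / (1 - sigmaOf r)) *
            Real.log V ^ (sigmaOf r / (1 - sigmaOf r))) := by
  have hmax := @maxZetaDeriv_le r
  have hσ : 1 / 2 < sigmaOf r := by unfold sigmaOf; linarith
  have hσ1 : sigmaOf r < 3 / 4 := by unfold sigmaOf; linarith
  generalize sigmaOf r = σ at *
  have hβ : 0 < 1 - σ := by linarith
  -- Radii at thirds of the gap between `3 - σ` and `5/2`, the radius reaching the critical line.
  set ρ₁ := 3 - σ + (σ - 1 / 2) / 3 with hρ₁
  set ρ₃ := 3 - σ + 2 * (σ - 1 / 2) / 3 with hρ₃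
  obtain ⟨Cw, k₀, hCw, hE₃⟩ := exists_measure_primeSum_large_le hσ (by linarith)
  obtain ⟨A, Cz, Tz, hA, hzeta⟩ := exists_norm_zeta_le_exp_primeSum (ρ₁ := ρ₁) (ρ₃ := ρ₃)
    (by linarith) (by linarith) (by linarith)
  obtain ⟨C₂, T₂, hC₂, hE₂⟩ := exists_measure_log_le_primeSum_le (ρ := ρ₃) (by linarith)
    (by linarith)
  obtain ⟨c, C₁, T₁, hc, hC₁, hE₁⟩ := exists_measure_zeta_zero_le (ρ := ρ₃) (by linarith)
    (by linarith)
  -- Makes the threshold `Cw W` for the prime sum at most `V/4`.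
  set κ := min 1 ((1 / (4 * Cw)) ^ (1 / (1 - σ))) with hκd
  have hκ : 0 < κ := lt_min one_pos (by positivity)
  have hκ1 : κ ≤ 1 := min_le_left _ _
  have hκC : Cw * κ ^ (1 - σ) ≤ 1 / 4 := by
    have h1 : κ ^ (1 - σ) ≤ 1 / (4 * Cw) := by
      calc κ ^ (1 - σ) ≤ ((1 / (4 * Cw)) ^ (1 / (1 - σ))) ^ (1 - σ) := by
            gcongr
            exact min_le_right _ _
        _ = _ := by
          rw [← Real.rpow_mul (by positivity), one_div_mul_cancel hβ.ne', Real.rpow_one]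
    calc Cw * κ ^ (1 - σ) ≤ Cw * (1 / (4 * Cw)) := by gcongr
      _ = 1 / 4 := by field_simp
  -- `b₃ ≤ c` gives `T^(-c) ≤ e^(-k)` for the zeros, and `2(A + 1) b₃ ≤ 1` gives `N^(2k) ≤ T` for
  -- the moments.
  set b₃ := min 1 (min c (1 / (2 * (A + 1)))) with hb₃d
  have hb₃ : 0 < b₃ := lt_min one_pos (lt_min hc (by positivity))
  have hb₃1 : b₃ ≤ 1 := min_le_left _ _
  have hb₃c : b₃ ≤ c := (min_le_right _ _).trans (min_le_left _ _)
  have hb₃A : 2 * (A + 1) * b₃ ≤ 1 := by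
    have h1 : b₃ ≤ 1 / (2 * (A + 1)) := (min_le_right _ _).trans (min_le_right _ _)
    rwa [le_div_iff₀ (by positivity), mul_comm] at h1
  obtain ⟨Ts, hTs⟩ : ∃ Ts : ℝ, 3 ≤ Ts ∧ Real.exp (Real.exp 1) ≤ Ts ∧ 6 ≤ Ts ∧ Tz ≤ Ts ∧
      T₁ ≤ Ts ∧ T₂ ≤ Ts :=
    ((Filter.eventually_ge_atTop 3).and <| (Filter.eventually_ge_atTop _).and <|
      (Filter.eventually_ge_atTop 6).and <| (Filter.eventually_ge_atTop _).and <|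
      (Filter.eventually_ge_atTop _).and (Filter.eventually_ge_atTop _)).exists
  obtain ⟨hTs3, hTse, hTs6, hTsz, hTs1, hTs2⟩ := hTs
  have hlog3 : 1 < Real.log 3 := by
    rw [Real.lt_log_iff_exp_lt (by norm_num)]
    linarith [Real.exp_one_lt_d9]
  obtain ⟨b₂, hb₂⟩ : ∃ b₂ : ℝ, 256 ≤ b₂ ∧ 2 / κ ≤ b₂ ∧ 4 * Cz ≤ b₂ ∧ k₀ ≤ b₂ ∧
      Real.exp (3 / (σ - 1 / 2)) ≤ b₂ ∧
      b₃ * Real.log Ts ^ (1 - σ) / Real.log (Real.log 3) ≤ b₂ :=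
    ((Filter.eventually_ge_atTop 256).and <| (Filter.eventually_ge_atTop _).and <|
      (Filter.eventually_ge_atTop _).and <| (Filter.eventually_ge_atTop _).and <|
      (Filter.eventually_ge_atTop _).and (Filter.eventually_ge_atTop _)).exists
  obtain ⟨hb256, hbκ, hbz, hbk, hbσ, hbT⟩ := hb₂
  -- The halving in `b₁ = κ/2` covers the integer part in `k = ⌊κ D⌋₊`; the three exceptional sets
  -- add up to `C`.
  refine ⟨κ / 2, b₂, b₃, C₁ + C₂ + Cw, by positivity, by linarith, hb₃, by positivity, ?_⟩
  intro T V hT3 hbV hVT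
  -- For `3 ≤ T < Ts` the upper limit for `V` does not exceed `b₂`, so the range of `V` is empty.
  have hTsT : Ts ≤ T := by
    by_contra! hlt
    refine absurd (hbV.trans_le hVT) (not_lt.mpr (le_trans ?_ hbT))
    have h1 : Real.log 3 ≤ Real.log T := Real.log_le_log (by norm_num) hT3
    have h2 : 0 < Real.log (Real.log 3) := Real.log_pos hlog3
    have h3 : Real.log T ^ (1 - σ) ≤ Real.log Ts ^ (1 - σ) :=
      Real.rpow_le_rpow (by linarith) (Real.log_le_log (by linarith) hlt.le) hβ.le
    have h4 : 0 ≤ b₃ * Real.log Ts ^ (1 - σ) :=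
      mul_nonneg hb₃.le (Real.rpow_nonneg (Real.log_nonneg (by linarith)) _)
    exact div_le_div₀ h4 (mul_le_mul_of_nonneg_left h3 hb₃.le) h2
      (Real.log_le_log (by linarith) h1)
  have hT0 : 0 < T := by linarith
  have hℓe : Real.exp 1 ≤ Real.log T := (Real.le_log_iff_exp_le hT0).mpr (hTse.trans hTsT)
  set ℓ := Real.log T with hℓ
  have hℓ2 : 2 ≤ ℓ := by linarith [Real.add_one_le_exp 1]
  have hm1 : 1 ≤ Real.log ℓ := (Real.le_log_iff_exp_le (by linarith)).mpr hℓe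
  set D := V ^ (1 / (1 - σ)) * Real.log V ^ (σ / (1 - σ)) with hD
  obtain ⟨hkD, hkκ, hVk, hlogk, hlogV, hW⟩ := moment_order_bounds hσ hσ1 hκ hκ1 (by linarith)
    (hbκ.trans hbV.le) hD rfl
  set k := ⌊κ * D⌋₊ with hk
  have hD0 : 0 < D := by
    have : 0 < Real.log V := Real.log_pos (by linarith)
    have : 0 < V := by linarith
    positivity
  have hDℓ : D ≤ b₃ * ℓ / Real.log ℓ :=
    value_rpow_mul_log_rpow_le hσ (by linarith) hb₃ hb₃1 (by linarith) hℓe hVT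
  have hkm : k * Real.log ℓ ≤ b₃ * ℓ := by
    rw [le_div_iff₀ (by linarith)] at hDℓ
    refine le_trans ?_ hDℓ
    gcongr
    exact hkκ.trans (mul_le_of_le_one_left hD0.le hκ1)
  have hkb : k ≤ b₃ * ℓ := le_trans (le_mul_of_one_le_right (by positivity) hm1) hkm
  have hkℓ : k ≤ ℓ := hkb.trans (mul_le_of_le_one_left (by linarith) hb₃1)
  have hkc : k ≤ c * ℓ := hkb.trans (by gcongr)
  set N := ⌈ℓ ^ A⌉₊ with hN
  have hNT : ((N : ℝ) ^ k) ^ 2 ≤ T := by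
    refine natCeil_log_rpow_pow_le hA (by linarith) hℓ2 ?_
    calc 2 * (A + 1) * (k * Real.log ℓ) ≤ 2 * (A + 1) * (b₃ * ℓ) := by gcongr
      _ = 2 * (A + 1) * b₃ * ℓ := by ring
      _ ≤ 1 * ℓ := by gcongr
      _ = ℓ := one_mul _
  set ε := 1 / Real.log k with hε
  have hε0 : 0 < ε := by positivity
  have hε1 : ε ≤ 1 := by rw [hε, div_le_one (by linarith)]; exact hlogk
  have hερ : 3 - σ + ε ≤ ρ₁ := by
    have h1 : 3 / (σ - 1 / 2) ≤ Real.log k := by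
      rw [Real.le_log_iff_exp_le (by linarith)]
      linarith
    rw [div_le_iff₀ (by linarith)] at h1
    have h2 : ε ≤ (σ - 1 / 2) / 3 := by
      rw [hε, div_le_iff₀ (by linarith)]
      linarith
    linarith
  set W := (k : ℝ) ^ (1 - σ) * Real.log k ^ (-σ) with hWd
  have hCW : Cw * W ≤ V / 4 := by
    have h0 : 0 ≤ V := by linarith
    calc Cw * W ≤ Cw * (κ ^ (1 - σ) * V) := by gcongr
      _ = Cw * κ ^ (1 - σ) * V := by ring
      _ ≤ 1 / 4 * V := by gcongr
      _ = V / 4 := by ring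
  -- Outside the three sets the exponent `V` is met in quarters: `Cz ≤ V/4`, the prime sum is at
  -- most `V/4`, and the Cauchy factor `log k` is at most `e^(V/4)`.
  have hexp : ∀ t ∈ Set.Icc T (2 * T), Real.exp V < maxZetaDeriv r t →
      (∃ z ∈ Metric.closedBall ((3 : ℂ) + t * I) ρ₃, riemannZeta z = 0) ∨
      ((∃ z ∈ Metric.closedBall ((3 : ℂ) + t * I) ρ₃, ℓ ≤ ‖primeSum N z‖) ∨
      ∃ z ∈ Metric.closedBall ((3 : ℂ) + t * I) (3 - σ + ε), Cw * W ≤ ‖primeSum N z‖) := by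
    intro t ht
    contrapose!
    rintro ⟨h1, h2, h3⟩
    have h4 : ∀ z ∈ Metric.closedBall ((3 : ℂ) + t * I) (3 - σ + ε),
        ‖riemannZeta z‖ ≤ Real.exp (Cz + V / 4) := by
      intro z hz
      refine (hzeta T (hTsz.trans hTsT) t ht h1 (fun w hw => (h2 w hw).le) z
        (Metric.closedBall_subset_closedBall hερ hz)).trans (Real.exp_le_exp.mpr ?_)
      have := h3 z hz
      linarith
    calc maxZetaDeriv r t ≤ Real.exp (Cz + V / 4) / ε :=
          hmax hr0.le hr (by linarith [ht.1]) hε0 hε1 h4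
      _ = Real.exp (Cz + V / 4) * Real.log k := by rw [hε, div_div_eq_mul_div, div_one]
      _ ≤ Real.exp (Cz + V / 4) * Real.exp (V / 4) := by gcongr
      _ = Real.exp (Cz + V / 4 + V / 4) := (Real.exp_add _ _).symm
      _ ≤ Real.exp V := Real.exp_le_exp.mpr (by linarith)
  have hfinal : volume.real {t ∈ Set.Icc T (2 * T) | Real.exp V < maxZetaDeriv r t} ≤
      (C₁ + C₂ + Cw) * T * Real.exp (-k) := by
    have e1 := hE₁ T (hTs1.trans hTsT)
    have e2 := hE₂ k N T (hTs2.trans hTsT) hNT hkℓ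
    have e3 := hE₃ k N T (by linarith) hT0.le hNT
    have e4 : T ^ (1 - c) ≤ T * Real.exp (-k) := by
      rw [sub_eq_add_neg, Real.rpow_add hT0, Real.rpow_one, Real.rpow_def_of_pos hT0]
      gcongr
      linarith
    calc _ ≤ _ := measureReal_Icc_inter_mono hexp
      _ ≤ C₁ * T ^ (1 - c) + (C₂ * T * Real.exp (-k) + Cw * T * Real.exp (-k)) := by
        simp only [Set.sep_or]
        exact (measureReal_union_le _ _).trans
          (add_le_add e1 ((measureReal_union_le _ _).trans (add_le_add e2 e3)))
      _ ≤ C₁ * (T * Real.exp (-k)) + (C₂ * T * Real.exp (-k) + Cw * T * Real.exp (-k)) := by gcongr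
      _ = _ := by ring
  calc probT T {t : ℝ | maxZetaDeriv r t > Real.exp V}
      ≤ 1 / T * ((C₁ + C₂ + Cw) * T * Real.exp (-k)) := by
        unfold probT
        gcongr
        exact hfinal
    _ = (C₁ + C₂ + Cw) * Real.exp (-k) := by field_simp
    _ ≤ _ := by
      gcongr
      rw [mul_assoc, ← hD]
      linarith
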